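/- Fix a prime $\ell$ and let $K$ be an arbitrary field. For a Krull valuation $v$ of a field, write $\mathcal O_v,\mathfrak m_v,\Gamma_v,k(v)$ for its valuation ring, maximal ideal, value group and residue field. Valuations are taken up to equivalence, the trivial one is allowed, and "finer" means finer or equal. The $\ell$-adic completion of an abelian group $W$ is $\widehat W=\varprojlim_n W/\ell^n$, and $\widehat K$ denotes the $\ell$-adic completion of $K^\times$, a topological $\mathbb Z_\ell$-module. Submodules of $\widehat K$ are always taken closed, and $\mathrm{tor}(M)$ is the torsion submodule of a $\mathbb Z_\ell$-module $M$. Cyclic groups and modules may be trivial. **Mod-$\ell$ definitions.** A subgroup $T\le K^\times$ containing $K^{\times\ell}$ is *rigid* if for all $x\in K^\times\smallsetminus T$ the image of $\langle x,1-x\rangle$ in $K^\times/T$ is cyclic. For $\langle K^{\times\ell},-1\rangle\le T\le K^\times$ let $\mathbf H(T)$ be the intersection of all $H$ with $T\le H\le K^\times$ and $K^\times/H$ cyclic such that $H\cap H'$ is rigid for every $H'$ with $T\le H'\le K^\times$ and $K^\times/H'$ cyclic. Put $\mathfrak U_v=\mathcal O_v^\times\cdot K^{\times\ell}$ and $\mathfrak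 U_v^1=\langle 1+\mathfrak m_v,-1,K^{\times\ell}\rangle$. Let $\mathcal V_K$ be the set of valuations $v$ of $K$ such that $\Gamma_v$ has no non-trivial $\ell$-divisible convex subgroup, $k(v)^\times/\langle k(v)^{\times\ell},-1\rangle$ is non-cyclic, and $\mathbf H(\langle k(v)^{\times\ell},-1\rangle)=k(v)^\times$. Let $\mathcal T_K$ be the set of subgroups $\langle K^{\times\ell},-1\rangle\le T\le K^\times$ such that $T\ne\mathbf H(T)$ and $\mathbf H(T')\not\le\mathbf H(T)$ whenever $\langle K^{\times\ell},-1\rangle\le T'\lneq T$. For $v\in\mathcal V_K$ let $\mathcal V_K^v$ be the set of $w\in\mathcal V_K$ finer than $v$, and $\mathcal T_K^v$ the set of $T\in\mathcal T_K$ with $\mathfrak U_v^1\le T\le\mathbf H(T)\le\mathfrak U_v$. For a subgroup $T$ with $\mathfrak U_v^1\le T\le\mathfrak U_v$ let $T_v$ be the image of $T\cap\mathcal O_v^\times$ in $k(v)^\times$. **Pro-$\ell$ definitions.** A submodule $\widehat T\le\widehat K$ is *rigid* if for all $x\in K^\times$ whose image in $\widehat K$ is not in $\widehat T$, the submodule of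 $\widehat K/\widehat T$ generated by $x$ and $1-x$ is $\mathbb Z_\ell$-cyclic. For $\widehat T$ with $\widehat K/\widehat T$ torsion-free let $\mathbf H(\widehat T)$ be the intersection of all $\widehat H\ge\widehat T$ with $\widehat K/\widehat H$ torsion-free cyclic such that $\widehat H\cap\widehat H'$ is rigid for every $\widehat H'\ge\widehat T$ with $\widehat K/\widehat H'$ torsion-free cyclic. Let $\mathcal U_v\le\widehat K$ be the $\ell$-adic completion of $\mathcal O_v^\times$, and $\mathcal U_v^1$ the kernel of $\mathcal U_v\to\widehat{k(v)}/\mathrm{tor}(\widehat{k(v)})$. Let $\widehat{\mathcal V}_K$ be the set of valuations $v$ of $K$ such that $\Gamma_v$ has no non-trivial $\ell$-divisible convex subgroup, $\widehat{k(v)}/\mathrm{tor}(\widehat{k(v)})$ is non-cyclic, and $\mathbf H(\mathrm{tor}(\widehat{k(v)}))=\widehat{k(v)}$. Let $\widehat{\mathcal T}_K$ be the set of submodules $\widehat T\le\widehat K$ with $\widehat K/\widehat T$ torsion-free such that $\widehat T\neq\mathbf H(\widehat T)$ and $\mathbf H(\widehat T')\not\le\mathbf H(\widehat T)$ whenever $\widehat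 T'\lneq\widehat T$ and $\widehat K/\widehat T'$ is torsion-free. For $v\in\widehat{\mathcal V}_K$ let $\widehat{\mathcal V}_K^v$ be the set of $w\in\widehat{\mathcal V}_K$ finer than $v$, and $\widehat{\mathcal T}_K^v$ the set of $\widehat T\in\widehat{\mathcal T}_K$ with $\mathcal U_v^1\le\widehat T\le\mathbf H(\widehat T)\le\mathcal U_v$. For a submodule $\widehat T$ with $\mathcal U_v^1\le\widehat T\le\mathcal U_v$ let $\widehat T_v$ be the image of $\widehat T\cap\mathcal U_v$ in $\widehat{k(v)}$. **Theorem.** (a) The map $v\mapsto\mathfrak U_v^1$ is a bijection $\mathcal V_K\to\mathcal T_K$. For each $v\in\mathcal V_K$ it restricts to a bijection $\mathcal V_K^v\to\mathcal T_K^v$. Moreover, for each $v\in\mathcal V_K$, the map $w\mapsto w\circ v$ (composition of valuations) is a bijection $\mathcal V_{k(v)}\to\mathcal V_K^v$; for each $T'\in\mathcal T_{k(v)}$ there is a unique $T$ with $\mathfrak U_v^1\le T\le\mathfrak U_v$ and $T_v=T'$, and $T'\mapsto T$ is a bijection $\mathcal T_{k(v)}\to\mathcal T_K^v$; and the following diagram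 of bijections commutes: $$\begin{array}{ccc}\mathcal V_K^v&\longrightarrow&\mathcal T_K^v\\ \uparrow&&\uparrow\\ \mathcal V_{k(v)}&\longrightarrow&\mathcal T_{k(v)}\end{array}$$ (b) The map $v\mapsto\mathcal U_v^1$ is a bijection $\widehat{\mathcal V}_K\to\widehat{\mathcal T}_K$. For each $v\in\widehat{\mathcal V}_K$ it restricts to a bijection $\widehat{\mathcal V}_K^v\to\widehat{\mathcal T}_K^v$. Moreover, for each $v\in\widehat{\mathcal V}_K$, the map $w\mapsto w\circ v$ is a bijection $\widehat{\mathcal V}_{k(v)}\to\widehat{\mathcal V}_K^v$; for each $\widehat T'\in\widehat{\mathcal T}_{k(v)}$ there is a unique submodule $\widehat T$ with $\mathcal U_v^1\le\widehat T\le\mathcal U_v$ and $\widehat T_v=\widehat T'$, and $\widehat T'\mapsto\widehat T$ is a bijection $\widehat{\mathcal T}_{k(v)}\to\widehat{\mathcal T}_K^v$; and the following diagram of bijections commutes: $$\begin{array}{ccc}\widehat{\mathcal V}_K^v&\longrightarrow&\widehat{\mathcal T}_K^v\\ \uparrow&&\uparrow\\ \widehat{\mathcal V}_{k(v)}&\longrightarrow&\widehat{\mathcal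 T}_{k(v)}\end{array}$$ -/

import Mathlib

/-! Valuations of a field `K` (up to equivalence) are represented by their valuation rings,
i.e. by terms of `ValuationSubring K`; the trivial valuation is `⊤`, and `B ≤ A` means that
`B` is finer than `A` (or equal to it). -/

namespace RigidVal

noncomputable section

universe u

/-! ### Valuations: value groups and composition -/

/-- `Γ_v` has no non-trivial `ℓ`-divisible convex subgroups.
Here `Γ_v` is the group of units of `A.ValueGroup` (the value group with a zero adjoined),
written multiplicatively. -/
def NoDivisibleConvex {K : Type u} [Field K] (ℓ : ℕ) (A : ValuationSubring K) : Prop :=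
  ∀ Δ : Subgroup (A.ValueGroup)ˣ, (Δ : Set (A.ValueGroup)ˣ).OrdConnected →
    (∀ g ∈ Δ, ∃ h ∈ Δ, h ^ ℓ = g) → Δ = ⊥

/-- The valuation-theoretic composition `w ∘ v`: if `A = 𝒪_v ⊆ K` and `B = 𝒪_w ⊆ k(v)`, its
valuation ring consists of the `x ∈ 𝒪_v` whose residue lies in `𝒪_w`. -/
def compVal {K : Type u} [Field K] (A : ValuationSubring K)
    (B : ValuationSubring (IsLocalRing.ResidueField A)) : ValuationSubring K :=
  { (B.toSubring.comap (IsLocalRing.residue A)).map A.subtype with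
    mem_or_inv_mem' := by
      intro x
      have key' : ∀ a : A, (IsLocalRing.residue A a ∈ B) →
          (a : K) ∈ (B.toSubring.comap (IsLocalRing.residue A)).map A.subtype :=
        fun a ha => ⟨a, ha, rfl⟩
      change x ∈ (B.toSubring.comap (IsLocalRing.residue A)).map A.subtype ∨
        x⁻¹ ∈ (B.toSubring.comap (IsLocalRing.residue A)).map A.subtype
      have nonunit : ∀ y : K, y⁻¹ ∉ A → ∀ h : y ∈ A, IsLocalRing.residue A ⟨y, h⟩ ∈ B := by
        intro y hy h
        have h1 : IsLocalRing.residue A ⟨y, h⟩ = 0 := by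
          rw [IsLocalRing.residue_eq_zero_iff]
          have h2 := A.mem_nonunits_iff_or.mpr (Or.inr hy)
          obtain ⟨_, h3⟩ := A.mem_nonunits_iff_exists_mem_maximalIdeal.mp h2
          exact h3
        rw [h1]
        exact B.zero_mem
      by_cases hx : x ∈ A
      · by_cases hx' : x⁻¹ ∈ A
        · by_cases h0 : x = 0
          · left
            subst h0
            exact Subring.zero_mem _
          · have h1 : (⟨x, hx⟩ : A) * ⟨x⁻¹, hx'⟩ = 1 := Subtype.ext (mul_inv_cancel₀ h0)
            have h2 := congrArg (IsLocalRing.residue A) h1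
            rw [map_mul, map_one] at h2
            have h3 := B.mem_or_inv_mem (IsLocalRing.residue A ⟨x, hx⟩)
            rw [← eq_inv_of_mul_eq_one_right h2] at h3
            exact h3.imp (key' ⟨x, hx⟩) (key' ⟨x⁻¹, hx'⟩)
        · left
          exact key' ⟨x, hx⟩ (nonunit x hx' hx)
      · right
        have hx' : x⁻¹ ∈ A := (A.mem_or_inv_mem x).resolve_left hx
        exact key' ⟨x⁻¹, hx'⟩ (nonunit x⁻¹ (by rwa [inv_inv]) hx') }

/-! ### The mod-`ℓ` case: subgroups of `Kˣ` -/

section ModEll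

variable {K : Type u} [Field K]

/-- `K^{×ℓ}`. -/
def powers (ℓ : ℕ) (K : Type u) [Field K] : Subgroup Kˣ := (powMonoidHom ℓ : Kˣ →* Kˣ).range

/-- `⟨K^{×ℓ}, -1⟩`. -/
def powersNeg (ℓ : ℕ) (K : Type u) [Field K] : Subgroup Kˣ :=
  powers ℓ K ⊔ Subgroup.zpowers (-1)

/-- `T` is rigid: for every `x ∈ Kˣ ∖ T` (necessarily `x ≠ 1`, and `y = 1 - x`), the subgroup
`⟨x, 1 - x⟩ mod T` of `Kˣ/T` is cyclic. -/
def Rigid (T : Subgroup Kˣ) : Prop :=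
  ∀ x y : Kˣ, (x : K) + (y : K) = 1 → x ∉ T →
    IsCyclic ((Subgroup.closure {x, y}).map (QuotientGroup.mk' T))

/-- `𝐇(T)`: the intersection of all `H ≥ T` with `Kˣ/H` cyclic such that `H ∩ H'` is rigid
for all `H' ≥ T` with `Kˣ/H'` cyclic. -/
def bigH (T : Subgroup Kˣ) : Subgroup Kˣ :=
  sInf {H | T ≤ H ∧ IsCyclic (Kˣ ⧸ H) ∧
    ∀ H' : Subgroup Kˣ, T ≤ H' → IsCyclic (Kˣ ⧸ H') → Rigid (H ⊓ H')}

/-- `𝔘_v = 𝒪_vˣ · K^{×ℓ}`. -/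
def U (ℓ : ℕ) (A : ValuationSubring K) : Subgroup Kˣ := A.unitGroup ⊔ powers ℓ K

/-- `𝔘_v¹ = ⟨1 + 𝔪_v, -1, K^{×ℓ}⟩`. -/
def U1 (ℓ : ℕ) (A : ValuationSubring K) : Subgroup Kˣ := A.principalUnitGroup ⊔ powersNeg ℓ K

/-- The class `𝒱_K` of valuations. -/
def V (ℓ : ℕ) (K : Type u) [Field K] : Set (ValuationSubring K) :=
  {A | NoDivisibleConvex ℓ A ∧
    ¬ IsCyclic ((IsLocalRing.ResidueField A)ˣ ⧸ powersNeg ℓ (IsLocalRing.ResidueField A)) ∧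
    bigH (powersNeg ℓ (IsLocalRing.ResidueField A)) = ⊤}

/-- The class `𝒯_K` of subgroups of `Kˣ`. -/
def T (ℓ : ℕ) (K : Type u) [Field K] : Set (Subgroup Kˣ) :=
  {S | powersNeg ℓ K ≤ S ∧
    (∀ S' : Subgroup Kˣ, powersNeg ℓ K ≤ S' → S' ≤ S → S' ≠ S → ¬ bigH S' ≤ bigH S) ∧
    S ≠ bigH S}

/-- `𝒱_K^v`: the valuations in `𝒱_K` finer than (or equal to) `v`. -/
def Vrel (ℓ : ℕ) (A : ValuationSubring K) : Set (ValuationSubring K) :=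
  {B | B ∈ V ℓ K ∧ B ≤ A}

/-- `𝒯_K^v`: the `S ∈ 𝒯_K` with `𝔘_v¹ ≤ S ≤ 𝐇(S) ≤ 𝔘_v`. -/
def Trel (ℓ : ℕ) (A : ValuationSubring K) : Set (Subgroup Kˣ) :=
  {S | S ∈ T ℓ K ∧ U1 ℓ A ≤ S ∧ S ≤ bigH S ∧ bigH S ≤ U ℓ A}

/-- `S_v`: the image of `S ∩ 𝒪_vˣ` in `k(v)ˣ`. -/
def residueSubgroup (A : ValuationSubring K) (S : Subgroup Kˣ) :
    Subgroup (IsLocalRing.ResidueField A)ˣ :=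
  (S.comap A.unitGroup.subtype).map A.unitGroupToResidueFieldUnits

/-- The subgroup of `Kˣ` generated by `K^{×ℓ}` and the preimage in `𝒪_vˣ` of a subgroup `S` of
`k(v)ˣ`. If `⟨k(v)^{×ℓ}, -1⟩ ≤ S`, it is the unique subgroup between `𝔘_v¹` and `𝔘_v` whose
image in `k(v)ˣ` is `S`. -/
def liftSubgroup (ℓ : ℕ) (A : ValuationSubring K)
    (S : Subgroup (IsLocalRing.ResidueField A)ˣ) : Subgroup Kˣ :=
  (S.comap A.unitGroupToResidueFieldUnits).map A.unitGroup.subtype ⊔ powers ℓ K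

end ModEll

/-! ### `ℓ`-adic completions of abelian groups -/

section Completion

variable (ℓ : ℕ)

/-- `W/ℓⁿ`, for an abelian group `W` (written additively). -/
def ModPow (W : Type u) [AddCommGroup W] (n : ℕ) : Type u :=
  W ⧸ (nsmulAddMonoidHom (α := W) (ℓ ^ n)).range

instance (W : Type u) [AddCommGroup W] (n : ℕ) : AddCommGroup (ModPow ℓ W n) :=
  inferInstanceAs (AddCommGroup (W ⧸ (nsmulAddMonoidHom (α := W) (ℓ ^ n)).range))

/-- The projection `W → W/ℓⁿ`. -/
def ModPow.mk (W : Type u) [AddCommGroup W] (n : ℕ) : W →+ ModPow ℓ W n :=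
  QuotientAddGroup.mk' (nsmulAddMonoidHom (α := W) (ℓ ^ n)).range

theorem ModPow.mk_surjective (W : Type u) [AddCommGroup W] (n : ℕ) :
    Function.Surjective (ModPow.mk ℓ W n) := QuotientAddGroup.mk'_surjective _

theorem ModPow.pow_nsmul_eq_zero {W : Type u} [AddCommGroup W] {n : ℕ} (x : ModPow ℓ W n) :
    ℓ ^ n • x = 0 := by
  obtain ⟨w, rfl⟩ := ModPow.mk_surjective ℓ W n x
  rw [← map_nsmul]
  exact (QuotientAddGroup.eq_zero_iff _).mpr ⟨w, rfl⟩

instance (W : Type u) [AddCommGroup W] (n : ℕ) : Module (ZMod (ℓ ^ n)) (ModPow ℓ W n) :=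
  AddCommGroup.zmodModule (ModPow.pow_nsmul_eq_zero ℓ)

variable [Fact ℓ.Prime]

/-- `ℤ_ℓ` acts on `W/ℓⁿ` through `ℤ_ℓ → ℤ/ℓⁿ`. -/
instance (W : Type u) [AddCommGroup W] (n : ℕ) : Module ℤ_[ℓ] (ModPow ℓ W n) :=
  Module.compHom (ModPow ℓ W n) (PadicInt.toZModPow (p := ℓ) n)

instance (W : Type u) [AddCommGroup W] (n : ℕ) : TopologicalSpace (ModPow ℓ W n) := ⊥

instance (W : Type u) [AddCommGroup W] (n : ℕ) : DiscreteTopology (ModPow ℓ W n) := ⟨rfl⟩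

theorem ModPow.smul_eq_nsmul {W : Type u} [AddCommGroup W] {n : ℕ} (z : ℤ_[ℓ]) (k : ℕ)
    (h : PadicInt.toZModPow n z = (k : ZMod (ℓ ^ n))) (x : ModPow ℓ W n) : z • x = k • x := by
  change PadicInt.toZModPow n z • x = k • x
  rw [h, Nat.cast_smul_eq_nsmul]

/-- Additive maps `W/ℓⁿ → W'/ℓᵐ` with `m ≤ n` are `ℤ_ℓ`-linear. -/
def ModPow.toLinear {W W' : Type u} [AddCommGroup W] [AddCommGroup W'] {n m : ℕ} (hmn : m ≤ n)
    (f : ModPow ℓ W n →+ ModPow ℓ W' m) : ModPow ℓ W n →ₗ[ℤ_[ℓ]] ModPow ℓ W' m :=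
  { f with
    map_smul' := by
      intro z x
      change f (z • x) = z • f x
      have h1 : PadicInt.toZModPow n z = ((z.appr n : ℕ) : ZMod (ℓ ^ n)) := rfl
      have h2 : PadicInt.toZModPow m z = ((z.appr n : ℕ) : ZMod (ℓ ^ m)) := by
        rw [← PadicInt.cast_toZModPow m n hmn z, h1, ZMod.cast_natCast (pow_dvd_pow ℓ hmn)]
      rw [ModPow.smul_eq_nsmul ℓ z _ h1, ModPow.smul_eq_nsmul ℓ z _ h2, map_nsmul] }

/-- The projection `W/ℓⁿ⁺¹ → W/ℓⁿ`. -/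
def ModPow.trans (W : Type u) [AddCommGroup W] (n : ℕ) :
    ModPow ℓ W (n + 1) →ₗ[ℤ_[ℓ]] ModPow ℓ W n :=
  ModPow.toLinear ℓ n.le_succ (QuotientAddGroup.map _ _ (AddMonoidHom.id W) (by
    rintro _ ⟨w, rfl⟩
    exact ⟨ℓ • w, by simp [pow_succ, mul_smul]⟩))

/-- The map `W/ℓⁿ → W'/ℓⁿ` induced by `f : W → W'`. -/
def ModPow.map {W W' : Type u} [AddCommGroup W] [AddCommGroup W'] (f : W →+ W') (n : ℕ) :
    ModPow ℓ W n →ₗ[ℤ_[ℓ]] ModPow ℓ W' n :=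
  ModPow.toLinear ℓ le_rfl (QuotientAddGroup.map _ _ f (by
    rintro _ ⟨w, rfl⟩
    exact ⟨f w, by simp⟩))

/-- The `ℓ`-adic completion `lim_n W/ℓⁿ` as the `ℤ_ℓ`-module of compatible sequences. -/
def completion (W : Type u) [AddCommGroup W] : Submodule ℤ_[ℓ] (∀ n, ModPow ℓ W n) where
  carrier := {x | ∀ n, ModPow.trans ℓ W n (x (n + 1)) = x n}
  add_mem' := by
    intro x y hx hy n
    simp only [Pi.add_apply, map_add, hx n, hy n]
  zero_mem' := by
    intro n
    simp only [Pi.zero_apply, map_zero]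
  smul_mem' := by
    intro z x hx n
    simp only [Pi.smul_apply, map_smul, hx n]

/-- `Ŵ = lim_n W/ℓⁿ`; its topology is the inverse limit (that is, the `ℓ`-adic) topology. -/
abbrev Hat (W : Type u) [AddCommGroup W] : Type u := completion ℓ W

/-- The canonical map `W → Ŵ`. -/
def toHat (W : Type u) [AddCommGroup W] : W →+ Hat ℓ W where
  toFun w := ⟨fun n => ModPow.mk ℓ W n w, fun _ => rfl⟩
  map_zero' := Subtype.ext (funext fun n => map_zero (ModPow.mk ℓ W n))
  map_add' x y := Subtype.ext (funext fun n => map_add (ModPow.mk ℓ W n) x y)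

/-- The map `Ŵ → Ŵ'` induced by `f : W → W'`. -/
def hatMap {W W' : Type u} [AddCommGroup W] [AddCommGroup W'] (f : W →+ W') :
    Hat ℓ W →ₗ[ℤ_[ℓ]] Hat ℓ W' :=
  (LinearMap.pi fun n => ModPow.map ℓ f n ∘ₗ LinearMap.proj n).restrict (by
    intro x hx n
    change ModPow.trans ℓ W' n (ModPow.map ℓ f (n + 1) (x (n + 1))) = ModPow.map ℓ f n (x n)
    rw [← hx n]
    obtain ⟨w, hw⟩ := ModPow.mk_surjective ℓ W (n + 1) (x (n + 1))
    rw [← hw]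
    rfl)

/-- The submodule of torsion elements of a `ℤ_ℓ`-module. -/
def tor (M : Type u) [AddCommGroup M] [Module ℤ_[ℓ] M] : Submodule ℤ_[ℓ] M :=
  Submodule.torsion ℤ_[ℓ] M

end Completion

/-! ### The pro-`ℓ` case: closed submodules of `K̂` -/

section ProEll

variable (ℓ : ℕ) [Fact ℓ.Prime] {K : Type u} [Field K]

/-- `K̂`, the `ℓ`-adic completion of `Kˣ` (written additively). -/
abbrev FieldHat (K : Type u) [Field K] : Type u := Hat ℓ (Additive Kˣ)

/-- The canonical map `Kˣ → K̂`. -/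
def unitsToHat (x : Kˣ) : FieldHat ℓ K := toHat ℓ (Additive Kˣ) (Additive.ofMul x)

/-- `S` is closed and `K̂/S` is torsion-free. -/
def TorsionFreeQuot (S : Submodule ℤ_[ℓ] (FieldHat ℓ K)) : Prop :=
  IsClosed (S : Set (FieldHat ℓ K)) ∧ Module.IsTorsionFree ℤ_[ℓ] (FieldHat ℓ K ⧸ S)

/-- `S` is closed and `K̂/S` is torsion-free and `ℤ_ℓ`-cyclic (possibly trivial). -/
def TorsionFreeCyclicQuot (S : Submodule ℤ_[ℓ] (FieldHat ℓ K)) : Prop :=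
  TorsionFreeQuot ℓ S ∧ Module.IsPrincipal ℤ_[ℓ] (FieldHat ℓ K ⧸ S)

/-- `S` is rigid: for every `x ∈ Kˣ`, `x ∉ S` (with `y = 1 - x`), the submodule
`⟨x, 1 - x⟩ mod S` of `K̂/S` is `ℤ_ℓ`-cyclic. -/
def RigidHat (S : Submodule ℤ_[ℓ] (FieldHat ℓ K)) : Prop :=
  ∀ x y : Kˣ, (x : K) + (y : K) = 1 → unitsToHat ℓ x ∉ S →
    ((Submodule.span ℤ_[ℓ] {unitsToHat ℓ x, unitsToHat ℓ y}).map S.mkQ).IsPrincipal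

/-- `𝐇(S)`: the intersection of all `H ≥ S` with `K̂/H` torsion-free cyclic such that `H ∩ H'`
is rigid for all `H' ≥ S` with `K̂/H'` torsion-free cyclic. -/
def bigHHat (S : Submodule ℤ_[ℓ] (FieldHat ℓ K)) : Submodule ℤ_[ℓ] (FieldHat ℓ K) :=
  sInf {H | S ≤ H ∧ TorsionFreeCyclicQuot ℓ H ∧
    ∀ H' : Submodule ℤ_[ℓ] (FieldHat ℓ K), S ≤ H' → TorsionFreeCyclicQuot ℓ H' →
      RigidHat ℓ (H ⊓ H')}

/-- The map from the `ℓ`-adic completion of `𝒪_vˣ` to `K̂` (injective, as `Γ_v` is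
torsion-free). -/
def unitsHatIncl (A : ValuationSubring K) :
    Hat ℓ (Additive A.unitGroup) →ₗ[ℤ_[ℓ]] FieldHat ℓ K :=
  hatMap ℓ (MonoidHom.toAdditive A.unitGroup.subtype)

/-- The map from the `ℓ`-adic completion of `𝒪_vˣ` to that of `k(v)ˣ`. -/
def unitsHatRes (A : ValuationSubring K) :
    Hat ℓ (Additive A.unitGroup) →ₗ[ℤ_[ℓ]] FieldHat ℓ (IsLocalRing.ResidueField A) :=
  hatMap ℓ (MonoidHom.toAdditive A.unitGroupToResidueFieldUnits)

/-- `𝒰_v`: the `ℓ`-adic completion of `𝒪_vˣ`, as a submodule of `K̂`. -/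
def UHat (A : ValuationSubring K) : Submodule ℤ_[ℓ] (FieldHat ℓ K) :=
  LinearMap.range (unitsHatIncl ℓ A)

/-- `𝒰_v¹`: the kernel of `𝒰_v → k(v)^ → k(v)^/tor`, as a submodule of `K̂`. -/
def U1Hat (A : ValuationSubring K) : Submodule ℤ_[ℓ] (FieldHat ℓ K) :=
  (LinearMap.ker ((tor ℓ (FieldHat ℓ (IsLocalRing.ResidueField A))).mkQ ∘ₗ
    unitsHatRes ℓ A)).map (unitsHatIncl ℓ A)

/-- The class `𝒱̂_K` of valuations. -/
def VHat (K : Type u) [Field K] : Set (ValuationSubring K) :=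
  {A | NoDivisibleConvex ℓ A ∧
    ¬ Module.IsPrincipal ℤ_[ℓ] (FieldHat ℓ (IsLocalRing.ResidueField A) ⧸
      tor ℓ (FieldHat ℓ (IsLocalRing.ResidueField A))) ∧
    bigHHat ℓ (tor ℓ (FieldHat ℓ (IsLocalRing.ResidueField A))) = ⊤}

/-- The class `𝒯̂_K` of closed submodules of `K̂`. -/
def THat (K : Type u) [Field K] : Set (Submodule ℤ_[ℓ] (FieldHat ℓ K)) :=
  {S | TorsionFreeQuot ℓ S ∧
    (∀ S' : Submodule ℤ_[ℓ] (FieldHat ℓ K), S' ≤ S → TorsionFreeQuot ℓ S' → S' ≠ S →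
      ¬ bigHHat ℓ S' ≤ bigHHat ℓ S) ∧
    S ≠ bigHHat ℓ S}

/-- `𝒱̂_K^v`: the valuations in `𝒱̂_K` finer than (or equal to) `v`. -/
def VHatRel (A : ValuationSubring K) : Set (ValuationSubring K) :=
  {B | B ∈ VHat ℓ K ∧ B ≤ A}

/-- `𝒯̂_K^v`: the `S ∈ 𝒯̂_K` with `𝒰_v¹ ≤ S ≤ 𝐇(S) ≤ 𝒰_v`. -/
def THatRel (A : ValuationSubring K) : Set (Submodule ℤ_[ℓ] (FieldHat ℓ K)) :=
  {S | S ∈ THat ℓ K ∧ U1Hat ℓ A ≤ S ∧ S ≤ bigHHat ℓ S ∧ bigHHat ℓ S ≤ UHat ℓ A}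

/-- `S_v`: the image of `S ∩ 𝒰_v` in the `ℓ`-adic completion of `k(v)ˣ`. -/
def residueSubmodule (A : ValuationSubring K) (S : Submodule ℤ_[ℓ] (FieldHat ℓ K)) :
    Submodule ℤ_[ℓ] (FieldHat ℓ (IsLocalRing.ResidueField A)) :=
  (S.comap (unitsHatIncl ℓ A)).map (unitsHatRes ℓ A)

/-- The preimage in `𝒰_v ≤ K̂` of a submodule `S` of the `ℓ`-adic completion of `k(v)ˣ`. If `S`
contains the torsion, it is the unique submodule between `𝒰_v¹` and `𝒰_v` whose image in the
completion of `k(v)ˣ` is `S`. -/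
def liftSubmodule (A : ValuationSubring K)
    (S : Submodule ℤ_[ℓ] (FieldHat ℓ (IsLocalRing.ResidueField A))) :
    Submodule ℤ_[ℓ] (FieldHat ℓ K) :=
  (S.comap (unitsHatRes ℓ A)).map (unitsHatIncl ℓ A)

end ProEll

end

end RigidVal

/-! The proof dualizes. Let `R` be `ZMod ℓ` in the mod-ℓ case and `ℤ_[ℓ]` in the pro-ℓ case. A
subgroup containing the ℓ-th powers, or a closed submodule with torsion-free quotient, is determined
by the characters `Kˣ → R` vanishing on it, and the (torsion-free) cyclic quotients belong to
kernels of single characters. If `H`, `H'` are the kernels of `f`, `g`, then `H ∩ H'` is rigid iff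
`f(x) g(1-x) = f(1-x) g(x)` for all `x` (`Comm`). So 𝐇(T) is dual to the centre `ctr D` of the
family `D` dual to `T`, 𝔘_v to the characters `inr v` of the value group, and 𝔘_v¹ to the characters
`dec v` that kill `-1` and the principal units. In this language 𝒯 consists of the non-commutative
`D` such that no larger family has a centre containing that of `D`, and 𝒱 of the `v` without
divisible convex subgroups for which `ctr (dec v) = inr v ≠ dec v`. Both cases are treated together
over a ring in the class `Coeff`.

Three facts carry the correspondence. First, a non-commutative `D` admits a valuation with `ctr D ⊆
inr v` and `D ⊆ dec v` (`CommData.exists_valuationSubring`). Indeed, a central `f` and any `g ∈ D`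
send a relation `x + y = z` to three collinear points; playing a non-collinear triple against an
element that `f` separates from it shows that a sum of two elements separated by the centre has the
class of one of them. The dominant term defines an order, and the order a valuation ring. Second,
`v` can be coarsened so that no divisible convex subgroup remains, without losing these inclusions
(`exists_coarsening`). Third, without divisible convex subgroups every character commuting with `inr
v` lies in `dec v` (`mem_dec_of_comm_inr`), and `inr v` determines `v` (`le_of_inr_subset`).

Hence `dec v` is maximal for `v` in 𝒱, and `v` is recovered from its centre. Conversely, if `D` is
in 𝒯 and `v` is the coarsened valuation, then `D ⊆ dec v` and `ctr D ⊆ inr v ⊆ ctr (dec v)`, so `D =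
dec v`.

For the relative statements, characters in `dec v` induce characters of `k(v)`, all characters of
`k(v)` trivial on `-1` arise in this way because the value group is torsion-free and `R` is compact,
and commutation can be tested on `k(v)` (`Lifts.comm_iff`). So the conditions pass through
composition of valuations; the square commutes, and its remaining side is bijective because the
other three are. -/

namespace RigidVal

/-! ### Extension of homomorphisms into compact groups -/

section Compact

universe u w

/-- Coefficient rings: compact Hausdorff domains that are `ℓ`-adically separated and in which
`ℓ` is not invertible. -/
class Coeff (ℓ : ℕ) (R : Type w) [CommRing R] [TopologicalSpace R] : Prop extends
    IsDomain R, IsTopologicalRing R, CompactSpace R, T2Space R where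
  not_unit : ¬ IsUnit (ℓ : R)
  separated : ∀ r : R, (∀ n : ℕ, ∃ s, r = (ℓ : R) ^ n * s) → r = 0

variable {W : Type u} [AddCommGroup W] {R : Type w}

/-- A compactness argument: an additive map with prescribed closed properties exists as soon as
maps exist that are additive on given finite sets. -/
theorem exists_addHom_of_finite [AddCommGroup R] [TopologicalSpace R] [IsTopologicalAddGroup R]
    [CompactSpace R] [T2Space R] {Q : Set (W → R)} (hQ : IsClosed Q)
    (h : ∀ s : Finset W, ∃ φ ∈ Q, ∀ x ∈ s, ∀ y ∈ s, φ (x + y) = φ x + φ y) :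
    ∃ f : W →+ R, ⇑f ∈ Q := by
  classical
  let C : Finset W → Set (W → R) := fun s => Q ∩ {φ | ∀ x ∈ s, ∀ y ∈ s, φ (x + y) = φ x + φ y}
  have hC : ∀ s, IsClosed (C s) := by
    intro s
    refine hQ.inter ?_
    simp only [Set.ofPred_forall]
    refine isClosed_iInter fun x => isClosed_iInter fun _ => isClosed_iInter fun y =>
      isClosed_iInter fun _ => ?_
    exact isClosed_eq (continuous_apply _)
      (Continuous.add (f := fun φ : W → R => φ x) (g := fun φ : W → R => φ y)
        (continuous_apply x) (continuous_apply y))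
  have := IsCompact.nonempty_iInter_of_directed_nonempty_isCompact_isClosed C
    (by
      intro s t
      refine ⟨s ∪ t, ?_, ?_⟩
      · exact fun φ hφ => ⟨hφ.1, fun x hx y hy => hφ.2 x (Finset.mem_union_left _ hx) y
          (Finset.mem_union_left _ hy)⟩
      · exact fun φ hφ => ⟨hφ.1, fun x hx y hy => hφ.2 x (Finset.mem_union_right _ hx) y
          (Finset.mem_union_right _ hy)⟩)
    (by
      intro s
      obtain ⟨φ, hφ, h'⟩ := h s
      exact ⟨φ, hφ, h'⟩)
    (fun s => (hC s).isCompact) hC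
  obtain ⟨φ, hφ⟩ := this
  rw [Set.mem_iInter] at hφ
  have hadd : ∀ x y, φ (x + y) = φ x + φ y := by
    intro x y
    exact (hφ {x, y}).2 x (by simp) y (by simp)
  exact ⟨AddMonoidHom.mk' φ hadd, (hφ ∅).1⟩

theorem free_closure_of_torsionFree {N : Type u} [AddCommGroup N]
    (htf : ∀ n : ℕ, n ≠ 0 → ∀ x : N, n • x = 0 → x = 0) (s : Finset N) :
    Module.Free ℤ (Submodule.span ℤ (s : Set N)) := by
  have : Module.IsTorsionFree ℤ N := by
    refine ⟨fun r hr x y hxy => ?_⟩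
    have hr0 : r ≠ 0 := hr.ne_zero
    have h1 : r • (x - y) = 0 := by rw [smul_sub]; exact sub_eq_zero.mpr hxy
    have h2 : r.natAbs • (x - y) = 0 := by
      rcases Int.natAbs_eq r with h | h
      · rw [h, natCast_zsmul] at h1; exact h1
      · rw [h, neg_smul, natCast_zsmul, neg_eq_zero] at h1; exact h1
    exact sub_eq_zero.mp (htf _ (Int.natAbs_ne_zero.mpr hr0) _ h2)
  have : Module.Finite ℤ (Submodule.span ℤ (s : Set N)) :=
    Module.Finite.span_of_finite ℤ s.finite_toSet
  infer_instance

/-- Homomorphisms into a compact group extend along inclusions with torsion-free quotient. -/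
theorem exists_extension [AddCommGroup R] [TopologicalSpace R] [IsTopologicalAddGroup R]
    [CompactSpace R] [T2Space R] (W' : AddSubgroup W)
    (htf : ∀ n : ℕ, n ≠ 0 → ∀ x : W, n • x ∈ W' → x ∈ W') (f : W' →+ R) :
    ∃ g : W →+ R, ∀ x : W', g x = f x := by
  classical
  have hQ : IsClosed {φ : W → R | ∀ x : W', φ x = f x} := by
    simp only [Set.ofPred_forall]
    exact isClosed_iInter fun x => isClosed_eq (continuous_apply _) continuous_const
  obtain ⟨g, hg⟩ := exists_addHom_of_finite hQ (by
    intro s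
    let N := W ⧸ W'
    let p : W →ₗ[ℤ] N := (QuotientAddGroup.mk' W').toIntLinearMap
    have hp : ∀ x, p x = 0 ↔ x ∈ W' := fun x => QuotientAddGroup.eq_zero_iff x
    have hN : ∀ n : ℕ, n ≠ 0 → ∀ x : N, n • x = 0 → x = 0 := by
      intro n hn x hx
      obtain ⟨w, rfl⟩ := QuotientAddGroup.mk'_surjective W' x
      rw [← map_nsmul] at hx
      exact (hp w).mpr (htf n hn w ((hp (n • w)).mp hx))
    let M := Submodule.span ℤ ((s.image p : Finset N) : Set N)
    have hfree : Module.Free ℤ M := free_closure_of_torsionFree hN _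
    let P := M.comap p
    let q : P →ₗ[ℤ] M := p.restrict (fun x hx => hx)
    have hq : Function.Surjective q := by
      rintro ⟨y, hy⟩
      obtain ⟨w, rfl⟩ := QuotientAddGroup.mk'_surjective W' y
      exact ⟨⟨w, hy⟩, rfl⟩
    -- Over a finitely generated, hence free, subgroup of `W/W'` the projection splits, so `x ↦ x -
    -- σ (q x)` retracts `P` onto `W'`; composing with `f` extends `f` to `P`.
    obtain ⟨σ, hσ⟩ := Module.projective_lifting_property q LinearMap.id hq
    have hd : ∀ x : P, ((x - σ (q x) : P) : W) ∈ W' := by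
      intro x
      rw [← hp]
      have : q (x - σ (q x)) = 0 := by
        rw [map_sub]
        have := LinearMap.congr_fun hσ (q x)
        simp only [LinearMap.comp_apply, LinearMap.id_apply] at this
        rw [this, sub_self]
      exact congrArg Subtype.val this
    have hσ0 : ∀ x : P, (x : W) ∈ W' → q x = 0 := fun x hx => Subtype.ext ((hp _).mpr hx)
    -- The value `0` outside `P` is a default: `P` contains both `s` and `W'`.
    refine ⟨fun x => if hx : x ∈ P then f ⟨_, hd ⟨x, hx⟩⟩ else 0, ?_, ?_⟩
    · intro x
      have hxP : (x : W) ∈ P := by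
        change p x ∈ M
        rw [(hp x).mpr x.2]
        exact M.zero_mem
      simp only [dif_pos hxP]
      congr 1
      apply Subtype.ext
      simp only [hσ0 ⟨x, hxP⟩ x.2, map_zero, sub_zero]
    · intro x hx y hy
      have hP : ∀ z ∈ s, z ∈ P := fun z hz =>
        Submodule.subset_span (Finset.mem_coe.mpr (Finset.mem_image_of_mem p hz))
      have hxP := hP x hx
      have hyP := hP y hy
      have hxyP := P.add_mem hxP hyP
      simp only [dif_pos hxP, dif_pos hyP, dif_pos hxyP]
      rw [← map_add]
      congr 1
      apply Subtype.ext
      have : (⟨x + y, hxyP⟩ : P) = ⟨x, hxP⟩ + ⟨y, hyP⟩ := rfl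
      simp only [this, map_add, AddSubgroup.coe_add, Submodule.coe_sub, Submodule.coe_add]
      abel)
  exact ⟨g, hg⟩

/-- In a torsion-free group, elements that are not divisible by `ℓ` are detected by characters. -/
theorem exists_hom_ne_zero (ℓ : ℕ) [hp : Fact ℓ.Prime] [CommRing R] [TopologicalSpace R] [Coeff ℓ R]
    (htf : ∀ n : ℕ, n ≠ 0 → ∀ x : W, n • x = 0 → x = 0) {w : W} (hw : ∀ y : W, ℓ • y ≠ w) :
    ∃ f : W →+ R, f w ≠ 0 := by
  classical
  -- Unlike `φ w ≠ 0`, the condition `φ w ∈ 1 + ℓR` is closed; it implies `φ w ≠ 0` since `ℓ` is not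
  -- a unit.
  have hQ : IsClosed {φ : W → R | φ w ∈ Set.range fun r : R => 1 + (ℓ : R) * r} := by
    refine IsClosed.preimage (continuous_apply w) ?_
    exact (isCompact_range (by fun_prop)).isClosed
  obtain ⟨g, hg⟩ := exists_addHom_of_finite hQ (by
    intro s
    let M := Submodule.span ℤ ((insert w s : Finset W) : Set W)
    have hfree : Module.Free ℤ M := free_closure_of_torsionFree htf _
    let B := Module.Free.chooseBasis ℤ M
    have hwM : w ∈ M := Submodule.subset_span (by simp)
    -- As `w` is not divisible by `ℓ`, some coordinate in a basis of `M` is prime to `ℓ`. A Bézout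
    -- multiple of that coordinate function takes the value `1 - aℓ` at `w`.
    obtain ⟨i, hi⟩ : ∃ i, ¬ (ℓ : ℤ) ∣ B.repr ⟨w, hwM⟩ i := by
      by_contra! hn
      choose c hc using hn
      let y : M := ∑ i ∈ (B.repr ⟨w, hwM⟩).support, c i • B i
      apply hw (y : W)
      have : ℓ • y = ⟨w, hwM⟩ := by
        rw [← B.linearCombination_repr ⟨w, hwM⟩, Finsupp.linearCombination_apply, Finsupp.sum,
          Finset.smul_sum]
        refine Finset.sum_congr rfl fun i _ => ?_
        rw [hc i, mul_smul, natCast_zsmul]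
      exact congrArg Subtype.val this
    have hcop : IsCoprime (ℓ : ℤ) (B.repr ⟨w, hwM⟩ i) :=
      (Nat.prime_iff_prime_int.mp hp.out).coprime_iff_not_dvd.mpr hi
    obtain ⟨a, b, hab⟩ := hcop
    let φ : M →+ R := (Int.castAddHom R).comp ((b • B.coord i).toAddMonoidHom)
    refine ⟨fun x => if hx : x ∈ M then φ ⟨x, hx⟩ else 0, ⟨-(a : R), ?_⟩, ?_⟩
    · simp only [dif_pos hwM]
      have : φ ⟨w, hwM⟩ = ((b * B.repr ⟨w, hwM⟩ i : ℤ) : R) := rfl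
      rw [this]
      have e : b * B.repr ⟨w, hwM⟩ i = 1 - a * ℓ := by linarith
      rw [e]
      push_cast
      ring
    · intro x hx y hy
      have hxM : x ∈ M := Submodule.subset_span (by simp [hx])
      have hyM : y ∈ M := Submodule.subset_span (by simp [hy])
      simp only [dif_pos hxM, dif_pos hyM, dif_pos (M.add_mem hxM hyM)]
      rw [← map_add]
      rfl)
  refine ⟨g, fun h0 => ?_⟩
  obtain ⟨r, hr⟩ := hg
  apply Coeff.not_unit (ℓ := ℓ) (R := R)
  refine IsUnit.of_mul_eq_one (-r) ?_
  have hr' : 1 + (ℓ : R) * r = g w := hr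
  rw [h0] at hr'
  linear_combination -hr'

end Compact

/-! ### Valuations from families of commuting characters -/

section Core

universe u w

variable {K : Type u} [Field K] {F : Type w} [Field F]

/-- Characters of `Kˣ` with values in the additive group of a field, trivial on `-1`,
viewed as functions on `K`. -/
structure IsLog (g : K → F) : Prop where
  mul : ∀ x y : K, x ≠ 0 → y ≠ 0 → g (x * y) = g x + g y
  neg_one : g (-1) = 0

theorem IsLog.one {g : K → F} (hg : IsLog g) : g 1 = 0 := by
  have := hg.mul 1 1 one_ne_zero one_ne_zero
  simpa using this

theorem IsLog.neg {g : K → F} (hg : IsLog g) (x : K) : g (-x) = g x := by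
  by_cases hx : x = 0
  · simp [hx]
  · have := hg.mul (-1) x (by simp) hx
    rw [neg_one_mul, hg.neg_one, zero_add] at this
    exact this

/-- A family `D` of characters together with a subfamily `I` of characters commuting with all
of `D`, and a pair `b + c = 1` witnessing that `D` is not commutative. -/
structure CommData (D I : Set (K → F)) (b c : K) : Prop where
  log : ∀ g ∈ D, IsLog g
  sub : I ⊆ D
  comm : ∀ f ∈ I, ∀ g ∈ D, ∀ x y : K, x ≠ 0 → y ≠ 0 → x + y = 1 → f x * g y = f y * g x
  add_eq : b + c = 1
  left_ne : b ≠ 0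
  right_ne : c ≠ 0
  indep : ∃ g ∈ D, ∃ g' ∈ D, g b * g' c ≠ g c * g' b

/-- `x` and `y` are not separated by the characters in `D`. -/
def Eqv (D : Set (K → F)) (x y : K) : Prop := ∀ g ∈ D, g x = g y

/-- `x` and `y` are separated by a character in `I`. -/
def Sep (I : Set (K → F)) (x y : K) : Prop := ∃ f ∈ I, f x ≠ f y

/-- `p` is infinitesimal relative to `q`, as witnessed directly by the characters. -/
structure LL (D I : Set (K → F)) (p q : K) : Prop where
  left_ne : p ≠ 0
  right_ne : q ≠ 0
  sep : Sep I p q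
  eqv : Eqv D (p + q) q

/-- A non-collinear triple `a = b + c`. -/
structure Ind (D : Set (K → F)) (a b c : K) : Prop where
  eq : b + c = a
  ha : a ≠ 0
  hb : b ≠ 0
  hc : c ≠ 0
  indep : ∃ g ∈ D, ∃ g' ∈ D,
    (g b - g a) * (g' c - g' a) ≠ (g c - g a) * (g' b - g' a)

variable {D I : Set (K → F)} {b c : K}

omit [Field K] [Field F] in
theorem Eqv.symm {x y : K} (h : Eqv D x y) : Eqv D y x := fun g hg => (h g hg).symm

omit [Field K] [Field F] in
theorem Eqv.trans {x y z : K} (h : Eqv D x y) (h' : Eqv D y z) : Eqv D x z :=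
  fun g hg => (h g hg).trans (h' g hg)

omit [Field K] [Field F] in
theorem Sep.symm {x y : K} (h : Sep I x y) : Sep I y x := by
  obtain ⟨f, hf, h⟩ := h
  exact ⟨f, hf, h.symm⟩

/-! ### Non-collinear triples and the relation `LL`. -/

namespace CommData

variable (h : CommData D I b c)

include h

theorem not_eqv {x y : K} (hs : Sep I x y) : ¬ Eqv D x y := by
  obtain ⟨f, hf, hn⟩ := hs
  exact fun he => hn (he f (h.sub hf))

theorem sep_congr {x x' y y' : K} (hx : Eqv D x x') (hy : Eqv D y y') (hs : Sep I x y) :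
    Sep I x' y' := by
  obtain ⟨f, hf, hn⟩ := hs
  exact ⟨f, hf, by rwa [← hx f (h.sub hf), ← hy f (h.sub hf)]⟩

theorem eqv_neg (x : K) : Eqv D (-x) x := fun g hg => (h.log g hg).neg x

theorem eqv_mul {x y t : K} (hx : x ≠ 0) (hy : y ≠ 0) (ht : t ≠ 0) (he : Eqv D x y) :
    Eqv D (t * x) (t * y) := fun g hg => by
  rw [(h.log g hg).mul t x ht hx, (h.log g hg).mul t y ht hy, he g hg]

theorem sep_mul {x y t : K} (hx : x ≠ 0) (hy : y ≠ 0) (ht : t ≠ 0) (hs : Sep I x y) :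
    Sep I (t * x) (t * y) := by
  obtain ⟨f, hf, hn⟩ := hs
  have hl := h.log f (h.sub hf)
  exact ⟨f, hf, by rw [hl.mul t x ht hx, hl.mul t y ht hy]; simpa using hn⟩

theorem add_ne {p q : K} (hs : Sep I p q) : p + q ≠ 0 := by
  intro h0
  rw [eq_neg_of_add_eq_zero_left h0] at hs
  exact h.not_eqv hs (h.eqv_neg q)

/-- After division by `z` this is `comm` for `x/z + y/z = 1`: the images of `x`, `y`, `z` under `(f,
g)` lie on a line. -/
theorem collinear {f g : K → F} (hf : f ∈ I) (hg : g ∈ D) {x y z : K} (hx : x ≠ 0) (hy : y ≠ 0)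
    (hz : z ≠ 0) (hxy : x + y = z) :
    (f x - f z) * (g y - g z) = (f y - f z) * (g x - g z) := by
  have hfl := h.log f (h.sub hf)
  have hgl := h.log g hg
  have key := h.comm f hf g hg (x / z) (y / z) (div_ne_zero hx hz) (div_ne_zero hy hz)
    (by rw [← add_div, hxy, div_self hz])
  have e : ∀ k : K → F, IsLog k → ∀ w : K, w ≠ 0 → k (w / z) = k w - k z := by
    intro k hk w hw
    have := hk.mul (w / z) z (div_ne_zero hw hz) hz
    rw [div_mul_cancel₀ _ hz] at this
    rw [this]; ring
  rwa [e f hfl x hx, e f hfl y hy, e g hgl x hx, e g hgl y hy] at key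

omit h in
theorem _root_.RigidVal.Ind.swap {a b c : K} (hi : Ind D a b c) : Ind D a c b := by
  obtain ⟨h1, h2, h3, h4, g, hg, g', hg', hn⟩ := hi
  exact ⟨by rw [add_comm, h1], h2, h4, h3, g, hg, g', hg', fun h => hn h.symm⟩

theorem ind_rot {a b c : K} (hi : Ind D a b c) : Ind D c a (-b) := by
  obtain ⟨h1, h2, h3, h4, g, hg, g', hg', hn⟩ := hi
  refine ⟨by rw [← h1]; ring, h4, h2, neg_ne_zero.mpr h3, g, hg, g', hg', fun h' => hn ?_⟩
  rw [(h.log g hg).neg, (h.log g' hg').neg] at h'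
  linear_combination h'

theorem ind_mul {a b c t : K} (ht : t ≠ 0) (hi : Ind D a b c) : Ind D (t * a) (t * b) (t * c) := by
  obtain ⟨h1, h2, h3, h4, g, hg, g', hg', hn⟩ := hi
  refine ⟨by rw [← h1]; ring, mul_ne_zero ht h2, mul_ne_zero ht h3, mul_ne_zero ht h4,
    g, hg, g', hg', fun h' => hn ?_⟩
  have l := h.log g hg
  have l' := h.log g' hg'
  rw [l.mul _ _ ht h2, l.mul _ _ ht h3, l.mul _ _ ht h4, l'.mul _ _ ht h2, l'.mul _ _ ht h3,
    l'.mul _ _ ht h4] at h'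
  linear_combination h'

theorem ind_base : Ind D 1 b c := by
  obtain ⟨g, hg, g', hg', hn⟩ := h.indep
  refine ⟨h.add_eq, one_ne_zero, h.left_ne, h.right_ne, g, hg, g', hg', ?_⟩
  rw [(h.log g hg).one, (h.log g' hg').one]
  simpa using hn

/-- The geometric heart. Commuting with all of `D`, the character `f` is constant on the
non-collinear triple (`hB`, `hC`). The lines `a, p, a + p` and `c, p, c + p` and `b, c + p, a + p`
give `E1`, `E2`, `E3`. Eliminating the values of `g` at `p`, `a + p` and `c + p` leaves `E4`, a
linear relation between `g b - g a` and `g c - g a` with coefficients depending only on `f`;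
non-collinearity forces both coefficients to vanish. -/
theorem ind_aux {a b c p : K} (hi : Ind D a b c) (hp : p ≠ 0) (hs : Sep I p a) :
    Eqv D (a + p) a ∨ (Eqv D (a + p) p ∧ Eqv D (c + p) p) := by
  obtain ⟨f, hf, hfp⟩ := hs
  obtain ⟨h1, ha, hb, hc, g1, hg1, g2, hg2, hn⟩ := hi
  have hfD := h.sub hf
  have hB : f b - f a = 0 := by
    have e1 := h.collinear hf hg1 hb hc ha h1
    have e2 := h.collinear hf hg2 hb hc ha h1
    have : (f b - f a) * ((g1 b - g1 a) * (g2 c - g2 a) - (g1 c - g1 a) * (g2 b - g2 a)) = 0 := by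
      linear_combination (g1 b - g1 a) * e2 - (g2 b - g2 a) * e1
    exact (mul_eq_zero.mp this).resolve_right (sub_ne_zero.mpr hn)
  have hC : f c - f a = 0 := by
    have e1 := h.collinear hf hg1 hb hc ha h1
    have e2 := h.collinear hf hg2 hb hc ha h1
    have : (f c - f a) * ((g1 b - g1 a) * (g2 c - g2 a) - (g1 c - g1 a) * (g2 b - g2 a)) = 0 := by
      linear_combination (g1 c - g1 a) * e2 - (g2 c - g2 a) * e1
    exact (mul_eq_zero.mp this).resolve_right (sub_ne_zero.mpr hn)
  have hPf : f p - f a ≠ 0 := sub_ne_zero.mpr hfp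
  have hap : a + p ≠ 0 := h.add_ne ⟨f, hf, hfp.symm⟩
  have hcp : c + p ≠ 0 := h.add_ne ⟨f, hf, by rw [sub_eq_zero.mp hC]; exact hfp.symm⟩
  have E1 : ∀ g ∈ D, (f (a + p) - f a) * (g p - g a) = (f p - f a) * (g (a + p) - g a) := by
    intro g hg
    linear_combination -(h.collinear hf hg ha hp hap rfl)
  have E2 : ∀ g ∈ D, (f p - f a) * (g (c + p) - g c) = (f (c + p) - f a) * (g p - g c) := by
    intro g hg
    linear_combination (h.collinear hf hg hc hp hcp rfl) - hC * (g p - g (c + p))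
  have E3 : ∀ g ∈ D, (f (c + p) - f a) * (g (a + p) - g b) =
      (f (a + p) - f a) * (g (c + p) - g b) := by
    intro g hg
    linear_combination (h.collinear hf hg hb hcp hap (by rw [← h1]; ring)) -
      hB * (g (c + p) - g (a + p))
  by_cases hX : f (a + p) - f a = 0
  · left
    intro g hg
    have := E1 g hg
    rw [hX, zero_mul] at this
    exact sub_eq_zero.mp ((mul_eq_zero.mp this.symm).resolve_left hPf)
  · right
    have E4 : ∀ g ∈ D, (f p - f a) * (f (a + p) - f (c + p)) * (g b - g a) =
        (f (a + p) - f a) * (f p - f (c + p)) * (g c - g a) := by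
      intro g hg
      linear_combination (f p - f a) * E3 g hg + (f (c + p) - f a) * E1 g hg
        + (f (a + p) - f a) * E2 g hg
    have A1 : (f p - f a) * (f (a + p) - f (c + p)) *
        ((g1 b - g1 a) * (g2 c - g2 a) - (g1 c - g1 a) * (g2 b - g2 a)) = 0 := by
      linear_combination (g2 c - g2 a) * E4 g1 hg1 - (g1 c - g1 a) * E4 g2 hg2
    have A2 : (f (a + p) - f a) * (f p - f (c + p)) *
        ((g1 b - g1 a) * (g2 c - g2 a) - (g1 c - g1 a) * (g2 b - g2 a)) = 0 := by
      linear_combination (g2 b - g2 a) * E4 g1 hg1 - (g1 b - g1 a) * E4 g2 hg2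
    have B1 : f (a + p) - f (c + p) = 0 :=
      (mul_eq_zero.mp ((mul_eq_zero.mp A1).resolve_right (sub_ne_zero.mpr hn))).resolve_left hPf
    have B2 : f p - f (c + p) = 0 :=
      (mul_eq_zero.mp ((mul_eq_zero.mp A2).resolve_right (sub_ne_zero.mpr hn))).resolve_left hX
    constructor
    · intro g hg
      have : (f p - f a) * (g (a + p) - g p) = 0 := by
        linear_combination -(E1 g hg) + (g p - g a) * (B1 - B2)
      exact sub_eq_zero.mp ((mul_eq_zero.mp this).resolve_left hPf)
    · intro g hg
      have : (f p - f a) * (g (c + p) - g p) = 0 := by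
        linear_combination (E2 g hg) - (g p - g c) * B2
      exact sub_eq_zero.mp ((mul_eq_zero.mp this).resolve_left hPf)

/-- The witness `b + c = 1` scaled by `q` is a non-collinear triple, to which `ind_aux` applies. -/
theorem ll_total {p q : K} (hp : p ≠ 0) (hq : q ≠ 0) (hs : Sep I p q) : LL D I p q ∨ LL D I q p := by
  have hi := h.ind_mul hq h.ind_base
  rw [mul_one] at hi
  rcases h.ind_aux hi hp hs with h1 | ⟨h1, -⟩
  · exact Or.inl ⟨hp, hq, hs, by rwa [add_comm]⟩
  · exact Or.inr ⟨hq, hp, hs.symm, h1⟩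

theorem ll_asymm {p q : K} (h1 : LL D I p q) (h2 : LL D I q p) : False := by
  apply h.not_eqv h1.sep
  have := h2.eqv
  rw [add_comm] at this
  exact this.symm.trans h1.eqv

theorem ll_mul {p q t : K} (ht : t ≠ 0) (hl : LL D I p q) : LL D I (t * p) (t * q) := by
  refine ⟨mul_ne_zero ht hl.left_ne, mul_ne_zero ht hl.right_ne,
    h.sep_mul hl.left_ne hl.right_ne ht hl.sep, ?_⟩
  rw [← mul_add]
  exact h.eqv_mul (h.add_ne hl.sep) hl.right_ne ht hl.eqv

/-- The first alternative of `ind_aux` would identify the classes of `a` and `p`. Separation of `c`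
from `p` survives because characters in `I` are constant on the triple. -/
theorem ll_ind {a b c p : K} (hi : Ind D a b c) (hl : LL D I a p) : LL D I c p := by
  rcases h.ind_aux hi hl.right_ne hl.sep.symm with h1 | ⟨-, h2⟩
  · exact absurd (h1.symm.trans hl.eqv) (h.not_eqv hl.sep)
  · refine ⟨hi.hc, hl.right_ne, ?_, h2⟩
    by_contra hns
    have hs : ∀ f ∈ I, f c = f p := by
      intro f hf
      by_contra hne
      exact hns ⟨f, hf, hne⟩
    obtain ⟨f, hf, hn⟩ := hl.sep
    obtain ⟨h1, ha, hb, hc, g1, hg1, g2, hg2, hn'⟩ := hi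
    have e1 := h.collinear hf hg1 hb hc ha h1
    have e2 := h.collinear hf hg2 hb hc ha h1
    have : (f c - f a) * ((g1 b - g1 a) * (g2 c - g2 a) - (g1 c - g1 a) * (g2 b - g2 a)) = 0 := by
      linear_combination (g1 c - g1 a) * e2 - (g2 c - g2 a) * e1
    have := (mul_eq_zero.mp this).resolve_right (sub_ne_zero.mpr hn')
    apply hn
    rw [← hs f hf]
    exact (sub_eq_zero.mp this).symm

/-- Rotating the triple `p, pb, pc` with `ind_rot` and applying `ll_ind` three times leads to `-p`.
-/
theorem ll_neg_left {p q : K} (hl : LL D I p q) : LL D I (-p) q := by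
  have hi := h.ind_mul hl.left_ne h.ind_base
  rw [mul_one] at hi
  have h1 := h.ll_ind hi hl
  have h2 := h.ind_rot hi
  have h3 := h.ll_ind h2 h1
  have h4 := h.ind_rot h2
  exact h.ll_ind h4 h3

/-- With `ll_mul_right` and `not_eqv_mul` this is the lever of the contradictions below: an
intermediate element `s` can be replaced by `b * s`, which has a different class under `D`. -/
theorem ll_mul_left {p q : K} (hl : LL D I p q) : LL D I (b * p) q := by
  have hi := h.ind_mul hl.left_ne h.ind_base
  rw [mul_one] at hi
  have h1 := h.ll_ind hi.swap hl
  rwa [mul_comm]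

theorem ll_mul_right {p q : K} (hl : LL D I p q) : LL D I p (b * q) := by
  have hi := h.ind_rot h.ind_base.swap
  have hb := h.left_ne
  have hi := h.ind_mul (mul_ne_zero hl.left_ne (inv_ne_zero hb)) hi
  rw [mul_assoc, inv_mul_cancel₀ hb, mul_one, mul_one] at hi
  have h2 := h.ll_mul hb (h.ll_ind hi.swap hl)
  rwa [mul_left_comm, mul_inv_cancel₀ hb, mul_one] at h2

theorem ll_neg_right {p q : K} (hl : LL D I p q) : LL D I p (-q) := by
  have := h.ll_neg_left (h.ll_mul (neg_ne_zero.mpr one_ne_zero) hl)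
  simpa using this

/-- Otherwise every character in `D` would vanish at `b`, against `indep`. -/
theorem not_eqv_mul {x : K} (hx : x ≠ 0) : ¬ Eqv D x (b * x) := by
  intro he
  obtain ⟨g, hg, g', hg', hn⟩ := h.indep
  apply hn
  have e1 := he g hg
  have e2 := he g' hg'
  rw [(h.log g hg).mul _ _ h.left_ne hx] at e1
  rw [(h.log g' hg').mul _ _ h.left_ne hx] at e2
  linear_combination g c * e2 - g' c * e1

omit [Field K] [Field F] h in
theorem sep_of_ne {x y z : K} (hs : Sep I x z) (h0 : ¬ Sep I x y) : Sep I y z := by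
  obtain ⟨f, hf, hn⟩ := hs
  refine ⟨f, hf, ?_⟩
  by_contra he
  exact h0 ⟨f, hf, fun h' => hn (h'.trans he)⟩

theorem tri_aux {x y z : K} (hx : x ≠ 0) (hy : y ≠ 0) (hxy : x + y = z)
    (hs : Sep I x y) : Eqv D x z ∨ Eqv D y z := by
  rcases h.ll_total hx hy hs with h1 | h1
  · right; rw [← hxy]; exact h1.eqv.symm
  · left; rw [← hxy, add_comm]; exact h1.eqv.symm

/-- In a sum `x + y = z` two of the three classes coincide, unless `I` sees nothing. -/
theorem tri {x y z : K} (hy : y ≠ 0) (hz : z ≠ 0) (hxy : x + y = z)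
    (hs : Sep I y z) : Eqv D x z ∨ Eqv D x y := by
  rcases h.tri_aux (neg_ne_zero.mpr hy) hz (show -y + z = x by rw [← hxy]; ring)
    (h.sep_congr (h.eqv_neg y).symm (fun _ _ => rfl) hs) with h1 | h1
  · exact Or.inr (((h.eqv_neg y).symm.trans h1).symm)
  · exact Or.inl h1.symm

/-- If `r ≪ p + q`, then `tri` forces `p` into the class of `r`. The same reasoning puts `p` into
the class of `b * r`, which is a different one. -/
theorem ll_add {p q r : K} (h1 : LL D I p q) (h2 : LL D I q r) : LL D I (p + q) r := by
  have hpq := h.add_ne h1.sep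
  have hr := h2.right_ne
  have hs : Sep I (p + q) r := h.sep_congr h1.eqv.symm (fun _ _ => rfl) h2.sep
  rcases h.ll_total hpq hr hs with h3 | h3
  · exact h3
  exfalso
  have key : ∀ r', LL D I q r' → LL D I r' (p + q) → Eqv D p r' := by
    intro r' a1 a2
    have e1 : Eqv D (p + (q + r')) q := by
      have := a2.eqv
      rw [show r' + (p + q) = p + (q + r') by ring] at this
      exact this.trans h1.eqv
    have hne : p + (q + r') ≠ 0 := by
      have := h.add_ne a2.sep
      rwa [show r' + (p + q) = p + (q + r') by ring] at this
    rcases h.tri (h.add_ne a1.sep) hne rfl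
      (h.sep_congr a1.eqv.symm e1.symm a1.sep.symm) with e | e
    · exact absurd (e.trans e1) (h.not_eqv h1.sep)
    · exact e.trans a1.eqv
  exact h.not_eqv_mul hr ((key r h2 h3).symm.trans
    (key (b * r) (h.ll_mul_right h2) (h.ll_mul_left h3)))

/-- If `r ≪ p` instead, then `ll_add` gives `p + q + r` both the class of `r` and the class of `p`.
-/
theorem ll_trans {p q r : K} (h1 : LL D I p q) (h2 : LL D I q r) (hs : Sep I p r) :
    LL D I p r := by
  rcases h.ll_total h1.left_ne h2.right_ne hs with h3 | h3
  · exact h3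
  exfalso
  have a1 := (h.ll_add h1 h2).eqv
  have a2 := (h.ll_add h2 h3).eqv
  rw [show q + r + p = p + q + r by ring] at a2
  exact h.not_eqv hs (a2.symm.trans a1)

theorem ll_trans₃ {p q r s : K} (h1 : LL D I p q) (h2 : LL D I q r) (h3 : LL D I r s)
    (hs : Sep I p s) : LL D I p s := by
  rcases h.ll_total h1.left_ne h3.right_ne hs with h4 | h4
  · exact h4
  exfalso
  have a1 := (h.ll_add (h.ll_add h1 h2) h3).eqv
  have a2 := (h.ll_add (h.ll_add h2 h3) h4).eqv
  rw [show q + r + s + p = p + q + r + s by ring] at a2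
  exact h.not_eqv hs (a2.symm.trans a1)

end CommData

/-- The strict order of the valuation attached to `D` and `I`. -/
def LT (D I : Set (K → F)) (p q : K) : Prop := LL D I p q ∨ ∃ s, LL D I p s ∧ LL D I s q

/-! ### The strict order `LT`, its ultrametric inequality, and the valuation ring. -/

namespace CommData

variable (h : CommData D I b c)

include h

/-- Two steps always suffice. If `p` and `r` are separated, three steps merge into one; if not, then
`p` and `q` are separated and the first two steps merge. -/
theorem lt_ll {p q r : K} (h1 : LT D I p q) (h2 : LL D I q r) : LT D I p r := by
  rcases h1 with h1 | ⟨s, h1, h1'⟩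
  · exact Or.inr ⟨q, h1, h2⟩
  · by_cases hs : Sep I p r
    · exact Or.inl (h.ll_trans₃ h1 h1' h2 hs)
    · have : Sep I q p := by
        by_contra hn
        exact hs (sep_of_ne h2.sep hn)
      exact Or.inr ⟨q, h.ll_trans h1 h1' this.symm, h2⟩

theorem lt_trans {p q r : K} (h1 : LT D I p q) (h2 : LT D I q r) : LT D I p r := by
  rcases h2 with h2 | ⟨s, h2, h2'⟩
  · exact h.lt_ll h1 h2
  · exact h.lt_ll (h.lt_ll h1 h2) h2'

theorem lt_irrefl {p : K} (h1 : LT D I p p) : False := by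
  rcases h1 with h1 | ⟨s, h1, h1'⟩
  · exact h.ll_asymm h1 h1
  · exact h.ll_asymm h1 h1'

theorem lt_sep {p q : K} (h1 : LT D I p q) (hs : Sep I p q) : LL D I p q := by
  rcases h1 with h1 | ⟨s, h1, h1'⟩
  · exact h1
  · exact h.ll_trans h1 h1' hs

theorem lt_mul {p q t : K} (ht : t ≠ 0) (h1 : LT D I p q) : LT D I (t * p) (t * q) := by
  rcases h1 with h1 | ⟨s, h1, h1'⟩
  · exact Or.inl (h.ll_mul ht h1)
  · exact Or.inr ⟨t * s, h.ll_mul ht h1, h.ll_mul ht h1'⟩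

theorem lt_neg_right {p q : K} (h1 : LT D I p q) : LT D I p (-q) := by
  rcases h1 with h1 | ⟨s, h1, h1'⟩
  · exact Or.inl (h.ll_neg_right h1)
  · exact Or.inr ⟨s, h1, h.ll_neg_right h1'⟩

/-- This makes `LT` a strict weak order; closure of the valuation ring under products and sums rests
on it. -/
theorem lt_or_lt {p q r : K} (h1 : LT D I p r) (hp : p ≠ 0) (hr : r ≠ 0) (hq : q ≠ 0) :
    LT D I p q ∨ LT D I q r := by
  by_cases hpq : Sep I p q
  · rcases h.ll_total hp hq hpq with h2 | h2
    · exact Or.inl (Or.inl h2)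
    · exact Or.inr (h.lt_trans (Or.inl h2) h1)
  by_cases hqr : Sep I q r
  · rcases h.ll_total hq hr hqr with h2 | h2
    · exact Or.inr (Or.inl h2)
    · exact Or.inl (h.lt_ll h1 h2)
  rcases h1 with h1 | ⟨s, h1, h1'⟩
  · exact absurd (sep_of_ne h1.sep hpq) hqr
  · rcases h.ll_total hq h1.right_ne (sep_of_ne h1.sep hpq) with h2 | h2
    · exact Or.inr (Or.inr ⟨s, h2, h1'⟩)
    · exact Or.inl (Or.inr ⟨s, h1, h2⟩)

/-- From `x ≪ x + y` it follows that `y` has the class of `x + y`, so `y < x + y` needs an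
intermediate `s`. Computing `-y + s + (x + y) = x + s` then puts `x` into the class of `s`, and
likewise into that of `b * s`. -/
theorem not_lt_add_of_sep {x y : K} (h1 : LT D I x (x + y)) (h2 : LT D I y (x + y))
    (hs : Sep I x (x + y)) : False := by
  have a1 := h.lt_sep h1 hs
  have hyz : Eqv D y (x + y) := by
    have := (h.ll_neg_left a1).eqv
    rwa [show -x + (x + y) = y by ring] at this
  rcases h2 with h2 | ⟨s, h2, h2'⟩
  · exact h.not_eqv h2.sep hyz
  have key : ∀ s, LL D I y s → LL D I s (x + y) → Eqv D x s := by
    intro s b1 b2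
    have b3 := h.ll_add (h.ll_neg_left b1) b2
    have e := b3.eqv
    have hne := h.add_ne b3.sep
    rw [show -y + s + (x + y) = x + s by ring] at e hne
    rcases h.tri b2.left_ne hne rfl
      (h.sep_congr (fun _ _ => rfl) e.symm b2.sep) with e' | e'
    · exact absurd (e'.trans e) (h.not_eqv hs)
    · exact e'
  exact h.not_eqv_mul h2.right_ne ((key s h2 h2').symm.trans
    (key (b * s) (h.ll_mul_right h2) (h.ll_mul_left h2')))

theorem not_lt_add {x y : K} (h1 : LT D I x (x + y)) (h2 : LT D I y (x + y))
    (hy : y ≠ 0) : False := by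
  by_cases hxs : Sep I x (x + y)
  · exact h.not_lt_add_of_sep h1 h2 hxs
  by_cases hys : Sep I y (x + y)
  · rw [add_comm] at h1 h2 hys
    exact h.not_lt_add_of_sep h2 h1 hys
  rcases h1 with h1 | ⟨s, h1, h1'⟩
  · exact hxs h1.sep
  rcases h2 with h2 | ⟨t, h2, h2'⟩
  · exact hys h2.sep
  -- Now neither summand is separated from the sum, so intermediates `s` and `t` exist for both.
  -- Every such `s` has the class of `t`; but `s` and `b * s` both qualify.
  have key : ∀ s, LL D I x s → LL D I s (x + y) → Eqv D s t := by
    intro s b1 b2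
    have b3 := h.ll_add (h.ll_neg_left b1) b2
    have e := b3.eqv
    have hne := h.add_ne b3.sep
    rw [show -x + s + (x + y) = y + s by ring] at e hne
    have hsy : Sep I s y := by
      by_contra hn
      exact hys (sep_of_ne b2.sep hn)
    have b4 : LL D I s y := by
      rcases h.ll_total b2.left_ne hy hsy with b4 | b4
      · exact b4
      · exact absurd (b4.eqv.symm.trans e) (h.not_eqv b2.sep)
    have b5 := h.ll_add (h.ll_add (h.ll_add (h.ll_neg_left b1) (h.ll_neg_right b4))
      (h.ll_neg_left h2)) h2'
    have e5 := b5.eqv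
    have hne5 := h.add_ne b5.sep
    rw [show -x + s + -y + t + (x + y) = s + t by ring] at e5 hne5
    rcases h.tri h2'.left_ne hne5 rfl
      (h.sep_congr (fun _ _ => rfl) e5.symm h2'.sep) with e' | e'
    · exact absurd (e'.trans e5) (h.not_eqv b2.sep)
    · exact e'
  exact h.not_eqv_mul h1.right_ne ((key s h1 h1').trans
    (key (b * s) (h.ll_mul_right h1) (h.ll_mul_left h1')).symm)

theorem lt_inv {x : K} (hx : x ≠ 0) (h1 : LT D I 1 x⁻¹) : LT D I x 1 := by
  have := h.lt_mul hx h1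
  rwa [mul_one, mul_inv_cancel₀ hx] at this

/-- Through an intermediate `s` the element `1 + x` gets the class of `1` or of `s`. Repeating this
with `b * s` rules out the second possibility. -/
theorem eqv_one_add {x : K} (hx : LT D I x 1) : Eqv D (1 + x) 1 := by
  rcases hx with hx | ⟨s, h1, h2⟩
  · have := hx.eqv
    rwa [add_comm] at this
  have hne : 1 + x ≠ 0 := by
    intro h0
    have : x = -1 := by linear_combination h0
    subst this
    have := h.ll_neg_left h1
    rw [neg_neg] at this
    exact h.ll_asymm this h2
  have key : ∀ s, LL D I x s → LL D I s 1 → Eqv D (1 + x) 1 ∨ Eqv D (1 + x) s := by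
    intro s b1 b2
    have b3 := h.ll_add b1 b2
    have e := b3.eqv
    have hn := h.add_ne b3.sep
    rw [show x + s + 1 = 1 + x + s by ring] at e hn
    rcases h.tri b2.left_ne hn rfl
      (h.sep_congr (fun _ _ => rfl) e.symm b2.sep) with e' | e'
    · exact Or.inl (e'.trans e)
    · exact Or.inr e'
  rcases key s h1 h2 with e | e
  · exact e
  rcases key (b * s) (h.ll_mul_right h1) (h.ll_mul_left h2) with e' | e'
  · exact e'
  · exact absurd (e.symm.trans e') (h.not_eqv_mul h1.right_ne)

/-- The valuation ring attached to a non-commutative family of characters with centre `I`. -/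
theorem exists_valuationSubring : ∃ A : ValuationSubring K,
    (∀ f ∈ I, ∀ x ∈ A.unitGroup, f (x : K) = 0) ∧
    (∀ g ∈ D, ∀ x ∈ A.principalUnitGroup, g (x : K) = 0) := by
  have no : ¬ LT D I 1 (0 : K) := by
    rintro (h1 | ⟨s, h1, h2⟩)
    · exact h1.right_ne rfl
    · exact h2.right_ne rfl
  have dich : ∀ x : K, ¬ LT D I 1 x ∨ ¬ LT D I 1 x⁻¹ := by
    intro x
    by_cases hx : x = 0
    · left; rwa [hx]
    · by_contra! hn
      exact h.lt_irrefl (h.lt_trans hn.1 (h.lt_inv hx hn.2))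
  -- `LT D I 1 x` says that `x` is strictly larger than `1`, so the ring consists of the elements
  -- for which this fails, including `0`.
  let A : ValuationSubring K :=
    { carrier := {x | ¬ LT D I 1 x}
      mul_mem' := by
        intro x y hx hy hxy
        by_cases h0 : x = 0
        · rw [h0, zero_mul] at hxy; exact no hxy
        by_cases h0' : y = 0
        · rw [h0', mul_zero] at hxy; exact no hxy
        rcases h.lt_or_lt hxy one_ne_zero (mul_ne_zero h0 h0') h0 with h1 | h1
        · exact hx h1
        · have := h.lt_mul (inv_ne_zero h0) h1
          rw [inv_mul_cancel₀ h0, inv_mul_cancel_left₀ h0] at this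
          exact hy this
      one_mem' := fun h1 => h.lt_irrefl h1
      add_mem' := by
        intro x y hx hy hxy
        by_cases h0 : x = 0
        · rw [h0, zero_add] at hxy; exact hy hxy
        by_cases h0' : y = 0
        · rw [h0', add_zero] at hxy; exact hx hxy
        have hne : x + y ≠ 0 := by
          intro h1; rw [h1] at hxy; exact no hxy
        rcases h.lt_or_lt hxy one_ne_zero hne h0 with h1 | h1
        · exact hx h1
        rcases h.lt_or_lt hxy one_ne_zero hne h0' with h2 | h2
        · exact hy h2
        exact h.not_lt_add h1 h2 h0'
      zero_mem' := no
      neg_mem' := by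
        intro x hx hn
        have := h.lt_neg_right hn
        rw [neg_neg] at this
        exact hx this
      mem_or_inv_mem' := dich }
  have hA : ∀ x, x ∈ A ↔ ¬ LT D I 1 x := fun x => Iff.rfl
  refine ⟨A, ?_, ?_⟩
  · intro f hf x hx
    by_contra hn
    have hsep : Sep I (1 : K) (x : K) :=
      ⟨f, hf, by rw [(h.log f (h.sub hf)).one]; exact fun h' => hn h'.symm⟩
    have hu : A.valuation (x : K) = 1 := hx
    have h1 : (x : K) ∈ A := by rw [← A.valuation_le_one_iff, hu]
    have h2 : (x : K)⁻¹ ∈ A := by rw [← A.valuation_le_one_iff, map_inv₀, hu, inv_one]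
    rcases h.ll_total one_ne_zero x.ne_zero hsep with h3 | h3
    · exact h1 (Or.inl h3)
    · have := h.ll_mul (inv_ne_zero x.ne_zero) h3
      rw [inv_mul_cancel₀ x.ne_zero, mul_one] at this
      exact h2 (Or.inl this)
  · intro g hg x hx
    by_cases h0 : (x : K) - 1 = 0
    · rw [sub_eq_zero.mp h0, (h.log g hg).one]
    have hv : A.valuation ((x : K) - 1) < 1 := hx
    have hi : ((x : K) - 1)⁻¹ ∉ A := by
      rw [← A.valuation_le_one_iff, map_inv₀, not_le]
      exact (one_lt_inv₀ (zero_lt_iff.mpr ((Valuation.ne_zero_iff _).mpr h0))).mpr hv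
    have hlt : LT D I ((x : K) - 1) 1 := h.lt_inv h0 (not_not.mp hi)
    have := h.eqv_one_add hlt g hg
    rwa [add_sub_cancel, (h.log g hg).one] at this

end CommData

end Core

/-! ### Characters and valuations -/

section Characters

universe u w

/-- Characters of `Kˣ` with values in (the additive group of) `R`. -/
abbrev Ch (R : Type w) [CommRing R] (K : Type u) [Field K] := Additive Kˣ →+ R

variable {K : Type u} [Field K] {R : Type w} [CommRing R]

/-- Evaluation of a character. -/
def ev (f : Ch R K) (x : Kˣ) : R := f (Additive.ofMul x)

@[simp] theorem ev_mul (f : Ch R K) (x y : Kˣ) : ev f (x * y) = ev f x + ev f y := map_add f _ _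
@[simp] theorem ev_one (f : Ch R K) : ev f 1 = 0 := map_zero f
@[simp] theorem ev_inv (f : Ch R K) (x : Kˣ) : ev f x⁻¹ = -ev f x := map_neg f _
@[simp] theorem ev_div (f : Ch R K) (x y : Kˣ) : ev f (x / y) = ev f x - ev f y := map_sub f _ _
@[simp] theorem ev_pow (f : Ch R K) (x : Kˣ) (n : ℕ) : ev f (x ^ n) = n * ev f x := by
  rw [← nsmul_eq_mul]
  exact map_nsmul f n (Additive.ofMul x)
@[simp] theorem ev_zpow (f : Ch R K) (x : Kˣ) (n : ℤ) : ev f (x ^ n) = n * ev f x := by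
  rw [← zsmul_eq_mul]
  exact map_zsmul f n (Additive.ofMul x)
@[simp] theorem ev_zero (x : Kˣ) : ev (0 : Ch R K) x = 0 := rfl

theorem ch_ext {f g : Ch R K} (h : ∀ x, ev f x = ev g x) : f = g := AddMonoidHom.ext h

/-- Two characters commute if the pairs `(f x, f (1 - x))` and `(g x, g (1 - x))` are always
proportional. -/
def Comm (f g : Ch R K) : Prop :=
  ∀ x y : Kˣ, (x : K) + (y : K) = 1 → ev f x * ev g y = ev f y * ev g x

theorem Comm.symm {f g : Ch R K} (h : Comm f g) : Comm g f := by
  intro x y hxy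
  linear_combination -(h x y hxy)

variable (K R) in
/-- The characters that are trivial on `-1`. -/
def full : Set (Ch R K) := {f | ev f (-1) = 0}

theorem ev_neg {f : Ch R K} (hf : f ∈ full K R) (x : Kˣ) : ev f (-x) = ev f x := by
  rw [← neg_one_mul, ev_mul, show ev f (-1) = 0 from hf, zero_add]

/-- The centre of a family of characters. -/
def ctr (D : Set (Ch R K)) : Set (Ch R K) := {f | f ∈ D ∧ ∀ g ∈ D, Comm f g}

variable (R) in
/-- The characters that are trivial on `-1` and on the principal units. -/
def dec (A : ValuationSubring K) : Set (Ch R K) :=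
  {f | f ∈ full K R ∧ ∀ x ∈ A.principalUnitGroup, ev f x = 0}

variable (R) in
/-- The characters that are trivial on the units. -/
def inr (A : ValuationSubring K) : Set (Ch R K) := {f | ∀ x ∈ A.unitGroup, ev f x = 0}

theorem neg_one_mem_unitGroup (A : ValuationSubring K) : (-1 : Kˣ) ∈ A.unitGroup := by
  rw [A.mem_unitGroup_iff]
  simp

theorem inr_subset_dec (A : ValuationSubring K) : inr R A ⊆ dec R A := fun _ hf =>
  ⟨hf _ (neg_one_mem_unitGroup A), fun x hx => hf x (A.principal_units_le_units hx)⟩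

theorem dec_mono {A B : ValuationSubring K} (h : A ≤ B) : dec R A ⊆ dec R B := fun _ hf =>
  ⟨hf.1, fun x hx =>
    hf.2 x (ValuationSubring.principalUnitGroup_le_principalUnitGroup.mpr h hx)⟩

theorem inr_anti {A B : ValuationSubring K} (h : A ≤ B) : inr R B ⊆ inr R A := fun _ hf x hx =>
  hf x (ValuationSubring.unitGroup_le_unitGroup.mpr h hx)

/-- If one of `x`, `y` lies in the maximal ideal, the other is a principal unit. Otherwise `x` is
not integral and `-y/x = 1 - x⁻¹` is a principal unit. In each case all characters in `dec` satisfy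
one common linear relation at the pair, which makes commutation automatic. -/
theorem pair_cases {A : ValuationSubring K} {x y : Kˣ}
    (hxy : (x : K) + y = 1) (h : ¬ (x ∈ A.unitGroup ∧ y ∈ A.unitGroup)) :
    (∀ f ∈ dec R A, ev f y = 0) ∨
    (∀ f ∈ dec R A, ev f x = 0) ∨ (∀ f ∈ dec R A, ev f x = ev f y) := by
  by_cases hx : A.valuation (x : K) < 1
  · left
    intro f hf
    refine hf.2 y ?_
    rw [A.mem_principalUnitGroup_iff, show (y : K) - 1 = -x by rw [← hxy]; ring,
      Valuation.map_neg]
    exact hx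
  by_cases hy : A.valuation (y : K) < 1
  · right; left
    intro f hf
    refine hf.2 x ?_
    rw [A.mem_principalUnitGroup_iff, show (x : K) - 1 = -y by rw [← hxy]; ring,
      Valuation.map_neg]
    exact hy
  right; right
  have hx1 : 1 < A.valuation (x : K) := by
    rcases (not_lt.mp hx).lt_or_eq with h1 | h1
    · exact h1
    rcases (not_lt.mp hy).lt_or_eq with h2 | h2
    · exfalso
      have := A.valuation.map_sub (1 : K) x
      rw [show (1 : K) - x = y by rw [← hxy]; ring, map_one, ← h1, max_self] at this
      exact absurd this (not_le.mpr h2)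
    · exact absurd ⟨h1.symm, h2.symm⟩ h
  intro f hf
  have : ev f (-y / x) = 0 := by
    refine hf.2 _ ?_
    rw [A.mem_principalUnitGroup_iff]
    have e : ((-y / x : Kˣ) : K) - 1 = -(x : K)⁻¹ := by
      rw [Units.val_div_eq_div_val, Units.val_neg]
      have := x.ne_zero
      field_simp
      linear_combination -hxy
    rw [e, Valuation.map_neg, map_inv₀]
    exact inv_lt_one_of_one_lt₀ hx1
  rw [ev_div, ev_neg hf.1] at this
  exact (sub_eq_zero.mp this).symm

/-- The reduction `𝒪_vˣ → k(v)ˣ`. -/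
noncomputable abbrev rs (A : ValuationSubring K) : A.unitGroup →* (IsLocalRing.ResidueField A)ˣ :=
  A.unitGroupToResidueFieldUnits

theorem rs_surjective (A : ValuationSubring K) : Function.Surjective (rs A) :=
  A.surjective_unitGroupToResidueFieldUnits

theorem rs_eq_one_iff (A : ValuationSubring K) (u : A.unitGroup) :
    rs A u = 1 ↔ (u : Kˣ) ∈ A.principalUnitGroup := by
  have := A.ker_unitGroupToResidueFieldUnits
  rw [← MonoidHom.mem_ker, this]
  rfl

theorem rs_neg_one (A : ValuationSubring K) :
    rs A ⟨-1, neg_one_mem_unitGroup A⟩ = -1 := by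
  apply Units.ext
  rw [A.coe_unitGroupToResidueFieldUnits_apply]
  rw [Units.val_neg, Units.val_one, ← map_one (IsLocalRing.residue A), ← map_neg]
  congr 1

theorem rs_add_iff (A : ValuationSubring K) (u u' : A.unitGroup) :
    (rs A u : IsLocalRing.ResidueField A) + rs A u' = 1 ↔
      A.valuation (((u : Kˣ) : K) + ((u' : Kˣ) : K) - 1) < 1 := by
  rw [A.coe_unitGroupToResidueFieldUnits_apply, A.coe_unitGroupToResidueFieldUnits_apply]
  have : ∀ a b : A, IsLocalRing.residue A a + IsLocalRing.residue A b = 1 ↔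
      A.valuation ((a : K) + b - 1) < 1 := by
    intro a b
    rw [← map_add, ← sub_eq_zero, ← map_one (IsLocalRing.residue A), ← map_sub,
      IsLocalRing.residue_eq_zero_iff, A.valuation_lt_one_iff]
    rfl
  exact this _ _

theorem unitGroup_root {A : ValuationSubring K} {n : ℕ} (hn : n ≠ 0) {x : Kˣ}
    (h : x ^ n ∈ A.unitGroup) : x ∈ A.unitGroup := by
  rw [A.mem_unitGroup_iff] at h ⊢
  rw [Units.val_pow_eq_pow_val, map_pow] at h
  exact (pow_eq_one_iff.mp h).resolve_right hn

/-- `h` is the character of the residue field induced by `f`. -/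
def Lifts (A : ValuationSubring K) (f : Ch R K) (h : Ch R (IsLocalRing.ResidueField A)) : Prop :=
  ∀ u : A.unitGroup, ev f u = ev h (rs A u)

variable {A : ValuationSubring K}

theorem exists_residue_ch {f : Ch R K} (hf : f ∈ dec R A) :
    ∃ h ∈ full (IsLocalRing.ResidueField A) R, Lifts A f h := by
  have hs := rs_surjective A
  have key : ∀ u u' : A.unitGroup, rs A u = rs A u' → ev f (u : Kˣ) = ev f (u' : Kˣ) := by
    intro u u' h
    have h1 : rs A (u / u') = 1 := by rw [map_div, h, div_self']
    have h2 := hf.2 _ ((rs_eq_one_iff A _).mp h1)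
    rw [Subgroup.coe_div, ev_div] at h2
    exact sub_eq_zero.mp h2
  obtain ⟨σ, hσ⟩ : ∃ σ : (IsLocalRing.ResidueField A)ˣ → A.unitGroup, ∀ z, rs A (σ z) = z :=
    ⟨Function.surjInv hs, Function.surjInv_eq hs⟩
  let h : Ch R (IsLocalRing.ResidueField A) := AddMonoidHom.mk'
    (fun z => ev f (σ z.toMul : Kˣ)) (by
      intro z z'
      rw [← ev_mul]
      refine key (σ (z + z').toMul) (σ z.toMul * σ z'.toMul) ?_
      rw [map_mul, hσ, hσ, hσ]
      rfl)
  have hl : Lifts A f h := fun u => key _ _ (hσ _).symm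
  refine ⟨h, ?_, hl⟩
  have := hl ⟨-1, neg_one_mem_unitGroup A⟩
  rw [rs_neg_one] at this
  exact this.symm.trans hf.1

/-- The pulled-back character on the units extends to `Kˣ` because the value group is torsion-free
and `R` is compact. -/
theorem exists_lift_ch [TopologicalSpace R] [IsTopologicalRing R] [CompactSpace R] [T2Space R]
    {h : Ch R (IsLocalRing.ResidueField A)} (hh : h ∈ full (IsLocalRing.ResidueField A) R) :
    ∃ f ∈ dec R A, Lifts A f h := by
  obtain ⟨f, hf⟩ := exists_extension (W := Additive Kˣ) (R := R) A.unitGroup.toAddSubgroup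
    (fun n hn x hx => unitGroup_root hn hx)
    (AddMonoidHom.mk' (fun u => ev h (rs A ⟨u.1.toMul, u.2⟩)) (by
      intro u u'
      rw [← ev_mul, ← map_mul]
      rfl))
  have hl : Lifts A f h := fun u => hf ⟨Additive.ofMul (u : Kˣ), u.2⟩
  refine ⟨f, ⟨?_, fun x hx => ?_⟩, hl⟩
  · have := hl ⟨-1, neg_one_mem_unitGroup A⟩
    rw [rs_neg_one] at this
    exact this.trans hh
  · have := hl ⟨x, A.principal_units_le_units hx⟩
    rw [(rs_eq_one_iff A _).mpr hx, ev_one] at this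
    exact this

theorem Lifts.mem_inr_iff {f : Ch R K} {h : Ch R (IsLocalRing.ResidueField A)}
    (hl : Lifts A f h) : f ∈ inr R A ↔ h = 0 := by
  constructor
  · intro hf
    apply ch_ext
    intro x
    obtain ⟨u, rfl⟩ := rs_surjective A x
    rw [← hl, ev_zero]
    exact hf u u.2
  · rintro rfl x hx
    exact hl ⟨x, hx⟩

/-- By `pair_cases` only pairs of units matter, and these reduce to residue pairs. Conversely, a
residue pair is the reduction of an exact relation `u + w = 1`, on replacing `u'` by `w = 1 - u`,
which has the same residue. -/
theorem Lifts.comm_iff {f g : Ch R K} {h h' : Ch R (IsLocalRing.ResidueField A)}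
    (hf : f ∈ dec R A) (hg : g ∈ dec R A) (hl : Lifts A f h) (hl' : Lifts A g h') :
    Comm f g ↔ Comm h h' := by
  constructor
  · intro hc x y hxy
    obtain ⟨u, rfl⟩ := rs_surjective A x
    obtain ⟨u', rfl⟩ := rs_surjective A y
    have hv := (rs_add_iff A u u').mp hxy
    have hu' : A.valuation ((u' : Kˣ) : K) = 1 := u'.2
    have hw : A.valuation (1 - ((u : Kˣ) : K)) = 1 := by
      have := A.valuation.map_sub_eq_of_lt_right (x := ((u : Kˣ) : K) + (u' : Kˣ) - 1)
        (y := ((u' : Kˣ) : K)) (by rw [hu']; exact hv)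
      rw [hu', ← Valuation.map_neg] at this
      rw [← this]
      congr 1
      ring
    have hne : 1 - ((u : Kˣ) : K) ≠ 0 := by
      intro h0
      rw [h0, map_zero] at hw
      exact zero_ne_one hw
    let w : A.unitGroup := ⟨Units.mk0 _ hne, hw⟩
    have hw' : rs A w = rs A u' := by
      have h1 : (rs A u : IsLocalRing.ResidueField A) + rs A w = 1 := by
        rw [rs_add_iff]
        have : ((u : Kˣ) : K) + ((w : Kˣ) : K) - 1 = 0 := by
          change ((u : Kˣ) : K) + (1 - ((u : Kˣ) : K)) - 1 = 0
          ring
        rw [this, map_zero]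
        exact zero_lt_one
      apply Units.ext
      exact add_left_cancel (h1.trans hxy.symm)
    rw [← hw', ← hl, ← hl, ← hl', ← hl']
    exact hc _ _ (add_sub_cancel _ _)
  · intro hc x y hxy
    by_cases hu : x ∈ A.unitGroup ∧ y ∈ A.unitGroup
    · have e : ((rs A ⟨x, hu.1⟩ : (IsLocalRing.ResidueField A)ˣ) : IsLocalRing.ResidueField A) +
          rs A ⟨y, hu.2⟩ = 1 := by
        rw [rs_add_iff, hxy, sub_self, map_zero]
        exact zero_lt_one
      have := hc _ _ e
      rwa [← hl, ← hl, ← hl', ← hl'] at this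
    · rcases pair_cases (R := R) hxy hu with h1 | h1 | h1
      · rw [h1 f hf, h1 g hg]; ring
      · rw [h1 f hf, h1 g hg]; ring
      · rw [h1 f hf, h1 g hg]

theorem comm_of_inr_dec {f g : Ch R K} (hf : f ∈ inr R A) (hg : g ∈ dec R A) : Comm f g := by
  obtain ⟨h', -, hl'⟩ := exists_residue_ch hg
  have hl : Lifts A f 0 := fun u => hf u u.2
  rw [hl.comm_iff (inr_subset_dec A hf) hg hl']
  intro x y _
  simp

theorem inr_subset_ctr_dec : inr R A ⊆ ctr (dec R A) := fun _ hf =>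
  ⟨inr_subset_dec A hf, fun _ hg => comm_of_inr_dec hf hg⟩

section Coeff

variable [TopologicalSpace R] [IsTopologicalRing R] [CompactSpace R] [T2Space R]

/-- Restriction to and lifting from the residue field respect commutation, and `inr` is what
restricts to `0`. This turns the condition on `k(v)` in the definition of `V` into one on characters
of `Kˣ`. -/
theorem ctr_dec_eq_iff :
    ctr (dec R A) = inr R A ↔ ctr (full (IsLocalRing.ResidueField A) R) = {0} := by
  constructor
  · intro h
    apply Set.eq_singleton_iff_unique_mem.mpr
    refine ⟨⟨ev_zero _, fun g _ x y _ => by simp⟩, ?_⟩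
    rintro f ⟨hf, hc⟩
    obtain ⟨f', hf', hl⟩ := exists_lift_ch (A := A) hf
    rw [← hl.mem_inr_iff, ← h]
    refine ⟨hf', fun g hg => ?_⟩
    obtain ⟨g', hg', hl'⟩ := exists_residue_ch hg
    exact (hl.comm_iff hf' hg hl').mpr (hc g' hg')
  · intro h
    refine Set.Subset.antisymm ?_ inr_subset_ctr_dec
    rintro f ⟨hf, hc⟩
    obtain ⟨f', hf', hl⟩ := exists_residue_ch hf
    rw [hl.mem_inr_iff]
    have : f' ∈ ctr (full (IsLocalRing.ResidueField A) R) := by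
      refine ⟨hf', fun g hg => ?_⟩
      obtain ⟨g', hg', hl'⟩ := exists_lift_ch (A := A) hg
      exact (hl.comm_iff hf hg' hl').mp (hc g' hg')
    rw [h] at this
    exact this

theorem dec_eq_inr_iff :
    dec R A = inr R A ↔ full (IsLocalRing.ResidueField A) R = {0} := by
  constructor
  · intro h
    apply Set.eq_singleton_iff_unique_mem.mpr
    refine ⟨ev_zero _, fun f hf => ?_⟩
    obtain ⟨f', hf', hl⟩ := exists_lift_ch (A := A) hf
    rw [← hl.mem_inr_iff, ← h]
    exact hf'
  · intro h
    refine Set.Subset.antisymm ?_ (inr_subset_dec A)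
    intro f hf
    obtain ⟨f', hf', hl⟩ := exists_residue_ch hf
    rw [hl.mem_inr_iff]
    rw [h] at hf'
    exact hf'

end Coeff

end Characters

/-! ### Divisibility in value groups -/

section ValueGroups

universe u w

variable {K : Type u} [Field K] {R : Type w} [CommRing R] {ℓ : ℕ}

theorem mem_U_iff {A : ValuationSubring K} {z : Kˣ} :
    z ∈ U ℓ A ↔ ∃ y : Kˣ, z / y ^ ℓ ∈ A.unitGroup := by
  constructor
  · intro h
    obtain ⟨a, ha, b, ⟨y, rfl⟩, rfl⟩ := Subgroup.mem_sup.mp h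
    refine ⟨y, ?_⟩
    simpa using ha
  · rintro ⟨y, hy⟩
    rw [← div_mul_cancel z (y ^ ℓ)]
    exact Subgroup.mul_mem_sup hy ⟨y, rfl⟩

theorem mem_U_iff' {A : ValuationSubring K} {z : Kˣ} :
    z ∈ U ℓ A ↔ ∃ y : Kˣ, A.valuation (z : K) = A.valuation (y : K) ^ ℓ := by
  rw [mem_U_iff]
  refine exists_congr fun y => ?_
  rw [A.mem_unitGroup_iff, Units.val_div_eq_div_val, map_div₀, Units.val_pow_eq_pow_val, map_pow,
    div_eq_one_iff_eq]
  exact pow_ne_zero _ ((Valuation.ne_zero_iff _).mpr y.ne_zero)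

/-- If every value between `v x` and `1` were an ℓ-th power, the convex subgroup generated by `v x`
would be ℓ-divisible. -/
theorem noDivisibleConvex_iff (hℓ : ℓ ≠ 0) {A : ValuationSubring K} :
    NoDivisibleConvex ℓ A ↔ ∀ x : Kˣ, A.valuation (x : K) < 1 →
      ∃ z : Kˣ, A.valuation (z : K) ≤ 1 ∧ A.valuation (x : K) ≤ A.valuation (z : K) ∧
        z ∉ U ℓ A := by
  have hsurj : ∀ γ : (A.ValueGroup)ˣ, ∃ x : Kˣ, A.valuation (x : K) = γ := by
    intro γ
    obtain ⟨x, hx⟩ := A.valuation_surjective (γ : A.ValueGroup)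
    have : x ≠ 0 := by
      rintro rfl
      rw [map_zero] at hx
      exact γ.ne_zero hx.symm
    exact ⟨Units.mk0 x this, hx⟩
  constructor
  · intro h x hx
    by_contra! hn
    have hn' : ∀ γ : (A.ValueGroup)ˣ, γ ≤ 1 → A.valuation (x : K) ≤ γ → ∃ δ, δ ^ ℓ = γ := by
      intro γ h1 h2
      obtain ⟨z, hz⟩ := hsurj γ
      obtain ⟨y, hy⟩ := mem_U_iff'.mp (hn z (by rw [hz]; exact_mod_cast h1) (by rwa [hz]))
      refine ⟨Units.map (A.valuation : K →* A.ValueGroup) y, ?_⟩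
      apply Units.ext
      rw [Units.val_pow_eq_pow_val, ← hz, hy]
      rfl
    let a : (A.ValueGroup)ˣ := Units.map (A.valuation : K →* A.ValueGroup) x
    have ha : (a : A.ValueGroup) = A.valuation (x : K) := rfl
    have ha1 : a < 1 := by
      rw [← Units.val_lt_val, ha]
      exact hx
    -- Dividing by `a` propagates divisibility from the interval `[a, 1]` to `[a ^ n, 1]`.
    have claim : ∀ n : ℕ, ∀ γ : (A.ValueGroup)ˣ, a ^ n ≤ γ → γ ≤ 1 → ∃ δ, δ ^ ℓ = γ := by
      intro n
      induction n with
      | zero =>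
        intro γ h1 h2
        rw [pow_zero] at h1
        exact ⟨1, by rw [one_pow, le_antisymm h2 h1]⟩
      | succ n ih =>
        intro γ h1 h2
        by_cases h3 : a ≤ γ
        · exact hn' γ h2 (by rw [← ha]; exact_mod_cast h3)
        · obtain ⟨δ, hδ⟩ := ih (γ / a) (by rwa [le_div_iff_mul_le, ← pow_succ])
            (by rw [div_le_one']; exact (not_le.mp h3).le)
          obtain ⟨ε, hε⟩ := hn' a ha1.le le_rfl
          exact ⟨δ * ε, by rw [mul_pow, hδ, hε, div_mul_cancel]⟩
    let Δ : Subgroup (A.ValueGroup)ˣ :=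
      { carrier := {γ | ∃ n : ℕ, a ^ n ≤ γ ∧ a ^ n ≤ γ⁻¹}
        one_mem' := ⟨0, by simp⟩
        mul_mem' := by
          rintro γ δ ⟨n, h1, h2⟩ ⟨m, h3, h4⟩
          refine ⟨n + m, ?_, ?_⟩
          · rw [pow_add]; exact mul_le_mul' h1 h3
          · rw [pow_add, mul_inv]; exact mul_le_mul' h2 h4
        inv_mem' := by
          rintro γ ⟨n, h1, h2⟩
          exact ⟨n, h2, by rwa [inv_inv]⟩ }
    have hmem : ∀ γ, γ ∈ Δ ↔ ∃ n : ℕ, a ^ n ≤ γ ∧ a ^ n ≤ γ⁻¹ := fun γ => Iff.rfl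
    have hle : ∀ γ : (A.ValueGroup)ˣ, γ ∈ Δ → γ ≤ 1 → ∃ δ ∈ Δ, δ ^ ℓ = γ := by
      rintro γ ⟨n, h1, h2⟩ h3
      obtain ⟨δ, hδ⟩ := claim n γ h1 h3
      have hδ1 : δ ≤ 1 := by
        rw [← hδ] at h3
        exact (pow_le_one_iff hℓ).mp h3
      have hδ2 : γ ≤ δ := by
        rw [← hδ]
        calc δ ^ ℓ ≤ δ ^ 1 := pow_le_pow_right_of_le_one' hδ1 (Nat.one_le_iff_ne_zero.mpr hℓ)
          _ = δ := pow_one δ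
      exact ⟨δ, ⟨n, h1.trans hδ2, (h1.trans h3).trans (one_le_inv'.mpr hδ1)⟩, hδ⟩
    have hΔ := h Δ ⟨by
        rintro γ ⟨n, h1, -⟩ δ ⟨m, -, h2⟩ ε ⟨h3, h4⟩
        refine ⟨n + m, ?_, ?_⟩
        · exact (pow_le_pow_right_of_le_one' ha1.le (Nat.le_add_right n m)).trans (h1.trans h3)
        · exact (pow_le_pow_right_of_le_one' ha1.le (Nat.le_add_left m n)).trans
            (h2.trans (inv_le_inv' h4))⟩ (by
        intro γ hγ
        rcases le_total γ 1 with h1 | h1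
        · exact hle γ hγ h1
        · obtain ⟨δ, hδ, hδ'⟩ := hle γ⁻¹ (Δ.inv_mem hγ) (inv_le_one'.mpr h1)
          exact ⟨δ⁻¹, Δ.inv_mem hδ, by rw [inv_pow, hδ', inv_inv]⟩)
    have : a ∈ Δ := ⟨1, by rw [pow_one], by
      rw [pow_one]; exact ha1.le.trans (one_le_inv'.mpr ha1.le)⟩
    rw [hΔ, Subgroup.mem_bot] at this
    exact ha1.ne this
  · intro h Δ hΔ hdiv
    have key : ∀ γ ∈ Δ, ¬ γ < 1 := by
      intro γ hγ h1
      obtain ⟨x, hx⟩ := hsurj γ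
      obtain ⟨z, hz1, hz2, hz⟩ := h x (by rw [hx]; exact_mod_cast h1)
      let c : (A.ValueGroup)ˣ := Units.map (A.valuation : K →* A.ValueGroup) z
      have hc : (c : A.ValueGroup) = A.valuation (z : K) := rfl
      have hcΔ : c ∈ Δ := hΔ.out hγ Δ.one_mem ⟨by
        rw [← Units.val_le_val, hc, ← hx]; exact hz2, by
        rw [← Units.val_le_val, hc]; exact hz1⟩
      obtain ⟨d, -, hd⟩ := hdiv c hcΔ
      obtain ⟨y, hy⟩ := hsurj d
      apply hz
      rw [mem_U_iff']
      refine ⟨y, ?_⟩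
      rw [hy, ← hc, ← hd, Units.val_pow_eq_pow_val]
    rw [Subgroup.eq_bot_iff_forall]
    intro γ hγ
    rcases lt_trichotomy γ 1 with h1 | h1 | h1
    · exact absurd h1 (key γ hγ)
    · exact h1
    · exact absurd (inv_lt_one'.mpr h1) (key _ (Δ.inv_mem hγ))

theorem unitGroup_le_U (A : ValuationSubring K) : A.unitGroup ≤ U ℓ A := le_sup_left

/-- In the torsion-free group `Kˣ/𝒪_vˣ`, not lying in `U` means not being divisible by `ℓ`, so
`exists_hom_ne_zero` applies. -/
theorem exists_inr_ne_zero [Fact ℓ.Prime] [TopologicalSpace R] [Coeff ℓ R]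
    {A : ValuationSubring K} {x : Kˣ} (hx : x ∉ U ℓ A) : ∃ f ∈ inr R A, ev f x ≠ 0 := by
  obtain ⟨f, hf⟩ := exists_hom_ne_zero (W := Additive (Kˣ ⧸ A.unitGroup)) (R := R) ℓ
    (w := Additive.ofMul (QuotientGroup.mk' A.unitGroup x))
    (by
      intro n hn y hy
      obtain ⟨z, hz⟩ := QuotientGroup.mk'_surjective A.unitGroup y.toMul
      have h1 : QuotientGroup.mk' A.unitGroup (z ^ n) = 1 := by
        rw [map_pow, hz]
        exact hy
      have h2 := unitGroup_root hn ((QuotientGroup.eq_one_iff _).mp h1)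
      have h3 : QuotientGroup.mk' A.unitGroup z = 1 := (QuotientGroup.eq_one_iff _).mpr h2
      rw [hz] at h3
      exact h3)
    (by
      intro y hy
      obtain ⟨z, hz⟩ := QuotientGroup.mk'_surjective A.unitGroup y.toMul
      apply hx
      rw [mem_U_iff]
      refine ⟨z, ?_⟩
      rw [← QuotientGroup.eq_one_iff]
      have h1 : QuotientGroup.mk' A.unitGroup (z ^ ℓ) = QuotientGroup.mk' A.unitGroup x := by
        rw [map_pow, hz]
        exact hy
      have h2 : QuotientGroup.mk' A.unitGroup (x / z ^ ℓ) = 1 := by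
        rw [map_div, h1, div_self']
      exact h2)
  refine ⟨f.comp (MonoidHom.toAdditive (QuotientGroup.mk' A.unitGroup)), ?_, hf⟩
  intro u hu
  have h1 : QuotientGroup.mk' A.unitGroup u = 1 := (QuotientGroup.eq_one_iff _).mpr hu
  change f (Additive.ofMul (QuotientGroup.mk' A.unitGroup u)) = 0
  rw [h1]
  exact map_zero f

/-- If `Γ_v` has no divisible convex subgroups, then the characters commuting with all characters
of `Γ_v` are trivial on the principal units. -/
theorem mem_dec_of_comm_inr [Fact ℓ.Prime] [TopologicalSpace R] [Coeff ℓ R]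
    {A : ValuationSubring K} (hA : NoDivisibleConvex ℓ A) {g : Ch R K} (hg : g ∈ full K R)
    (hc : ∀ f ∈ inr R A, Comm f g) : g ∈ dec R A := by
  -- Some `f ∈ inr` has `f x ≠ 0` and `f (1 + x) = 0`; commutation at `-x + (1 + x) = 1` then forces
  -- `g (1 + x) = 0`.
  have h1 : ∀ x y : Kˣ, (y : K) = 1 + x → A.valuation (x : K) < 1 → x ∉ U ℓ A → ev g y = 0 := by
    intro x y hxy hx hU
    obtain ⟨f, hf, hfx⟩ := exists_inr_ne_zero (R := R) hU
    have hy : ev f y = 0 := by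
      refine (inr_subset_dec A hf).2 y ?_
      rw [A.mem_principalUnitGroup_iff, hxy, add_sub_cancel_left]
      exact hx
    have := hc f hf (-x) y (by rw [hxy, Units.val_neg]; ring)
    rw [hy, ev_neg (inr_subset_dec A hf).1, zero_mul] at this
    exact (mul_eq_zero.mp this).resolve_left hfx
  -- For `x ∈ U` choose `z ∉ U` with value strictly between `v x` and `1`. Then `1 + x = (1 + z)(1 +
  -- b)` with `v b = v z`, and `h1` covers both factors.
  have h2 : ∀ x y : Kˣ, (y : K) = 1 + x → A.valuation (x : K) < 1 → ev g y = 0 := by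
    intro x y hxy hx
    by_cases hU : x ∈ U ℓ A
    · obtain ⟨z, hz1, hz2, hz⟩ :=
        (noDivisibleConvex_iff (Fact.out : ℓ.Prime).ne_zero).mp hA x hx
      have hz1' : A.valuation (z : K) < 1 :=
        lt_of_le_of_ne hz1 fun h => hz (unitGroup_le_U A h)
      have hz2' : A.valuation (x : K) < A.valuation (z : K) := by
        refine lt_of_le_of_ne hz2 fun h => hz ?_
        rw [mem_U_iff'] at hU ⊢
        rwa [← h]
      have hv1 : A.valuation (1 + (z : K)) = 1 := A.valuation.map_one_add_of_lt hz1'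
      have hne : 1 + (z : K) ≠ 0 := by
        intro h0
        rw [h0, map_zero] at hv1
        exact zero_ne_one hv1
      have hvs : A.valuation ((x : K) - z) = A.valuation (z : K) :=
        A.valuation.map_sub_eq_of_lt_right hz2'
      have hne' : (x : K) - z ≠ 0 := by
        intro h0
        rw [h0, map_zero] at hvs
        exact (Valuation.ne_zero_iff _).mpr z.ne_zero hvs.symm
      let s : Kˣ := Units.mk0 _ hne
      let b : Kˣ := Units.mk0 _ hne' / s
      have hs : (s : K) = 1 + z := rfl
      have hb : (b : K) = ((x : K) - z) / (1 + z) := Units.val_div_eq_div_val _ _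
      have hvb : A.valuation (b : K) = A.valuation (z : K) := by
        rw [hb, map_div₀, hv1, hvs, div_one]
      have hys : ((y / s : Kˣ) : K) = 1 + b := by
        rw [hb, Units.val_div_eq_div_val, hs, hxy]
        field_simp
        ring
      have e1 := h1 z s hs hz1' hz
      have e2 := h1 b (y / s) hys (by rw [hvb]; exact hz1') (by
        rw [mem_U_iff', hvb, ← mem_U_iff']; exact hz)
      rw [ev_div, e1, sub_zero] at e2
      exact e2
    · exact h1 x y hxy hx hU
  refine ⟨hg, fun y hy => ?_⟩
  by_cases h0 : (y : K) - 1 = 0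
  · have : y = 1 := Units.ext (sub_eq_zero.mp h0)
    rw [this, ev_one]
  · rw [A.mem_principalUnitGroup_iff] at hy
    exact h2 (Units.mk0 _ h0) y (by simp) hy

/-- If `Γ_v` has no divisible convex subgroups, then its characters determine `v` up to
refinement. -/
theorem le_of_inr_subset [Fact ℓ.Prime] [TopologicalSpace R] [Coeff ℓ R]
    {A B : ValuationSubring K} (hA : NoDivisibleConvex ℓ A) (h : inr R A ⊆ inr R B) : B ≤ A := by
  intro y hyB
  by_contra hyA
  have hy0 : y ≠ 0 := by
    rintro rfl
    exact hyA A.zero_mem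
  let x : Kˣ := (Units.mk0 y hy0)⁻¹
  have hx : (x : K) = y⁻¹ := by simp [x]
  have hxA : A.valuation (x : K) < 1 := by
    rw [hx, map_inv₀]
    refine inv_lt_one_of_one_lt₀ ?_
    rw [← not_le, A.valuation_le_one_iff]
    exact hyA
  have hxB : 1 ≤ B.valuation (x : K) := by
    rw [hx, map_inv₀]
    refine (one_le_inv₀ ?_).mpr ((B.valuation_le_one_iff y).mpr hyB)
    exact zero_lt_iff.mpr ((Valuation.ne_zero_iff _).mpr hy0)
  -- When both inequalities are strict, `1 + z` is a unit of `A` and `z / (1 + z)` is a unit of `B`;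
  -- a character of both value groups kills the two, hence `z`.
  have h1 : ∀ z : Kˣ, A.valuation (z : K) ≤ 1 → 1 ≤ B.valuation (z : K) →
      ∀ f ∈ inr R A, ev f z = 0 := by
    intro z hzA hzB f hf
    rcases hzA.lt_or_eq with hzA | hzA
    · rcases hzB.lt_or_eq with hzB | hzB
      · have hv1 : A.valuation (1 + (z : K)) = 1 := A.valuation.map_one_add_of_lt hzA
        have hne : 1 + (z : K) ≠ 0 := by
          intro h0
          rw [h0, map_zero] at hv1
          exact zero_ne_one hv1
        have hw1 : B.valuation (1 + (z : K)) = B.valuation (z : K) :=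
          by
          refine B.valuation.map_add_eq_of_lt_right ?_
          rw [map_one]
          exact hzB
        have e1 := hf (Units.mk0 _ hne) hv1
        have e2 := h hf (z / Units.mk0 _ hne) (by
          rw [B.mem_unitGroup_iff, Units.val_div_eq_div_val, map_div₀, Units.val_mk0, hw1,
            div_self]
          exact (Valuation.ne_zero_iff _).mpr z.ne_zero)
        rw [ev_div, e1, sub_zero] at e2
        exact e2
      · exact h hf z hzB.symm
    · exact hf z hzA
  -- Either `z` or `x / z` falls under `h1`, and so does `x`. Hence no character of the value group
  -- of `A` sees the interval from `v x` to `1`, against the absence of divisible convex subgroups.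
  have h2 : ∀ z : Kˣ, A.valuation (z : K) ≤ 1 → A.valuation (x : K) ≤ A.valuation (z : K) →
      ∀ f ∈ inr R A, ev f z = 0 := by
    intro z hzA hxz f hf
    by_cases hzB : 1 ≤ B.valuation (z : K)
    · exact h1 z hzA hzB f hf
    · have e := h1 (x / z) (by
        rw [Units.val_div_eq_div_val, map_div₀]
        exact div_le_one_of_le₀ hxz zero_le) (by
        rw [Units.val_div_eq_div_val, map_div₀]
        refine (one_le_div₀ (zero_lt_iff.mpr ((Valuation.ne_zero_iff _).mpr z.ne_zero))).mpr ?_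
        exact (not_le.mp hzB).le.trans hxB) f hf
      rw [ev_div, h1 x hxA.le hxB f hf, zero_sub, neg_eq_zero] at e
      exact e
  obtain ⟨z, hz1, hz2, hz⟩ := (noDivisibleConvex_iff (Fact.out : ℓ.Prime).ne_zero).mp hA x hxA
  obtain ⟨f, hf, hfz⟩ := exists_inr_ne_zero (R := R) hz
  exact hfz (h2 z hz1 hz2 f hf)

/-- The coarsening by the largest divisible convex subgroup. -/
theorem exists_coarsening [Fact ℓ.Prime] [TopologicalSpace R] [Coeff ℓ R]
    (A : ValuationSubring K) :
    ∃ B : ValuationSubring K, A ≤ B ∧ NoDivisibleConvex ℓ B ∧ inr R A ⊆ inr R B := by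
  have hℓ : ℓ ≠ 0 := (Fact.out : ℓ.Prime).ne_zero
  -- `P d` says that all values between `v d` and `1` are ℓ-divisible. Such `d` are closed under
  -- products, and allowing them as denominators yields the coarser ring.
  let P : Kˣ → Prop := fun d => A.valuation (d : K) ≤ 1 ∧
    ∀ z : Kˣ, A.valuation (z : K) ≤ 1 → A.valuation (d : K) ≤ A.valuation (z : K) → z ∈ U ℓ A
  have hpos : ∀ z : Kˣ, 0 < A.valuation (z : K) := fun z =>
    zero_lt_iff.mpr ((Valuation.ne_zero_iff _).mpr z.ne_zero)
  have P1 : P 1 := by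
    refine ⟨by simp, fun z h1 h2 => unitGroup_le_U A ?_⟩
    rw [Units.val_one, map_one] at h2
    exact le_antisymm h1 h2
  have Pmul : ∀ d e, P d → P e → P (d * e) := by
    rintro d e ⟨hd1, hd⟩ ⟨he1, he⟩
    refine ⟨by rw [Units.val_mul, map_mul]; exact mul_le_one' hd1 he1, fun z h1 h2 => ?_⟩
    by_cases h3 : A.valuation (d : K) ≤ A.valuation (z : K)
    · exact hd z h1 h3
    · have e1 : z / d ∈ U ℓ A := by
        apply he
        · rw [Units.val_div_eq_div_val, map_div₀]
          exact div_le_one_of_le₀ (not_le.mp h3).le zero_le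
        · rw [Units.val_div_eq_div_val, map_div₀, le_div_iff₀ (hpos d), mul_comm, ← map_mul]
          exact h2
      rw [← div_mul_cancel z d]
      exact mul_mem e1 (hd d hd1 le_rfl)
  have Pdvd : ∀ d e : Kˣ, P d → A.valuation (e : K) ≤ 1 →
      A.valuation (d : K) ≤ A.valuation (e : K) → P e :=
    fun d e hd h1 h2 => ⟨h1, fun z h3 h4 => hd.2 z h3 (h2.trans h4)⟩
  let S : Subring K :=
    { carrier := {x | ∃ d : Kˣ, P d ∧ A.valuation (d * x) ≤ 1}
      mul_mem' := by
        rintro x y ⟨d, hd, hx⟩ ⟨e, he, hy⟩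
        refine ⟨d * e, Pmul d e hd he, ?_⟩
        rw [Units.val_mul, show (d : K) * e * (x * y) = d * x * (e * y) by ring, map_mul]
        exact mul_le_one' hx hy
      one_mem' := ⟨1, P1, by simp⟩
      add_mem' := by
        rintro x y ⟨d, hd, hx⟩ ⟨e, he, hy⟩
        refine ⟨d * e, Pmul d e hd he, ?_⟩
        rw [Units.val_mul, show (d : K) * e * (x + y) = e * (d * x) + d * (e * y) by ring]
        refine (A.valuation.map_add _ _).trans (max_le ?_ ?_)
        · rw [map_mul]; exact mul_le_one' he.1 hx
        · rw [map_mul]; exact mul_le_one' hd.1 hy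
      zero_mem' := ⟨1, P1, by simp⟩
      neg_mem' := by
        rintro x ⟨d, hd, hx⟩
        exact ⟨d, hd, by rwa [mul_neg, Valuation.map_neg]⟩ }
  have hAS : A.toSubring ≤ S := fun x hx =>
    ⟨1, P1, by rw [Units.val_one, one_mul]; exact (A.valuation_le_one_iff x).mpr hx⟩
  let B := A.ofLE S hAS
  have hB : ∀ x, x ∈ B ↔ ∃ d : Kˣ, P d ∧ A.valuation (d * x) ≤ 1 := fun x => Iff.rfl
  have hBU : B.unitGroup ≤ U ℓ A := by
    intro u hu
    have hu1 : B.valuation (u : K) = 1 := hu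
    have h1 : (u : K) ∈ B := by rw [← B.valuation_le_one_iff, hu1]
    have h2 : (u : K)⁻¹ ∈ B := by rw [← B.valuation_le_one_iff, map_inv₀, hu1, inv_one]
    obtain ⟨d, hd, h1⟩ := (hB _).mp h1
    obtain ⟨e, he, h2⟩ := (hB _).mp h2
    have h3 : d * u ∈ U ℓ A := by
      refine (Pmul d e hd he).2 _ (by rwa [Units.val_mul]) ?_
      have : ((d * e : Kˣ) : K) = (d * u : Kˣ) * (e * (u : K)⁻¹) := by
        rw [Units.val_mul, Units.val_mul]
        have := u.ne_zero
        field_simp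
      rw [this, map_mul]
      exact mul_le_of_le_one_right' h2
    have h4 : d ∈ U ℓ A := hd.2 d hd.1 le_rfl
    exact (Subgroup.mul_mem_cancel_left _ h4).mp h3
  have hUU : U ℓ B ≤ U ℓ A := sup_le hBU le_sup_right
  refine ⟨B, fun x hx => hAS hx, ?_, ?_⟩
  · rw [noDivisibleConvex_iff hℓ]
    intro x hx
    have hxi : (x : K)⁻¹ ∉ B := by
      rw [← B.valuation_le_one_iff, map_inv₀, not_le]
      exact (one_lt_inv₀ (zero_lt_iff.mpr ((Valuation.ne_zero_iff _).mpr x.ne_zero))).mpr hx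
    have hxA : A.valuation (x : K) ≤ 1 := by
      rw [A.valuation_le_one_iff]
      exact (A.mem_or_inv_mem x).resolve_right fun h => hxi (hAS h)
    have hP : ¬ P x := by
      intro hP
      exact hxi ((hB _).mpr ⟨x, hP, by rw [mul_inv_cancel₀ x.ne_zero, map_one]⟩)
    have : ∃ z : Kˣ, A.valuation (z : K) ≤ 1 ∧ A.valuation (x : K) ≤ A.valuation (z : K) ∧
        z ∉ U ℓ A := by
      by_contra! hn
      exact hP ⟨hxA, hn⟩
    obtain ⟨z, h1, h2, h3⟩ := this
    have hle : A ≤ B := fun x hx => hAS hx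
    refine ⟨z, ?_, ?_, fun h => h3 (hUU h)⟩
    · rw [B.valuation_le_one_iff]
      exact hle ((A.valuation_le_one_iff _).mp h1)
    · rw [← A.mapOfLE_valuation_apply B hle, ← A.mapOfLE_valuation_apply B hle]
      exact A.monotone_mapOfLE B hle h2
  · intro f hf u hu
    have hle : A ≤ B := fun x hx => hAS hx
    -- A unit `u` of `B` is a unit of `A` times `y ^ ℓ` with `y` again a unit of `B`, so `f u = ℓ *
    -- f y`. Iterating, `f u` is divisible by all powers of `ℓ`.
    refine Coeff.separated (ℓ := ℓ) _ fun n => ?_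
    induction n generalizing u with
    | zero => exact ⟨ev f u, by rw [pow_zero, one_mul]⟩
    | succ n ih =>
      obtain ⟨y, hy⟩ := mem_U_iff.mp (hBU hu)
      have hyB : y ∈ B.unitGroup := by
        refine unitGroup_root hℓ ?_
        have h1 := ValuationSubring.unitGroup_le_unitGroup.mpr hle hy
        have h2 := B.unitGroup.div_mem hu h1
        rwa [div_div_cancel] at h2
      obtain ⟨s, hs⟩ := ih y hyB
      have e := hf _ hy
      rw [ev_div, ev_pow, hs] at e
      exact ⟨s, by rw [pow_succ]; linear_combination e⟩

end ValueGroups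

/-! ### The correspondence in terms of characters -/

section Correspondence

universe u w

variable {K : Type u} [Field K] {R : Type w} [CommRing R]

/-- Characters are composed with the embedding of `R` into its fraction field, where the linear
algebra of the core argument applies; their value at `0 : K` is a default. -/
theorem exists_valuation_of_ctr [IsDomain R] {D : Set (Ch R K)} (hD : D ⊆ full K R)
    (hne : D ≠ ctr D) : ∃ A : ValuationSubring K, ctr D ⊆ inr R A ∧ D ⊆ dec R A := by
  classical
  let F := FractionRing R
  let ι := algebraMap R F
  have hι : Function.Injective ι := IsFractionRing.injective R F
  let L : Ch R K → K → F := fun f x => if hx : x ≠ 0 then ι (ev f (Units.mk0 x hx)) else 0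
  have hL : ∀ f (x : K) (hx : x ≠ 0), L f x = ι (ev f (Units.mk0 x hx)) := fun f x hx => dif_pos hx
  have hLu : ∀ f (x : Kˣ), L f (x : K) = ι (ev f x) := by
    intro f x
    rw [hL f x x.ne_zero, Units.mk0_val]
  obtain ⟨f, hf, g, hg, hfg⟩ : ∃ f ∈ D, ∃ g ∈ D, ¬ Comm f g := by
    by_contra! hn
    exact hne (Set.Subset.antisymm (fun f hf => ⟨hf, hn f hf⟩) fun f hf => hf.1)
  obtain ⟨b, c, hbc, hn⟩ : ∃ b c : Kˣ, (b : K) + c = 1 ∧ ev f b * ev g c ≠ ev f c * ev g b := by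
    unfold Comm at hfg
    push Not at hfg
    exact hfg
  have data : CommData (L '' D) (L '' ctr D) (b : K) c :=
    { log := by
        rintro _ ⟨f, hf, rfl⟩
        refine ⟨fun x y hx hy => ?_, ?_⟩
        · rw [hL f x hx, hL f y hy, hL f _ (mul_ne_zero hx hy), ← map_add, ← ev_mul]
          congr 2
          exact Units.ext rfl
        · have := hLu f (-1)
          rw [show ev f (-1) = 0 from hD hf, map_zero] at this
          simpa using this
      sub := Set.image_mono fun f hf => hf.1
      comm := by
        rintro _ ⟨f, hf, rfl⟩ _ ⟨g, hg, rfl⟩ x y hx hy hxy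
        rw [hL f x hx, hL f y hy, hL g x hx, hL g y hy, ← map_mul, ← map_mul]
        exact congrArg ι (hf.2 g hg _ _ hxy)
      add_eq := hbc
      left_ne := b.ne_zero
      right_ne := c.ne_zero
      indep := by
        refine ⟨L f, ⟨f, hf, rfl⟩, L g, ⟨g, hg, rfl⟩, ?_⟩
        rw [hLu, hLu, hLu, hLu, ← map_mul, ← map_mul]
        exact fun h => hn (hι h) }
  obtain ⟨A, h1, h2⟩ := data.exists_valuationSubring
  refine ⟨A, fun f hf x hx => ?_, fun f hf => ⟨hD hf, fun x hx => ?_⟩⟩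
  · have := h1 _ ⟨f, hf, rfl⟩ x hx
    rw [hLu] at this
    exact hι (this.trans (map_zero ι).symm)
  · have := h2 _ ⟨f, hf, rfl⟩ x hx
    rw [hLu] at this
    exact hι (this.trans (map_zero ι).symm)

variable (ℓ : ℕ) [Fact ℓ.Prime] (R)

/-- The class of valuations `v` such that `Γ_v` has no divisible convex subgroup and the family
of all characters of `k(v)` is non-trivial with trivial centre. -/
def VCh (K : Type u) [Field K] : Set (ValuationSubring K) :=
  {A | NoDivisibleConvex ℓ A ∧ ctr (dec R A) = inr R A ∧ dec R A ≠ inr R A}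

variable {R}

/-- The non-commutative families in `𝒞` that are maximal for the given centre. -/
def TCh (𝒞 : Set (Set (Ch R K))) : Set (Set (Ch R K)) :=
  {D | D ∈ 𝒞 ∧ (∀ D' ∈ 𝒞, D ⊆ D' → D' ≠ D → ¬ ctr D ⊆ ctr D') ∧ D ≠ ctr D}

variable {ℓ} [TopologicalSpace R] [Coeff ℓ R]

theorem eq_of_inr_eq {A B : ValuationSubring K} (hA : NoDivisibleConvex ℓ A)
    (hB : NoDivisibleConvex ℓ B) (h : inr R A = inr R B) : A = B :=
  le_antisymm (le_of_inr_subset (R := R) hB h.ge) (le_of_inr_subset (R := R) hA h.le)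

/-- Only two properties of the class `𝒞` of admissible families matter: its members kill `-1`, and
it contains all `dec A`. This lets the same argument serve both dualities. -/
theorem bijOn_dec {𝒞 : Set (Set (Ch R K))} (h𝒞 : ∀ D ∈ 𝒞, D ⊆ full K R)
    (hdec : ∀ A : ValuationSubring K, dec R A ∈ 𝒞) :
    Set.BijOn (dec R) (VCh R ℓ K) (TCh 𝒞) := by
  refine ⟨?_, ?_, ?_⟩
  · rintro A ⟨hA, hc, hne⟩
    refine ⟨hdec A, fun D' hD' hsub hne' hctr => hne' ?_, by rwa [hc]⟩
    -- A larger family whose centre contains `inr A` commutes with `inr A`, hence lies in `dec A`.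
    refine Set.Subset.antisymm (fun g hg => ?_) hsub
    refine mem_dec_of_comm_inr hA (h𝒞 D' hD' hg) fun f hf => ?_
    rw [hc] at hctr
    exact (hctr hf).2 g hg
  · rintro A ⟨hA, hcA, -⟩ B ⟨hB, hcB, -⟩ hAB
    have hAB' : dec R A = dec R B := hAB
    exact eq_of_inr_eq (R := R) hA hB (by rw [← hcA, ← hcB, hAB'])
  · rintro D ⟨hD, hmax, hne⟩
    have : IsDomain R := Coeff.toIsDomain ℓ
    -- Coarsening preserves both inclusions, and the centre of `dec A` always contains `inr A`; so
    -- maximality of `D` forces `D = dec A`.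
    obtain ⟨A₀, h1, h2⟩ := exists_valuation_of_ctr (h𝒞 D hD) hne
    obtain ⟨A, hle, hA, hinr⟩ := exists_coarsening (R := R) (ℓ := ℓ) A₀
    have h1' : ctr D ⊆ inr R A := h1.trans hinr
    have h2' : D ⊆ dec R A := h2.trans (dec_mono hle)
    have hDA : D = dec R A := by
      by_contra hn
      exact hmax _ (hdec A) h2' (fun h => hn h.symm) (h1'.trans inr_subset_ctr_dec)
    have hc : ctr (dec R A) = inr R A :=
      Set.Subset.antisymm (by rwa [← hDA]) inr_subset_ctr_dec
    refine ⟨A, ⟨hA, hc, ?_⟩, hDA.symm⟩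
    rw [← hc, ← hDA]
    exact hne

/-- Being finer than `A` is detected on centres, by `le_of_inr_subset`. -/
theorem bijOn_dec_rel {𝒞 : Set (Set (Ch R K))} (h𝒞 : ∀ D ∈ 𝒞, D ⊆ full K R)
    (hdec : ∀ A : ValuationSubring K, dec R A ∈ 𝒞) {A : ValuationSubring K}
    (hA : NoDivisibleConvex ℓ A) :
    Set.BijOn (dec R) {B | B ∈ VCh R ℓ K ∧ B ≤ A}
      {D | D ∈ TCh 𝒞 ∧ D ⊆ dec R A ∧ inr R A ⊆ ctr D} := by
  have hb := bijOn_dec (ℓ := ℓ) h𝒞 hdec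
  refine ⟨?_, hb.injOn.mono fun B hB => hB.1, ?_⟩
  · rintro B ⟨hB, hBA⟩
    refine ⟨hb.mapsTo hB, dec_mono hBA, ?_⟩
    rw [hB.2.1]
    exact inr_anti hBA
  · rintro D ⟨hD, -, hD2⟩
    obtain ⟨B, hB, rfl⟩ := hb.surjOn hD
    rw [hB.2.1] at hD2
    exact ⟨B, ⟨hB, le_of_inr_subset hA hD2⟩, rfl⟩

/-! ### Composition of valuations -/

section Composition

variable {A : ValuationSubring K}

theorem mem_compVal {B : ValuationSubring (IsLocalRing.ResidueField A)} {x : K} :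
    x ∈ compVal A B ↔ ∃ h : x ∈ A, IsLocalRing.residue A ⟨x, h⟩ ∈ B := by
  constructor
  · rintro ⟨a, ha, rfl⟩
    exact ⟨a.2, ha⟩
  · rintro ⟨h, hx⟩
    exact ⟨⟨x, h⟩, hx, rfl⟩

theorem compVal_le (B : ValuationSubring (IsLocalRing.ResidueField A)) : compVal A B ≤ A :=
  fun _ hx => (mem_compVal.mp hx).1

theorem compVal_injective : Function.Injective (compVal A) := by
  intro B C h
  ext x
  obtain ⟨a, rfl⟩ := IsLocalRing.residue_surjective x
  have : ∀ B, IsLocalRing.residue A a ∈ B ↔ (a : K) ∈ compVal A B := by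
    intro B
    rw [mem_compVal]
    exact ⟨fun h => ⟨a.2, h⟩, fun h => h.2⟩
  rw [this, this, h]

/-- As `C` contains the maximal ideal of `A`, it is the full preimage of its image in the residue
field. -/
theorem exists_compVal_eq {C : ValuationSubring K} (hC : C ≤ A) :
    ∃ B, compVal A B = C := by
  have hm : ∀ a : A, IsLocalRing.residue A a = 0 → (a : K) ∈ C := by
    intro a ha
    rw [IsLocalRing.residue_eq_zero_iff, ← A.coe_mem_nonunits_iff] at ha
    exact C.nonunits_subset (ValuationSubring.nonunits_le_nonunits.mpr hC ha)
  let S : Subring A := C.toSubring.comap A.subtype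
  let B : ValuationSubring (IsLocalRing.ResidueField A) :=
    { S.map (IsLocalRing.residue A) with
      mem_or_inv_mem' := by
        intro x
        change x ∈ S.map (IsLocalRing.residue A) ∨ x⁻¹ ∈ S.map (IsLocalRing.residue A)
        obtain ⟨a, rfl⟩ := IsLocalRing.residue_surjective x
        by_cases h0 : IsLocalRing.residue A a = 0
        · left
          rw [h0]
          exact Subring.zero_mem _
        · have hu : IsUnit a := by
            rwa [← IsLocalRing.residue_ne_zero_iff_isUnit]
          obtain ⟨u, rfl⟩ := hu
          rcases C.mem_or_inv_mem ((u : A) : K) with h1 | h1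
          · exact Or.inl ⟨u, h1, rfl⟩
          · right
            refine ⟨(u⁻¹ : Aˣ), ?_, ?_⟩
            · change (((u⁻¹ : Aˣ) : A) : K) ∈ C
              convert h1
              refine eq_inv_of_mul_eq_one_left ?_
              exact congrArg Subtype.val (u.inv_mul)
            · refine eq_inv_of_mul_eq_one_left ?_
              rw [← map_mul, u.inv_mul, map_one] }
  refine ⟨B, ?_⟩
  ext x
  rw [mem_compVal]
  constructor
  · rintro ⟨h, a, ha, hax⟩
    have h1 : (((⟨x, h⟩ : A) - a : A) : K) ∈ C := by
      apply hm
      rw [map_sub, ← hax, sub_self]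
    have h2 : (x - a) + a ∈ C := C.add_mem _ _ h1 ha
    rwa [sub_add_cancel] at h2
  · intro hx
    exact ⟨hC hx, ⟨x, hC hx⟩, hx, rfl⟩

variable {B : ValuationSubring (IsLocalRing.ResidueField A)}

theorem valuation_compVal_le_iff {u u' : A.unitGroup} :
    (compVal A B).valuation ((u : Kˣ) : K) ≤ (compVal A B).valuation ((u' : Kˣ) : K) ↔
      B.valuation (rs A u : IsLocalRing.ResidueField A) ≤
        B.valuation (rs A u' : IsLocalRing.ResidueField A) := by
  have key : ∀ w : A.unitGroup, (compVal A B).valuation ((w : Kˣ) : K) ≤ 1 ↔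
      B.valuation (rs A w : IsLocalRing.ResidueField A) ≤ 1 := by
    intro w
    rw [ValuationSubring.valuation_le_one_iff, ValuationSubring.valuation_le_one_iff, mem_compVal,
      A.coe_unitGroupToResidueFieldUnits_apply]
    exact ⟨fun h => h.2, fun h => ⟨_, h⟩⟩
  have h := key (u / u')
  rw [Subgroup.coe_div, map_div, Units.val_div_eq_div_val, Units.val_div_eq_div_val, map_div₀,
    map_div₀, div_le_one₀, div_le_one₀] at h
  · exact h
  · exact zero_lt_iff.mpr ((Valuation.ne_zero_iff _).mpr (Units.ne_zero _))
  · exact zero_lt_iff.mpr ((Valuation.ne_zero_iff _).mpr (Units.ne_zero _))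

theorem valuation_compVal_lt_one_iff {u : A.unitGroup} :
    (compVal A B).valuation ((u : Kˣ) : K) < 1 ↔
      B.valuation (rs A u : IsLocalRing.ResidueField A) < 1 := by
  have := (valuation_compVal_le_iff (B := B) (u := 1) (u' := u)).not
  simpa using this

theorem mem_unitGroup_compVal {u : A.unitGroup} :
    (u : Kˣ) ∈ (compVal A B).unitGroup ↔ rs A u ∈ B.unitGroup := by
  rw [ValuationSubring.mem_unitGroup_iff, ValuationSubring.mem_unitGroup_iff]
  have h1 := valuation_compVal_le_iff (B := B) (u := u) (u' := 1)
  have h2 := valuation_compVal_le_iff (B := B) (u := 1) (u' := u)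
  simp only [Subgroup.coe_one, Units.val_one, map_one] at h1 h2
  rw [le_antisymm_iff, le_antisymm_iff, h1, h2]

theorem valuation_compVal_lt_one {x : K} (hx : A.valuation x < 1) :
    (compVal A B).valuation x < 1 := by
  have := ValuationSubring.nonunits_le_nonunits.mpr (compVal_le B)
  exact this hx

theorem mem_principalUnitGroup_compVal {u : A.unitGroup} :
    (u : Kˣ) ∈ (compVal A B).principalUnitGroup ↔ rs A u ∈ B.principalUnitGroup := by
  have key : ∀ a : A, (compVal A B).valuation (a : K) < 1 ↔
      B.valuation (IsLocalRing.residue A a) < 1 := by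
    intro a
    by_cases ha : A.valuation (a : K) = 1
    · have h0 : (a : K) ≠ 0 := by
        intro h0
        rw [h0, map_zero] at ha
        exact zero_ne_one ha
      exact valuation_compVal_lt_one_iff (u := ⟨Units.mk0 _ h0, ha⟩)
    · have ha' : A.valuation (a : K) < 1 := lt_of_le_of_ne (A.valuation_le_one a) ha
      have h0 : IsLocalRing.residue A a = 0 := by
        rwa [IsLocalRing.residue_eq_zero_iff, A.valuation_lt_one_iff]
      rw [h0, map_zero]
      exact ⟨fun _ => zero_lt_one, fun _ => valuation_compVal_lt_one ha'⟩
  rw [ValuationSubring.mem_principalUnitGroup_iff, ValuationSubring.mem_principalUnitGroup_iff,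
    A.coe_unitGroupToResidueFieldUnits_apply]
  have := key ((A.unitGroupMulEquiv u : A) - 1)
  rw [map_sub, map_one] at this
  exact this

theorem principalUnitGroup_compVal_le (B : ValuationSubring (IsLocalRing.ResidueField A)) :
    (compVal A B).principalUnitGroup ≤ A.unitGroup := fun _ hx =>
  ValuationSubring.unitGroup_le_unitGroup.mpr (compVal_le B)
    ((compVal A B).principal_units_le_units hx)

theorem unitGroup_compVal_le (B : ValuationSubring (IsLocalRing.ResidueField A)) :
    (compVal A B).unitGroup ≤ A.unitGroup :=
  ValuationSubring.unitGroup_le_unitGroup.mpr (compVal_le B)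

omit [TopologicalSpace R] in
theorem Lifts.mem_full {f : Ch R K} {h : Ch R (IsLocalRing.ResidueField A)} (hl : Lifts A f h)
    (hf : f ∈ full K R) : h ∈ full (IsLocalRing.ResidueField A) R := by
  have := hl ⟨-1, neg_one_mem_unitGroup A⟩
  rw [rs_neg_one] at this
  exact this.symm.trans hf

omit [TopologicalSpace R] in
theorem Lifts.mem_dec_compVal_iff {f : Ch R K} {h : Ch R (IsLocalRing.ResidueField A)}
    (hl : Lifts A f h) (hf : f ∈ full K R) : f ∈ dec R (compVal A B) ↔ h ∈ dec R B := by
  constructor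
  · rintro ⟨-, h2⟩
    refine ⟨hl.mem_full hf, fun x hx => ?_⟩
    obtain ⟨u, rfl⟩ := rs_surjective A x
    rw [← hl]
    exact h2 _ (mem_principalUnitGroup_compVal.mpr hx)
  · rintro ⟨-, h2⟩
    refine ⟨hf, fun x hx => ?_⟩
    have hxA := principalUnitGroup_compVal_le B hx
    rw [show ev f x = _ from hl ⟨x, hxA⟩]
    exact h2 _ (mem_principalUnitGroup_compVal.mp hx)

omit [TopologicalSpace R] in
theorem Lifts.mem_inr_compVal_iff {f : Ch R K} {h : Ch R (IsLocalRing.ResidueField A)}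
    (hl : Lifts A f h) : f ∈ inr R (compVal A B) ↔ h ∈ inr R B := by
  constructor
  · intro h2 x hx
    obtain ⟨u, rfl⟩ := rs_surjective A x
    rw [← hl]
    exact h2 _ (mem_unitGroup_compVal.mpr hx)
  · intro h2 x hx
    have hxA := unitGroup_compVal_le B hx
    rw [show ev f x = _ from hl ⟨x, hxA⟩]
    exact h2 _ (mem_unitGroup_compVal.mp hx)

variable [IsTopologicalRing R] [CompactSpace R] [T2Space R]

omit [Fact ℓ.Prime] [Coeff ℓ R] in
theorem ctr_dec_compVal_iff :
    ctr (dec R (compVal A B)) = inr R (compVal A B) ↔ ctr (dec R B) = inr R B := by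
  constructor
  · intro h
    refine Set.Subset.antisymm ?_ inr_subset_ctr_dec
    rintro f ⟨hf, hc⟩
    obtain ⟨f', hf', hl⟩ := exists_lift_ch (A := A) hf.1
    rw [← hl.mem_inr_compVal_iff, ← h]
    refine ⟨(hl.mem_dec_compVal_iff hf'.1).mpr hf, fun g hg => ?_⟩
    have hgA := dec_mono (compVal_le B) hg
    obtain ⟨g', hg', hl'⟩ := exists_residue_ch hgA
    exact (hl.comm_iff hf' hgA hl').mpr (hc g' ((hl'.mem_dec_compVal_iff hg.1).mp hg))
  · intro h
    refine Set.Subset.antisymm ?_ inr_subset_ctr_dec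
    rintro f ⟨hf, hc⟩
    have hfA := dec_mono (compVal_le B) hf
    obtain ⟨f', hf', hl⟩ := exists_residue_ch hfA
    rw [hl.mem_inr_compVal_iff, ← h]
    refine ⟨(hl.mem_dec_compVal_iff hf.1).mp hf, fun g hg => ?_⟩
    obtain ⟨g', hg', hl'⟩ := exists_lift_ch (A := A) hg.1
    exact (hl.comm_iff hfA hg' hl').mp (hc g' ((hl'.mem_dec_compVal_iff hg'.1).mpr hg))

omit [Fact ℓ.Prime] [Coeff ℓ R] in
theorem dec_compVal_eq_iff :
    dec R (compVal A B) = inr R (compVal A B) ↔ dec R B = inr R B := by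
  constructor
  · intro h
    refine Set.Subset.antisymm (fun f hf => ?_) (inr_subset_dec B)
    obtain ⟨f', hf', hl⟩ := exists_lift_ch (A := A) hf.1
    rw [← hl.mem_inr_compVal_iff, ← h, hl.mem_dec_compVal_iff hf'.1]
    exact hf
  · intro h
    refine Set.Subset.antisymm (fun f hf => ?_) (inr_subset_dec _)
    obtain ⟨f', hf', hl⟩ := exists_residue_ch (dec_mono (compVal_le B) hf)
    rw [hl.mem_inr_compVal_iff, ← h, ← hl.mem_dec_compVal_iff hf.1]
    exact hf

end Composition

end Correspondence

/-! ### Composition preserves `VCh`, and the abstract duality transfer. -/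

section CompositionBijection

universe u w

variable {K : Type u} [Field K] {R : Type w} [CommRing R] {ℓ : ℕ} {A : ValuationSubring K}
  {B : ValuationSubring (IsLocalRing.ResidueField A)}

theorem rs_mem_U_iff {u : A.unitGroup} (hℓ : ℓ ≠ 0) :
    (u : Kˣ) ∈ U ℓ (compVal A B) ↔ rs A u ∈ U ℓ B := by
  rw [mem_U_iff, mem_U_iff]
  constructor
  · rintro ⟨y, hy⟩
    have hyA : y ∈ A.unitGroup := by
      refine unitGroup_root hℓ ?_
      have := A.unitGroup.div_mem u.2 (unitGroup_compVal_le B hy)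
      rwa [div_div_cancel] at this
    refine ⟨rs A ⟨y, hyA⟩, ?_⟩
    rw [← map_pow, ← map_div, ← mem_unitGroup_compVal]
    exact hy
  · rintro ⟨y, hy⟩
    obtain ⟨w, rfl⟩ := rs_surjective A y
    rw [← map_pow, ← map_div, ← mem_unitGroup_compVal] at hy
    exact ⟨w, hy⟩

/-- The value group of `B` is a convex subgroup of that of the composite, with quotient the value
group of `A`. Non-units of `A` get their witness from `A`, units of `A` from `B`. -/
theorem noDivisibleConvex_compVal_iff (hℓ : ℓ ≠ 0) (hA : NoDivisibleConvex ℓ A) :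
    NoDivisibleConvex ℓ (compVal A B) ↔ NoDivisibleConvex ℓ B := by
  have hle : ∀ x y : K, (compVal A B).valuation x ≤ (compVal A B).valuation y →
      A.valuation x ≤ A.valuation y := by
    intro x y h
    rw [← (compVal A B).mapOfLE_valuation_apply A (compVal_le B),
      ← (compVal A B).mapOfLE_valuation_apply A (compVal_le B)]
    exact (compVal A B).monotone_mapOfLE A (compVal_le B) h
  rw [noDivisibleConvex_iff hℓ] at hA
  rw [noDivisibleConvex_iff hℓ, noDivisibleConvex_iff hℓ]
  constructor
  · intro h x hx
    obtain ⟨u, rfl⟩ := rs_surjective A x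
    obtain ⟨z, h1, h2, h3⟩ := h u (valuation_compVal_lt_one_iff.mpr hx)
    have hzA : z ∈ A.unitGroup := by
      rw [A.mem_unitGroup_iff]
      have e1 := hle z 1 (by rwa [map_one])
      have e2 := hle _ _ h2
      rw [map_one] at e1
      refine le_antisymm e1 ?_
      rwa [show A.valuation ((u : Kˣ) : K) = 1 from u.2] at e2
    lift z to A.unitGroup using hzA
    refine ⟨rs A z, ?_, valuation_compVal_le_iff.mp h2, fun h => h3 ((rs_mem_U_iff hℓ).mpr h)⟩
    have := (valuation_compVal_le_iff (B := B) (u := z) (u' := 1)).mp (by simpa using h1)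
    simpa using this
  · intro h x hx
    have hx1 : A.valuation (x : K) ≤ 1 := by
      have := hle x 1 (by rw [map_one]; exact hx.le)
      rwa [map_one] at this
    rcases hx1.lt_or_eq with hx1 | hx1
    · have hUU : U ℓ (compVal A B) ≤ U ℓ A := sup_le_sup_right (unitGroup_compVal_le B) _
      obtain ⟨z, h1, h2, h3⟩ := hA x hx1
      have hz : A.valuation (z : K) < 1 :=
        lt_of_le_of_ne h1 fun h => h3 (unitGroup_le_U A h)
      -- If `z` and `x` have the same `A`-value, `z` may lie below `x` for the composite; then `x`
      -- itself is a witness.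
      by_cases hxz : A.valuation (x : K) = A.valuation (z : K)
      · refine ⟨x, hx.le, le_rfl, fun h => h3 ?_⟩
        have := hUU h
        rw [mem_U_iff'] at this ⊢
        rwa [← hxz]
      · refine ⟨z, (valuation_compVal_lt_one hz).le, ?_, fun h => h3 (hUU h)⟩
        by_contra hn
        exact hxz (le_antisymm h2 (hle _ _ (not_le.mp hn).le))
    · let u : A.unitGroup := ⟨x, hx1⟩
      obtain ⟨z, h1, h2, h3⟩ := h (rs A u) (valuation_compVal_lt_one_iff.mp hx)
      obtain ⟨z, rfl⟩ := rs_surjective A z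
      refine ⟨z, ?_, (valuation_compVal_le_iff (u := u)).mpr h2,
        fun h => h3 ((rs_mem_U_iff hℓ).mp h)⟩
      have := (valuation_compVal_le_iff (B := B) (u := z) (u' := 1)).mpr (by simpa using h1)
      simpa using this

theorem bijOn_compVal [Fact ℓ.Prime] [TopologicalSpace R] [Coeff ℓ R]
    (hA : NoDivisibleConvex ℓ A) :
    Set.BijOn (compVal A) (VCh R ℓ (IsLocalRing.ResidueField A)) {C | C ∈ VCh R ℓ K ∧ C ≤ A} := by
  have : IsTopologicalRing R := Coeff.toIsTopologicalRing ℓ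
  have : CompactSpace R := Coeff.toCompactSpace ℓ
  have : T2Space R := Coeff.toT2Space ℓ
  have key : ∀ B, compVal A B ∈ VCh R ℓ K ↔ B ∈ VCh R ℓ (IsLocalRing.ResidueField A) := by
    intro B
    exact and_congr (noDivisibleConvex_compVal_iff (Fact.out : ℓ.Prime).ne_zero hA)
      (and_congr ctr_dec_compVal_iff dec_compVal_eq_iff.not)
  refine ⟨fun B hB => ⟨(key B).mpr hB, compVal_le B⟩, compVal_injective.injOn, ?_⟩
  rintro C ⟨hC, hCA⟩
  obtain ⟨B, rfl⟩ := exists_compVal_eq hCA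
  exact ⟨B, (key B).mp hC, rfl⟩

/-- Transfer of the correspondence along an order-reversing duality `perp`. -/
theorem bijOn_of_perp [Fact ℓ.Prime] [TopologicalSpace R] [Coeff ℓ R] {𝒮 : Type*}
    [PartialOrder 𝒮] {ok : Set 𝒮} {perp : 𝒮 → Set (Ch R K)} {H : 𝒮 → 𝒮}
    {u1 u : ValuationSubring K → 𝒮}
    (hperp : ∀ S ∈ ok, ∀ S' ∈ ok, S ≤ S' ↔ perp S' ⊆ perp S)
    (hH : ∀ S ∈ ok, H S ∈ ok ∧ perp (H S) = ctr (perp S))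
    (hfull : ∀ S ∈ ok, perp S ⊆ full K R)
    (hu1 : ∀ A, u1 A ∈ ok ∧ perp (u1 A) = dec R A)
    (hu : ∀ A, u A ∈ ok ∧ perp (u A) = inr R A) :
    Set.BijOn u1 (VCh R ℓ K)
      {S | S ∈ ok ∧ (∀ S' ∈ ok, S' ≤ S → S' ≠ S → ¬ H S' ≤ H S) ∧ S ≠ H S} ∧
    ∀ A, NoDivisibleConvex ℓ A → Set.BijOn u1 {B | B ∈ VCh R ℓ K ∧ B ≤ A}
      {S | (S ∈ ok ∧ (∀ S' ∈ ok, S' ≤ S → S' ≠ S → ¬ H S' ≤ H S) ∧ S ≠ H S) ∧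
        u1 A ≤ S ∧ S ≤ H S ∧ H S ≤ u A} := by
  have hinj : ∀ S ∈ ok, ∀ S' ∈ ok, S = S' ↔ perp S = perp S' := by
    intro S hS S' hS'
    refine ⟨fun h => by rw [h], fun h => le_antisymm ?_ ?_⟩
    · exact (hperp S hS S' hS').mpr h.ge
    · exact (hperp S' hS' S hS).mpr h.le
  have h𝒞 : ∀ D ∈ perp '' ok, D ⊆ full K R := by
    rintro _ ⟨S, hS, rfl⟩
    exact hfull S hS
  have hdec : ∀ A : ValuationSubring K, dec R A ∈ perp '' ok := fun A =>
    ⟨u1 A, (hu1 A).1, (hu1 A).2⟩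
  have hT : ∀ S ∈ ok, ((∀ S' ∈ ok, S' ≤ S → S' ≠ S → ¬ H S' ≤ H S) ∧ S ≠ H S) ↔
      perp S ∈ TCh (perp '' ok) := by
    intro S hS
    refine Iff.trans (and_congr ?_ ?_) (and_iff_right (Set.mem_image_of_mem perp hS)).symm
    · rw [Set.forall_mem_image]
      refine forall₂_congr fun S' hS' => ?_
      rw [hperp S' hS' S hS, Ne, hinj S' hS' S hS, hperp _ (hH S' hS').1 _ (hH S hS).1,
        (hH S hS).2, (hH S' hS').2]
    · rw [Ne, hinj S hS _ (hH S hS).1, (hH S hS).2]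
  have hctr : ∀ S ∈ ok, S ≤ H S := by
    intro S hS
    rw [hperp S hS _ (hH S hS).1, (hH S hS).2]
    exact fun f hf => hf.1
  have transfer : ∀ {X : Set (ValuationSubring K)} {Y : Set (Set (Ch R K))} {Z : Set 𝒮},
      Set.BijOn (dec R) X Y → (∀ S, S ∈ Z ↔ S ∈ ok ∧ perp S ∈ Y) → Set.BijOn u1 X Z := by
    intro X Y Z hb hZ
    refine ⟨fun A hA => ?_, fun A hA A' hA' h => ?_, fun S hS => ?_⟩
    · rw [hZ, (hu1 A).2]
      exact ⟨(hu1 A).1, hb.mapsTo hA⟩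
    · refine hb.injOn hA hA' ?_
      rw [← (hu1 A).2, ← (hu1 A').2, h]
    · obtain ⟨hS, hY⟩ := (hZ S).mp hS
      obtain ⟨A, hA, hAS⟩ := hb.surjOn hY
      exact ⟨A, hA, (hinj _ (hu1 A).1 _ hS).mpr ((hu1 A).2.trans hAS)⟩
  refine ⟨transfer (bijOn_dec (ℓ := ℓ) h𝒞 hdec) fun S => and_congr_right fun hS => hT S hS,
    fun A hA => transfer (bijOn_dec_rel (ℓ := ℓ) h𝒞 hdec hA) fun S => ?_⟩
  constructor
  · rintro ⟨⟨hS, hS'⟩, h1, -, h2⟩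
    refine ⟨hS, (hT S hS).mp hS', ?_, ?_⟩
    · rwa [← (hu1 A).2, ← hperp _ (hu1 A).1 S hS]
    · rwa [← (hu A).2, ← (hH S hS).2, ← hperp _ (hH S hS).1 _ (hu A).1]
  · rintro ⟨hS, hS', h1, h2⟩
    refine ⟨⟨hS, (hT S hS).mpr hS'⟩, ?_, hctr S hS, ?_⟩
    · rwa [← (hu1 A).2, ← hperp _ (hu1 A).1 S hS] at h1
    · rwa [← (hu A).2, ← (hH S hS).2, ← hperp _ (hH S hS).1 _ (hu A).1] at h2

end CompositionBijection

/-! ### The mod-`ℓ` case -/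

section ModEllDuality

universe u

variable {ℓ : ℕ} [hp : Fact ℓ.Prime] {K : Type u} [Field K]

instance coeffZMod : Coeff ℓ (ZMod ℓ) where
  not_unit := by
    rw [ZMod.natCast_self]
    exact not_isUnit_zero
  separated := by
    intro r h
    obtain ⟨s, hs⟩ := h 1
    rw [hs, ZMod.natCast_self, pow_one, zero_mul]

/-- The characters vanishing on `S`. -/
def perp (ℓ : ℕ) (S : Subgroup Kˣ) : Set (Ch (ZMod ℓ) K) := {f | ∀ x ∈ S, ev f x = 0}

/-- The kernel of a character. -/
def chKer (f : Ch (ZMod ℓ) K) : Subgroup Kˣ where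
  carrier := {x | ev f x = 0}
  one_mem' := ev_one f
  mul_mem' := by
    intro x y hx hy
    change ev f (x * y) = 0
    rw [ev_mul, show ev f x = 0 from hx, show ev f y = 0 from hy, add_zero]
  inv_mem' := by
    intro x hx
    change ev f x⁻¹ = 0
    rw [ev_inv, show ev f x = 0 from hx, neg_zero]

theorem mem_chKer {f : Ch (ZMod ℓ) K} {x : Kˣ} : x ∈ chKer f ↔ ev f x = 0 := Iff.rfl

theorem ev_pow_self (f : Ch (ZMod ℓ) K) (x : Kˣ) : ev f (x ^ ℓ) = 0 := by
  rw [ev_pow, ZMod.natCast_self, zero_mul]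

theorem powers_le_chKer (f : Ch (ZMod ℓ) K) : powers ℓ K ≤ chKer f := by
  rintro _ ⟨x, rfl⟩
  exact ev_pow_self f x

theorem mem_perp_iff {f : Ch (ZMod ℓ) K} {S : Subgroup Kˣ} : f ∈ perp ℓ S ↔ S ≤ chKer f := Iff.rfl

/-- `Kˣ/S` is an `𝔽_ℓ`-vector space, and functionals separate its points. -/
theorem exists_perp_ne_zero {S : Subgroup Kˣ} (hS : powers ℓ K ≤ S) {x : Kˣ} (hx : x ∉ S) :
    ∃ f ∈ perp ℓ S, ev f x ≠ 0 := by
  have hW : ∀ w : Additive (Kˣ ⧸ S), ℓ • w = 0 := by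
    intro w
    obtain ⟨z, hz⟩ := QuotientGroup.mk'_surjective S w.toMul
    have : QuotientGroup.mk' S (z ^ ℓ) = 1 := (QuotientGroup.eq_one_iff _).mpr (hS ⟨z, rfl⟩)
    rw [map_pow, hz] at this
    exact this
  let _ : Module (ZMod ℓ) (Additive (Kˣ ⧸ S)) :=
    AddCommGroup.zmodModule (n := ℓ) (G := Additive (Kˣ ⧸ S)) hW
  have hne : (Additive.ofMul (QuotientGroup.mk' S x) : Additive (Kˣ ⧸ S)) ≠ 0 := fun h =>
    hx ((QuotientGroup.eq_one_iff x).mp h)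
  obtain ⟨φ, hφ⟩ : ∃ φ : Module.Dual (ZMod ℓ) (Additive (Kˣ ⧸ S)), φ (Additive.ofMul (QuotientGroup.mk' S x)) ≠ 0 := by
    by_contra! hn
    exact hne ((Module.forall_dual_apply_eq_zero_iff (ZMod ℓ) _).mp hn)
  refine ⟨φ.toAddMonoidHom.comp (MonoidHom.toAdditive (QuotientGroup.mk' S)), fun y hy => ?_, hφ⟩
  have h1 : QuotientGroup.mk' S y = 1 := (QuotientGroup.eq_one_iff _).mpr hy
  change φ (Additive.ofMul (QuotientGroup.mk' S y)) = 0
  rw [h1]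
  exact map_zero φ

theorem perp_subset_iff {S S' : Subgroup Kˣ} (hS' : powers ℓ K ≤ S') :
    S ≤ S' ↔ perp ℓ S' ⊆ perp ℓ S := by
  refine ⟨fun h f hf x hx => hf x (h hx), fun h x hx => ?_⟩
  by_contra hn
  obtain ⟨f, hf, hfx⟩ := exists_perp_ne_zero hS' hn
  exact hfx (h hf x hx)

theorem isCyclic_quotient_chKer (f : Ch (ZMod ℓ) K) : IsCyclic (Kˣ ⧸ chKer f) := by
  let φ : Kˣ ⧸ chKer f →* Multiplicative (ZMod ℓ) :=
    QuotientGroup.lift (chKer f) (AddMonoidHom.toMultiplicativeRight f) fun x hx => hx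
  refine isCyclic_of_injective φ ((injective_iff_map_eq_one φ).mpr fun y hy => ?_)
  obtain ⟨x, rfl⟩ := QuotientGroup.mk'_surjective _ y
  exact (QuotientGroup.eq_one_iff x).mpr hy

/-- Together with `isCyclic_quotient_chKer` this lets the quantifiers over cyclic quotients in
`bigH` run over characters instead. -/
theorem exists_chKer_eq {H : Subgroup Kˣ} (hH : powers ℓ K ≤ H) (hc : IsCyclic (Kˣ ⧸ H)) :
    ∃ f : Ch (ZMod ℓ) K, H = chKer f := by
  obtain ⟨g, hg⟩ := hc.exists_generator
  obtain ⟨e, rfl⟩ := QuotientGroup.mk'_surjective H g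
  have hrep : ∀ x : Kˣ, ∃ n : ℤ, x / e ^ n ∈ H := by
    intro x
    obtain ⟨n, hn⟩ := Subgroup.mem_zpowers_iff.mp (hg (QuotientGroup.mk' H x))
    refine ⟨n, (QuotientGroup.eq_one_iff _).mp ?_⟩
    change QuotientGroup.mk' H (x / e ^ n) = 1
    rw [map_div, map_zpow, hn, div_self']
  by_cases he : e ∈ H
  · refine ⟨0, le_antisymm (fun x _ => ev_zero x) fun x _ => ?_⟩
    obtain ⟨n, hn⟩ := hrep x
    rw [← div_mul_cancel x (e ^ n)]
    exact H.mul_mem hn (H.zpow_mem he n)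
  · obtain ⟨f, hf, hfe⟩ := exists_perp_ne_zero hH he
    refine ⟨f, le_antisymm hf fun x hx => ?_⟩
    obtain ⟨n, hn⟩ := hrep x
    have h1 := hf _ hn
    rw [ev_div, mem_chKer.mp hx, zero_sub, neg_eq_zero, ev_zpow] at h1
    have h2 := (mul_eq_zero.mp h1).resolve_right hfe
    rw [ZMod.intCast_zmod_eq_zero_iff_dvd] at h2
    obtain ⟨m, rfl⟩ := h2
    rw [← div_mul_cancel x (e ^ ((ℓ : ℤ) * m))]
    refine H.mul_mem hn ?_
    rw [zpow_mul, zpow_natCast]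
    exact H.zpow_mem (hH ⟨e, rfl⟩) m

/-- The image of `⟨x, y⟩` is cyclic iff the vectors `(f x, g x)` and `(f y, g y)` in `𝔽_ℓ²` are
proportional, that is, iff their determinant vanishes; for `x ∈ T` it vanishes anyway. -/
theorem rigid_chKer_iff {f g : Ch (ZMod ℓ) K} : Rigid (chKer f ⊓ chKer g) ↔ Comm f g := by
  set T := chKer f ⊓ chKer g with hT
  have hmemT : ∀ x, x ∈ T ↔ ev f x = 0 ∧ ev g x = 0 := fun x => Iff.rfl
  constructor
  · intro h x y hxy
    by_cases hx : x ∈ T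
    · rw [((hmemT x).mp hx).1, ((hmemT x).mp hx).2]
      ring
    · obtain ⟨⟨w', hw'⟩, hw⟩ := (h x y hxy hx).exists_generator
      obtain ⟨w, hw1, rfl⟩ := hw'
      have hrep : ∀ z ∈ Subgroup.closure {x, y}, ∃ n : ℤ,
          ev f z = n * ev f w ∧ ev g z = n * ev g w := by
        intro z hz
        obtain ⟨n, hn⟩ := Subgroup.mem_zpowers_iff.mp
          (hw ⟨QuotientGroup.mk' T z, Subgroup.mem_map_of_mem _ hz⟩)
        have hn' : QuotientGroup.mk' T (w ^ n) = QuotientGroup.mk' T z := by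
          rw [map_zpow]
          exact congrArg Subtype.val hn
        have h1 : z / w ^ n ∈ T := by
          refine (QuotientGroup.eq_one_iff _).mp ?_
          change QuotientGroup.mk' T (z / w ^ n) = 1
          rw [map_div, hn', div_self']
        obtain ⟨h2, h3⟩ := (hmemT _).mp h1
        rw [ev_div, ev_zpow, sub_eq_zero] at h2 h3
        exact ⟨n, h2, h3⟩
      obtain ⟨n, h1, h2⟩ := hrep x (Subgroup.subset_closure (by simp))
      obtain ⟨m, h3, h4⟩ := hrep y (Subgroup.subset_closure (by simp))
      rw [h1, h2, h3, h4]
      ring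
  · intro h x y hxy hx
    have key : ∃ n : ℤ, y / x ^ n ∈ T := by
      have aux : ∀ f g : Ch (ZMod ℓ) K, Comm f g → ev f x ≠ 0 →
          ∃ n : ℤ, ev f (y / x ^ n) = 0 ∧ ev g (y / x ^ n) = 0 := by
        intro f g h hfx
        obtain ⟨n, hn⟩ := ZMod.intCast_surjective (ev f y / ev f x)
        refine ⟨n, ?_, ?_⟩
        · rw [ev_div, ev_zpow, hn, div_mul_cancel₀ _ hfx, sub_self]
        · rw [ev_div, ev_zpow, hn, sub_eq_zero, div_mul_eq_mul_div, eq_div_iff hfx]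
          linear_combination h x y hxy
      by_cases hf : ev f x = 0
      · have hg : ev g x ≠ 0 := fun hg => hx ((hmemT x).mpr ⟨hf, hg⟩)
        obtain ⟨n, h1, h2⟩ := aux g f h.symm hg
        exact ⟨n, (hmemT _).mpr ⟨h2, h1⟩⟩
      · obtain ⟨n, h1, h2⟩ := aux f g h hf
        exact ⟨n, (hmemT _).mpr ⟨h1, h2⟩⟩
    obtain ⟨n, hn⟩ := key
    have hle : (Subgroup.closure {x, y}).map (QuotientGroup.mk' T) ≤
        Subgroup.zpowers (QuotientGroup.mk' T x) := by
      rw [Subgroup.map_le_iff_le_comap, Subgroup.closure_le]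
      rintro z (rfl | rfl)
      · exact Subgroup.mem_zpowers _
      · refine Subgroup.mem_zpowers_iff.mpr ⟨n, ?_⟩
        have : QuotientGroup.mk' T (z / x ^ n) = 1 := (QuotientGroup.eq_one_iff _).mpr hn
        rw [map_div, div_eq_one, map_zpow] at this
        exact this.symm
    exact isCyclic_of_injective (Subgroup.inclusion hle) (Subgroup.inclusion_injective hle)

theorem mem_bigH_iff {S : Subgroup Kˣ} (hS : powers ℓ K ≤ S) {x : Kˣ} :
    x ∈ bigH S ↔ ∀ f ∈ ctr (perp ℓ S), ev f x = 0 := by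
  unfold bigH
  rw [Subgroup.mem_sInf]
  constructor
  · rintro h f ⟨hf, hc⟩
    refine h (chKer f) ⟨hf, isCyclic_quotient_chKer f, fun H' hH' hcyc => ?_⟩
    obtain ⟨g, rfl⟩ := exists_chKer_eq (hS.trans hH') hcyc
    exact rigid_chKer_iff.mpr (hc g hH')
  · rintro h H ⟨hSH, hcyc, hr⟩
    obtain ⟨f, rfl⟩ := exists_chKer_eq (hS.trans hSH) hcyc
    refine h f ⟨hSH, fun g hg => ?_⟩
    exact rigid_chKer_iff.mp (hr (chKer g) hg (isCyclic_quotient_chKer g))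

theorem le_bigH {S : Subgroup Kˣ} : S ≤ bigH S := le_sInf fun _ h => h.1

/-- The centre is closed under the duality: commuting with `g` at `(x, y)` means vanishing at the
single element `x ^ g(y) / y ^ g(x)`, which every central character kills and which therefore lies
in `bigH S`. -/
theorem perp_bigH {S : Subgroup Kˣ} (hS : powers ℓ K ≤ S) :
    perp ℓ (bigH S) = ctr (perp ℓ S) := by
  refine Set.Subset.antisymm (fun f hf => ?_) fun f hf x hx => (mem_bigH_iff hS).mp hx f hf
  refine ⟨fun x hx => hf x (le_bigH hx), fun g hg x y hxy => ?_⟩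
  have h1 : x ^ (ev g y).val / y ^ (ev g x).val ∈ bigH S := by
    rw [mem_bigH_iff hS]
    intro h hh
    rw [ev_div, ev_pow, ev_pow, ZMod.natCast_zmod_val, ZMod.natCast_zmod_val]
    linear_combination hh.2 g hg x y hxy
  have h2 := hf _ h1
  rw [ev_div, ev_pow, ev_pow, ZMod.natCast_zmod_val, ZMod.natCast_zmod_val] at h2
  linear_combination h2

omit hp in
theorem powers_le_powersNeg : powers ℓ K ≤ powersNeg ℓ K := le_sup_left

theorem powersNeg_le_chKer_iff {f : Ch (ZMod ℓ) K} :
    powersNeg ℓ K ≤ chKer f ↔ f ∈ full K (ZMod ℓ) := by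
  rw [powersNeg, sup_le_iff, Subgroup.zpowers_le]
  exact and_iff_right (powers_le_chKer f)

theorem perp_powersNeg : perp ℓ (powersNeg ℓ K) = full K (ZMod ℓ) :=
  Set.ext fun _ => powersNeg_le_chKer_iff

theorem perp_U1 (A : ValuationSubring K) : perp ℓ (U1 ℓ A) = dec (ZMod ℓ) A := by
  ext f
  rw [mem_perp_iff, U1, sup_le_iff, powersNeg_le_chKer_iff, and_comm]
  rfl

theorem perp_U (A : ValuationSubring K) : perp ℓ (U ℓ A) = inr (ZMod ℓ) A := by
  ext f
  rw [mem_perp_iff, U, sup_le_iff, and_iff_left (powers_le_chKer f)]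
  rfl

omit hp in
theorem powersNeg_le_U (A : ValuationSubring K) : powersNeg ℓ K ≤ U ℓ A := by
  rw [powersNeg, sup_le_iff, Subgroup.zpowers_le]
  exact ⟨le_sup_right, unitGroup_le_U A (neg_one_mem_unitGroup A)⟩

theorem bigH_powersNeg_eq_top_iff :
    bigH (powersNeg ℓ K) = ⊤ ↔ ctr (full K (ZMod ℓ)) = {0} := by
  rw [← perp_powersNeg, ← perp_bigH powers_le_powersNeg]
  constructor
  · intro h
    rw [h]
    refine Set.Subset.antisymm (fun f hf => ch_ext fun x => hf x trivial) ?_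
    rintro _ rfl x -
    exact ev_zero x
  · intro h
    rw [eq_top_iff, perp_subset_iff (powers_le_powersNeg.trans le_bigH), h]
    rintro _ rfl x -
    exact ev_zero x

/-- Over a cyclic quotient all characters are multiples of one another's values at a generator,
hence commute, and `full` is its own centre. So once the centre is trivial, non-cyclic just means
non-trivial. -/
theorem isCyclic_powersNeg_iff (h : ctr (full K (ZMod ℓ)) = {0}) :
    IsCyclic (Kˣ ⧸ powersNeg ℓ K) ↔ full K (ZMod ℓ) = {0} := by
  constructor
  · intro hc
    rw [← h]
    refine Set.Subset.antisymm (fun f hf => ⟨hf, fun g hg x y _ => ?_⟩) fun f hf => hf.1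
    obtain ⟨k, hk⟩ := exists_chKer_eq powers_le_powersNeg hc
    obtain ⟨w, hw⟩ := hc.exists_generator
    obtain ⟨e, rfl⟩ := QuotientGroup.mk'_surjective _ w
    have hrep : ∀ z, ∃ n : ℤ, ∀ f ∈ full K (ZMod ℓ), ev f z = n * ev f e := by
      intro z
      obtain ⟨n, hn⟩ := Subgroup.mem_zpowers_iff.mp (hw (QuotientGroup.mk' _ z))
      have h1 : z / e ^ n ∈ powersNeg ℓ K := by
        refine (QuotientGroup.eq_one_iff _).mp ?_
        change QuotientGroup.mk' (powersNeg ℓ K) (z / e ^ n) = 1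
        rw [map_div, map_zpow, hn, div_self']
      refine ⟨n, fun f hf => ?_⟩
      have := powersNeg_le_chKer_iff.mpr hf h1
      rwa [mem_chKer, ev_div, ev_zpow, sub_eq_zero] at this
    obtain ⟨n, hn⟩ := hrep x
    obtain ⟨m, hm⟩ := hrep y
    rw [hn f hf, hn g hg, hm f hf, hm g hg]
    ring
  · intro hfull
    have htop : powersNeg ℓ K = ⊤ := by
      rw [eq_top_iff, perp_subset_iff powers_le_powersNeg, perp_powersNeg, hfull]
      rintro _ rfl x -
      exact ev_zero x
    have : Subsingleton (Kˣ ⧸ powersNeg ℓ K) := by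
      rw [htop]
      exact QuotientGroup.subsingleton_quotient_top
    infer_instance

theorem V_eq : V ℓ K = VCh (ZMod ℓ) ℓ K := by
  ext A
  refine and_congr_right fun _ => ?_
  rw [bigH_powersNeg_eq_top_iff, ctr_dec_eq_iff, and_comm]
  refine and_congr_right fun h => ?_
  rw [isCyclic_powersNeg_iff h, Ne, dec_eq_inr_iff]

theorem bijOn_U1 : Set.BijOn (U1 ℓ) (V ℓ K) (T ℓ K) ∧
    ∀ A ∈ V ℓ K, Set.BijOn (U1 ℓ) (Vrel ℓ A) (Trel ℓ A) := by
  obtain ⟨h1, h2⟩ := bijOn_of_perp (ℓ := ℓ) (K := K) (R := ZMod ℓ)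
    (ok := {S | powersNeg ℓ K ≤ S}) (perp := perp ℓ) (H := bigH) (u1 := U1 ℓ) (u := U ℓ)
    (fun S _ S' hS' => perp_subset_iff (powers_le_powersNeg.trans hS'))
    (fun S hS => ⟨le_trans hS le_bigH, perp_bigH (powers_le_powersNeg.trans hS)⟩)
    (fun S hS f hf => powersNeg_le_chKer_iff.mp (le_trans hS hf))
    (fun A => ⟨le_sup_right (a := A.principalUnitGroup), perp_U1 A⟩) (fun A => ⟨powersNeg_le_U A, perp_U A⟩)
  rw [← V_eq] at h1
  refine ⟨h1, fun A hA => ?_⟩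
  have := h2 A hA.1
  rw [← V_eq] at this
  exact this

/-! ### Lifting subgroups from the residue field. -/

variable {A : ValuationSubring K}

omit hp in
theorem mem_liftSubgroup_iff {S : Subgroup (IsLocalRing.ResidueField A)ˣ} {x : Kˣ} :
    x ∈ liftSubgroup ℓ A S ↔ ∃ u : A.unitGroup, rs A u ∈ S ∧ ∃ y : Kˣ, x = u * y ^ ℓ := by
  rw [liftSubgroup, Subgroup.mem_sup]
  constructor
  · rintro ⟨_, ⟨u, hu, rfl⟩, _, ⟨y, rfl⟩, rfl⟩
    exact ⟨u, hu, y, rfl⟩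
  · rintro ⟨u, hu, y, rfl⟩
    exact ⟨u, ⟨u, hu, rfl⟩, _, ⟨y, rfl⟩, rfl⟩

/-- Modulo ℓ-th powers an element of `U` is a unit, and two units with the same residue differ by a
principal unit, which lies in `S` already. -/
theorem residueSubgroup_eq_iff {S' : Subgroup (IsLocalRing.ResidueField A)ˣ}
    (hS' : powersNeg ℓ (IsLocalRing.ResidueField A) ≤ S') (S : Subgroup Kˣ) :
    (U1 ℓ A ≤ S ∧ S ≤ U ℓ A ∧ residueSubgroup A S = S') ↔ S = liftSubgroup ℓ A S' := by
  have hpow : powers ℓ (IsLocalRing.ResidueField A) ≤ S' := powers_le_powersNeg.trans hS'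
  constructor
  · rintro ⟨h1, h2, rfl⟩
    have hpS : powers ℓ K ≤ S := powers_le_powersNeg.trans (le_sup_right.trans h1)
    ext x
    rw [mem_liftSubgroup_iff]
    constructor
    · intro hx
      obtain ⟨y, hy⟩ := mem_U_iff.mp (h2 hx)
      refine ⟨⟨_, hy⟩, ⟨⟨_, hy⟩, S.div_mem hx (hpS ⟨y, rfl⟩), rfl⟩, y, ?_⟩
      rw [div_mul_cancel]
    · rintro ⟨u, ⟨w, hw, hwu⟩, y, rfl⟩
      refine S.mul_mem ?_ (hpS ⟨y, rfl⟩)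
      have h3 : rs A (u / w) = 1 := by
        rw [map_div, div_eq_one]
        exact hwu.symm
      have h4 := h1 (Subgroup.mem_sup_left ((rs_eq_one_iff A _).mp h3))
      rw [← div_mul_cancel (u : Kˣ) (w : Kˣ)]
      exact S.mul_mem h4 hw
  · rintro rfl
    refine ⟨?_, ?_, ?_⟩
    · rw [U1, powersNeg, sup_le_iff, sup_le_iff, Subgroup.zpowers_le]
      refine ⟨fun x hx => ?_, le_sup_right, ?_⟩
      · rw [mem_liftSubgroup_iff]
        refine ⟨⟨x, A.principal_units_le_units hx⟩, ?_, 1, by simp⟩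
        rw [(rs_eq_one_iff A _).mpr hx]
        exact S'.one_mem
      · rw [mem_liftSubgroup_iff]
        refine ⟨⟨-1, neg_one_mem_unitGroup A⟩, ?_, 1, by simp⟩
        rw [rs_neg_one]
        exact hS' (Subgroup.mem_sup_right (Subgroup.mem_zpowers _))
    · refine sup_le_sup_right ?_ _
      rintro _ ⟨u, -, rfl⟩
      exact u.2
    · ext x
      constructor
      · rintro ⟨u, hu, rfl⟩
        obtain ⟨w, hw, y, hy⟩ := mem_liftSubgroup_iff.mp hu
        have hyA : y ∈ A.unitGroup := by
          refine unitGroup_root hp.out.ne_zero ?_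
          have e : y ^ ℓ = (u : Kˣ) / w := by
            rw [eq_div_iff_mul_eq', mul_comm, ← hy]
            rfl
          rw [e]
          exact A.unitGroup.div_mem u.2 w.2
        have : u = w * ⟨y, hyA⟩ ^ ℓ := Subtype.ext hy
        rw [this]
        change rs A _ ∈ S'
        rw [map_mul, map_pow]
        exact S'.mul_mem hw (hpow ⟨_, rfl⟩)
      · intro hx
        obtain ⟨u, rfl⟩ := rs_surjective A x
        refine ⟨u, ?_, rfl⟩
        exact mem_liftSubgroup_iff.mpr ⟨u, hx, 1, by simp⟩

omit hp in
theorem liftSubgroup_U1 (B : ValuationSubring (IsLocalRing.ResidueField A)) :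
    liftSubgroup ℓ A (U1 ℓ B) = U1 ℓ (compVal A B) := by
  apply le_antisymm
  · refine sup_le ?_ (powers_le_powersNeg.trans le_sup_right)
    rw [Subgroup.map_le_iff_le_comap]
    intro u hu
    obtain ⟨p, hp', q, hq, h1⟩ := Subgroup.mem_sup.mp (Subgroup.mem_comap.mp hu)
    obtain ⟨r, ⟨y, rfl⟩, s, ⟨n, rfl⟩, rfl⟩ := Subgroup.mem_sup.mp hq
    obtain ⟨w, rfl⟩ := rs_surjective A y
    let e : A.unitGroup := ⟨-1, neg_one_mem_unitGroup A⟩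
    have h2 : rs A (u / (w ^ ℓ * e ^ n)) = p := by
      rw [map_div, map_mul, map_pow, map_zpow, rs_neg_one]
      exact div_eq_of_eq_mul' (by rw [mul_comm]; exact h1.symm)
    rw [← h2, ← mem_principalUnitGroup_compVal] at hp'
    have h3 : (u : Kˣ) = ((u / (w ^ ℓ * e ^ n) : A.unitGroup) : Kˣ) * ((w : Kˣ) ^ ℓ * (-1) ^ n) := by
      have : u = (u / (w ^ ℓ * e ^ n)) * (w ^ ℓ * e ^ n) := (div_mul_cancel _ _).symm
      exact congrArg Subtype.val this
    rw [Subgroup.mem_comap]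
    change (u : Kˣ) ∈ _
    rw [h3]
    exact Subgroup.mul_mem_sup hp' (Subgroup.mul_mem_sup ⟨_, rfl⟩ ⟨n, rfl⟩)
  · rw [U1, powersNeg, sup_le_iff, sup_le_iff, Subgroup.zpowers_le]
    refine ⟨fun x hx => ?_, le_sup_right, ?_⟩
    · have hxA := principalUnitGroup_compVal_le B hx
      refine mem_liftSubgroup_iff.mpr ⟨⟨x, hxA⟩, ?_, 1, by simp⟩
      exact Subgroup.mem_sup_left (mem_principalUnitGroup_compVal.mp hx)
    · refine mem_liftSubgroup_iff.mpr ⟨⟨-1, neg_one_mem_unitGroup A⟩, ?_, 1, by simp⟩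
      rw [rs_neg_one]
      exact Subgroup.mem_sup_right (Subgroup.mem_sup_right (Subgroup.mem_zpowers _))

end ModEllDuality

/-! ### `ℓ`-adic completions and their functionals -/

section HatBasics

universe u

variable {ℓ : ℕ} [hp : Fact ℓ.Prime] {W W' : Type u} [AddCommGroup W] [AddCommGroup W']

instance coeffPadicInt : Coeff ℓ ℤ_[ℓ] where
  not_unit := PadicInt.p_nonunit
  separated := by
    intro r h
    by_contra hr
    obtain ⟨s, hs⟩ := h (r.valuation + 1)
    have h1 : r ∈ (Ideal.span {(ℓ : ℤ_[ℓ]) ^ (r.valuation + 1)} : Ideal ℤ_[ℓ]) :=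
      Ideal.mem_span_singleton.mpr ⟨s, hs⟩
    rw [PadicInt.mem_span_pow_iff_le_valuation r hr] at h1
    omega

theorem padic_ext {a b : ℤ_[ℓ]} (h : ∀ n : ℕ, ∃ s, a - b = (ℓ : ℤ_[ℓ]) ^ n * s) : a = b :=
  sub_eq_zero.mp (Coeff.separated (ℓ := ℓ) _ h)

theorem padic_approx (z : ℤ_[ℓ]) (n : ℕ) : ∃ (k : ℕ) (s : ℤ_[ℓ]), z = k + (ℓ : ℤ_[ℓ]) ^ n * s := by
  obtain ⟨s, hs⟩ := Ideal.mem_span_singleton.mp (PadicInt.appr_spec n z)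
  exact ⟨_, s, by rw [← hs]; ring⟩

theorem pow_smul_eq {M : Type*} [AddCommGroup M] [Module ℤ_[ℓ] M] (n : ℕ) (x : M) :
    ((ℓ : ℤ_[ℓ]) ^ n) • x = ℓ ^ n • x := by
  rw [← Nat.cast_pow, Nat.cast_smul_eq_nsmul]

/-- Additive maps to `ℤ_ℓ` are `ℤ_ℓ`-linear. -/
noncomputable def addToLinear {M : Type*} [AddCommGroup M] [Module ℤ_[ℓ] M] (φ : M →+ ℤ_[ℓ]) : M →ₗ[ℤ_[ℓ]] ℤ_[ℓ] :=
  { φ with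
    map_smul' := by
      intro z x
      change φ (z • x) = z * φ x
      -- Modulo `ℓ ^ n` the scalar `z` is a natural number, and an additive map sends multiples of
      -- `ℓ ^ n` to such multiples; no continuity is needed.
      refine padic_ext fun n => ?_
      obtain ⟨k, s, hs⟩ := padic_approx z n
      have h1 : φ (z • x) = k * φ x + (ℓ : ℤ_[ℓ]) ^ n * φ (s • x) := by
        rw [hs, add_smul, mul_smul, map_add, Nat.cast_smul_eq_nsmul, pow_smul_eq, map_nsmul,
          map_nsmul, nsmul_eq_mul, nsmul_eq_mul, Nat.cast_pow]
      refine ⟨φ (s • x) - s * φ x, ?_⟩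
      rw [h1]
      linear_combination (-φ x) * hs }

namespace Hat

omit hp in
theorem mk_eq_iff {n : ℕ} {w w' : W} :
    ModPow.mk ℓ W n w = ModPow.mk ℓ W n w' ↔ ∃ v, ℓ ^ n • v = w - w' := by
  rw [← sub_eq_zero, ← map_sub]
  exact QuotientAddGroup.eq_zero_iff (w - w')

theorem ext' {x y : Hat ℓ W} (h : ∀ n, x.1 n = y.1 n) : x = y := Subtype.ext (funext h)

theorem exists_rep (x : Hat ℓ W) (n : ℕ) : ∃ w, ModPow.mk ℓ W n w = x.1 n :=
  ModPow.mk_surjective ℓ W n _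

theorem rep_of_le (x : Hat ℓ W) {n m : ℕ} (hnm : n ≤ m) {w : W} (hw : ModPow.mk ℓ W m w = x.1 m) :
    ModPow.mk ℓ W n w = x.1 n := by
  induction m, hnm using Nat.le_induction with
  | base => exact hw
  | succ m _ ih =>
    apply ih
    rw [← x.2 m, ← hw]
    rfl

/-- The element of the completion defined by a Cauchy sequence. -/
def ofSeq (v : ℕ → W) (h : ∀ n, ∃ d, v (n + 1) = v n + ℓ ^ n • d) : Hat ℓ W :=
  ⟨fun n => ModPow.mk ℓ W n (v n), fun n => by
    change ModPow.mk ℓ W n (v (n + 1)) = _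
    obtain ⟨d, hd⟩ := h n
    exact mk_eq_iff.mpr ⟨d, by rw [hd, add_sub_cancel_left]⟩⟩

theorem ofSeq_apply (v : ℕ → W) (h : ∀ n, ∃ d, v (n + 1) = v n + ℓ ^ n • d) (n : ℕ) :
    (ofSeq v h).1 n = ModPow.mk ℓ W n (v n) := rfl

theorem exists_seq (x : Hat ℓ W) : ∃ v : ℕ → W, (∀ n, ModPow.mk ℓ W n (v n) = x.1 n) ∧
    ∀ n, ∃ d, v (n + 1) = v n + ℓ ^ n • d := by
  choose v hv using exists_rep x
  refine ⟨v, hv, fun n => ?_⟩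
  have := rep_of_le x n.le_succ (hv (n + 1))
  rw [← hv n, mk_eq_iff] at this
  obtain ⟨d, hd⟩ := this
  exact ⟨d, by rw [hd]; abel⟩

omit hp in
theorem seq_sum (v : ℕ → W) (d : ℕ → W) (k : ℕ) (h : ∀ n, v (n + 1) = v n + ℓ ^ (n + k) • d n)
    (n : ℕ) : v n = v 0 + ℓ ^ k • ∑ j ∈ Finset.range n, ℓ ^ j • d j := by
  induction n with
  | zero => simp
  | succ n ih =>
    rw [h n, ih, Finset.sum_range_succ, smul_add, smul_smul, ← pow_add, add_comm n k, add_assoc]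

/-- From its `n`-th term on, a representing sequence telescopes to `ℓ ^ n` times another Cauchy
sequence. Nothing has to be divided by `ℓ ^ n`, so torsion in `W` is harmless. -/
theorem exists_eq_pow_nsmul {x : Hat ℓ W} {n : ℕ} (hx : x.1 n = 0) :
    ∃ y : Hat ℓ W, x = ℓ ^ n • y := by
  obtain ⟨v, hv, hd⟩ := exists_seq x
  choose d hd using hd
  have h0 := hv n
  rw [hx, ← map_zero (ModPow.mk ℓ W n), mk_eq_iff] at h0
  obtain ⟨e, he⟩ := h0
  rw [sub_zero] at he
  have hsum : ∀ k, v (k + n) = ℓ ^ n • (e + ∑ j ∈ Finset.range k, ℓ ^ j • d (j + n)) := by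
    intro k
    have := seq_sum (ℓ := ℓ) (fun k => v (k + n)) (fun k => d (k + n)) n
      (fun k => by rw [← hd, add_right_comm]) k
    rw [this, Nat.zero_add, ← he, smul_add]
  refine ⟨ofSeq (fun k => e + ∑ j ∈ Finset.range k, ℓ ^ j • d (j + n))
    (fun k => ⟨d (k + n), by rw [Finset.sum_range_succ, add_assoc]⟩), ext' fun m => ?_⟩
  change x.1 m = ℓ ^ n • ModPow.mk ℓ W m _
  rw [← map_nsmul, ← hsum, rep_of_le x (Nat.le_add_right m n) (hv (m + n))]

theorem exists_toHat_add (x : Hat ℓ W) (n : ℕ) :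
    ∃ (w : W) (y : Hat ℓ W), ModPow.mk ℓ W n w = x.1 n ∧ x = toHat ℓ W w + ℓ ^ n • y := by
  obtain ⟨w, hw⟩ := exists_rep x n
  obtain ⟨y, hy⟩ := exists_eq_pow_nsmul (x := x - toHat ℓ W w) (n := n) (by
    change x.1 n - ModPow.mk ℓ W n w = 0
    rw [hw, sub_self])
  exact ⟨w, y, hw, by rw [← hy]; abel⟩

/-- The image of `W` is ℓ-adically dense, and linear functionals are ℓ-adically continuous
automatically. -/
theorem linear_ext {φ ψ : Hat ℓ W →ₗ[ℤ_[ℓ]] ℤ_[ℓ]}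
    (h : ∀ w, φ (toHat ℓ W w) = ψ (toHat ℓ W w)) : φ = ψ := by
  refine LinearMap.ext fun x => padic_ext fun n => ?_
  obtain ⟨w, y, -, rfl⟩ := exists_toHat_add x n
  refine ⟨φ y - ψ y, ?_⟩
  rw [map_add, map_add, h, map_nsmul, map_nsmul, nsmul_eq_mul, nsmul_eq_mul, Nat.cast_pow]
  ring

/-- The cosets `f (v n) + ℓ ^ n ℤ_ℓ` are nested and compact; the limit is a common point. -/
theorem exists_lim (f : W →+ ℤ_[ℓ]) (x : Hat ℓ W) : ∃ L : ℤ_[ℓ], ∀ n w,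
    ModPow.mk ℓ W n w = x.1 n → ∃ s, L = f w + (ℓ : ℤ_[ℓ]) ^ n * s := by
  obtain ⟨v, hv, hd⟩ := exists_seq x
  choose d hd using hd
  let C : ℕ → Set ℤ_[ℓ] := fun n => Set.range fun s => f (v n) + (ℓ : ℤ_[ℓ]) ^ n * s
  have hC : ∀ n, IsCompact (C n) := fun n => isCompact_range (by fun_prop)
  obtain ⟨L, hL⟩ := IsCompact.nonempty_iInter_of_sequence_nonempty_isCompact_isClosed C
    (by
      rintro n _ ⟨s, rfl⟩
      refine ⟨f (d n) + ℓ * s, ?_⟩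
      simp only [hd n, map_add, map_nsmul, nsmul_eq_mul, Nat.cast_pow]
      ring)
    (fun n => Set.range_nonempty _) (hC 0) (fun n => (hC n).isClosed)
  rw [Set.mem_iInter] at hL
  refine ⟨L, fun n w hw => ?_⟩
  obtain ⟨s, hs⟩ := hL n
  rw [← hv n, mk_eq_iff] at hw
  obtain ⟨u, hu⟩ := hw
  refine ⟨s - f u, ?_⟩
  have : f w = f (v n) + (ℓ : ℤ_[ℓ]) ^ n * f u := by
    rw [← sub_eq_iff_eq_add', ← map_sub, ← hu, map_nsmul, nsmul_eq_mul, Nat.cast_pow]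
  rw [this, ← hs]
  ring

/-- The extension of a homomorphism `W → ℤ_ℓ` to the completion. -/
noncomputable def extend (f : W →+ ℤ_[ℓ]) : Hat ℓ W →ₗ[ℤ_[ℓ]] ℤ_[ℓ] :=
  addToLinear (AddMonoidHom.mk' (fun x => (exists_lim f x).choose) (by
    intro x y
    refine padic_ext fun n => ?_
    obtain ⟨w, hw⟩ := exists_rep x n
    obtain ⟨w', hw'⟩ := exists_rep y n
    obtain ⟨s, hs⟩ := (exists_lim f x).choose_spec n w hw
    obtain ⟨s', hs'⟩ := (exists_lim f y).choose_spec n w' hw'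
    obtain ⟨t, ht⟩ := (exists_lim f (x + y)).choose_spec n (w + w') (by
      rw [map_add, hw, hw']
      rfl)
    refine ⟨t - s - s', ?_⟩
    rw [ht, hs, hs', map_add]
    ring))

theorem extend_spec (f : W →+ ℤ_[ℓ]) (x : Hat ℓ W) (n : ℕ) (w : W)
    (hw : ModPow.mk ℓ W n w = x.1 n) : ∃ s, extend f x = f w + (ℓ : ℤ_[ℓ]) ^ n * s :=
  (exists_lim f x).choose_spec n w hw

@[simp] theorem extend_toHat (f : W →+ ℤ_[ℓ]) (w : W) : extend f (toHat ℓ W w) = f w := by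
  refine padic_ext fun n => ?_
  obtain ⟨s, hs⟩ := extend_spec f (toHat ℓ W w) n w rfl
  exact ⟨s, by rw [hs]; ring⟩

theorem extend_eq {f : W →+ ℤ_[ℓ]} {φ : Hat ℓ W →ₗ[ℤ_[ℓ]] ℤ_[ℓ]}
    (h : ∀ w, φ (toHat ℓ W w) = f w) : extend f = φ :=
  linear_ext fun w => by rw [extend_toHat, h]

theorem continuous_apply (n : ℕ) : Continuous fun x : Hat ℓ W => x.1 n :=
  (_root_.continuous_apply n).comp continuous_subtype_val

/-- The kernel is an intersection of conditions on single coordinates: at each level `n` some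
representative has value in `ℓ ^ n ℤ_ℓ`. The coordinates live in discrete spaces. -/
theorem isClosed_ker_extend (f : W →+ ℤ_[ℓ]) : IsClosed {x : Hat ℓ W | extend f x = 0} := by
  have : {x : Hat ℓ W | extend f x = 0} =
      ⋂ n, (fun x : Hat ℓ W => x.1 n) ⁻¹'
        {y | ∃ w s, ModPow.mk ℓ W n w = y ∧ f w = (ℓ : ℤ_[ℓ]) ^ n * s} := by
    ext x
    rw [Set.mem_iInter]
    constructor
    · intro hx n
      obtain ⟨w, hw⟩ := exists_rep x n
      obtain ⟨s, hs⟩ := extend_spec f x n w hw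
      rw [show extend f x = 0 from hx] at hs
      exact ⟨w, -s, hw, by linear_combination -hs⟩
    · intro hx
      refine padic_ext fun n => ?_
      obtain ⟨w, s, hw, hs⟩ := hx n
      obtain ⟨t, ht⟩ := extend_spec f x n w hw
      exact ⟨s + t, by rw [ht, hs]; ring⟩
  rw [this]
  exact isClosed_iInter fun n => (isClosed_discrete _).preimage (continuous_apply n)

theorem mem_of_isClosed {S : Set (Hat ℓ W)} (hS : IsClosed S) {x : Hat ℓ W}
    (h : ∀ n : ℕ, ∃ y ∈ S, ∃ z, x = y + ℓ ^ n • z) : x ∈ S := by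
  choose y hy z hz using h
  refine hS.mem_of_tendsto (f := y) (b := Filter.atTop) ?_ (Filter.Eventually.of_forall hy)
  rw [tendsto_subtype_rng, tendsto_pi_nhds]
  intro m
  refine tendsto_const_nhds.congr' ?_
  filter_upwards [Filter.eventually_ge_atTop m] with n hn
  have h1 : x.1 m = (y n).1 m + ℓ ^ n • (z n).1 m := congrArg (fun t : Hat ℓ W => t.1 m) (hz n)
  have h2 : ℓ ^ n • (z n).1 m = 0 := by
    obtain ⟨k, rfl⟩ := Nat.exists_eq_add_of_le hn
    rw [pow_add, mul_comm, mul_smul, ModPow.pow_nsmul_eq_zero, smul_zero]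
  rw [h1, h2, add_zero]

theorem smul_mem_of_pow {S : Submodule ℤ_[ℓ] (Hat ℓ W)}
    (h : ∀ (n : ℕ) (x : Hat ℓ W), ℓ ^ n • x ∈ S → x ∈ S) {r : ℤ_[ℓ]} (hr : r ≠ 0) {x : Hat ℓ W}
    (hx : r • x ∈ S) : x ∈ S := by
  rw [PadicInt.unitCoeff_spec hr, mul_smul] at hx
  have := S.smul_mem (↑(PadicInt.unitCoeff hr)⁻¹ : ℤ_[ℓ]) hx
  rw [smul_smul, Units.inv_mul, one_smul, pow_smul_eq] at this
  exact h _ _ this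

/-- Closed submodules with torsion-free quotient are cut out by functionals. -/
theorem exists_extend_ne_zero {S : Submodule ℤ_[ℓ] (Hat ℓ W)} (hS : IsClosed (S : Set (Hat ℓ W)))
    (htf : ∀ r : ℤ_[ℓ], r ≠ 0 → ∀ x : Hat ℓ W, r • x ∈ S → x ∈ S) {x : Hat ℓ W} (hx : x ∉ S) :
    ∃ f : W →+ ℤ_[ℓ], (∀ y ∈ S, extend f y = 0) ∧ extend f x ≠ 0 := by
  classical
  -- As `S` is closed, `x ∉ S + ℓ ^ n Ŵ` for some `n`. With `n + 1` the least such exponent, `x = y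
  -- + ℓ ^ n z` where `y ∈ S` and `z` is not divisible by `ℓ` modulo `S`; a functional not vanishing
  -- at `z` does not vanish at `x`.
  have hex : ∃ n : ℕ, ∀ y ∈ S, ∀ z, x ≠ y + ℓ ^ n • z := by
    by_contra! hn
    exact hx (mem_of_isClosed hS hn)
  have hne : Nat.find hex ≠ 0 := by
    intro h0
    have := Nat.find_spec hex 0 S.zero_mem x
    rw [h0] at this
    simp at this
  obtain ⟨n, hn⟩ := Nat.exists_eq_succ_of_ne_zero hne
  have h1 := Nat.find_min hex (m := n) (by omega)
  push Not at h1
  obtain ⟨y, hy, z, hxz⟩ := h1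
  have h2 := Nat.find_spec hex
  rw [hn] at h2
  obtain ⟨φ, hφ⟩ := exists_hom_ne_zero (W := Hat ℓ W ⧸ S) (R := ℤ_[ℓ]) ℓ (w := S.mkQ z)
    (by
      intro n hn t ht
      obtain ⟨t, rfl⟩ := S.mkQ_surjective t
      rw [← map_nsmul, Submodule.mkQ_apply, Submodule.Quotient.mk_eq_zero,
        ← Nat.cast_smul_eq_nsmul ℤ_[ℓ]] at ht
      rw [Submodule.mkQ_apply, Submodule.Quotient.mk_eq_zero]
      exact htf _ (Nat.cast_ne_zero.mpr hn) _ ht)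
    (by
      intro t ht
      obtain ⟨t, rfl⟩ := S.mkQ_surjective t
      rw [← map_nsmul, Submodule.mkQ_apply, Submodule.mkQ_apply, Submodule.Quotient.eq] at ht
      have h3 := S.neg_mem (S.nsmul_mem ht (ℓ ^ n))
      refine h2 _ (S.add_mem hy h3) t ?_
      rw [hxz, pow_succ, mul_smul, smul_sub]
      abel)
  have hE : extend ((φ.comp S.mkQ.toAddMonoidHom).comp (toHat ℓ W)) = addToLinear φ ∘ₗ S.mkQ :=
    extend_eq fun w => rfl
  refine ⟨(φ.comp S.mkQ.toAddMonoidHom).comp (toHat ℓ W), fun t ht => ?_, ?_⟩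
  · rw [hE, LinearMap.comp_apply, Submodule.mkQ_apply, (Submodule.Quotient.mk_eq_zero S).mpr ht,
      map_zero]
  · rw [hE, hxz, map_add, LinearMap.comp_apply, Submodule.mkQ_apply,
      (Submodule.Quotient.mk_eq_zero S).mpr hy, map_zero, zero_add, map_nsmul, nsmul_eq_mul]
    refine mul_ne_zero (Nat.cast_ne_zero.mpr (pow_ne_zero n hp.out.ne_zero)) hφ

theorem hatMap_toHat (f : W →+ W') (w : W) : hatMap ℓ f (toHat ℓ W w) = toHat ℓ W' (f w) := rfl

theorem hatMap_apply (f : W →+ W') (x : Hat ℓ W) {n : ℕ} {w : W} (hw : ModPow.mk ℓ W n w = x.1 n) :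
    (hatMap ℓ f x).1 n = ModPow.mk ℓ W' n (f w) := by
  change ModPow.map ℓ f n (x.1 n) = _
  rw [← hw]
  rfl

theorem extend_hatMap (f : W →+ W') (g : W' →+ ℤ_[ℓ]) (x : Hat ℓ W) :
    extend g (hatMap ℓ f x) = extend (g.comp f) x := by
  have : extend (g.comp f) = extend g ∘ₗ hatMap ℓ f :=
    extend_eq fun w => by rw [LinearMap.comp_apply, hatMap_toHat, extend_toHat]; rfl
  rw [this]
  rfl

theorem hatMap_surjective {f : W →+ W'} (hf : Function.Surjective f) :
    Function.Surjective (hatMap ℓ f) := by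
  intro y
  obtain ⟨v, hv, hd⟩ := exists_seq y
  choose d hd using hd
  choose σ hσ using hf
  refine ⟨ofSeq (fun n => σ (v 0) + ∑ j ∈ Finset.range n, ℓ ^ j • σ (d j))
    (fun n => ⟨σ (d n), by rw [Finset.sum_range_succ, add_assoc]⟩), ext' fun n => ?_⟩
  rw [hatMap_apply f _ (ofSeq_apply _ _ n).symm, ← hv n]
  congr 1
  have := seq_sum (ℓ := ℓ) v d 0 hd n
  rw [this, pow_zero, one_smul, map_add, hσ, map_sum]
  simp only [map_nsmul, hσ]

/-! ### Completions of subgroups whose quotient has no ℓ-torsion. -/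

section Saturated

variable {i : W' →+ W} (hi : Function.Injective i)
  (hsat : ∀ (n : ℕ) (w : W), ℓ ^ n • w ∈ i.range → w ∈ i.range)

include hi hsat

theorem hatMap_injective : Function.Injective (hatMap ℓ i) := by
  rw [injective_iff_map_eq_zero]
  intro x hx
  refine ext' fun n => ?_
  obtain ⟨w, hw⟩ := exists_rep x n
  have h1 := hatMap_apply i x hw
  rw [hx] at h1
  have h2 : ModPow.mk ℓ W n (i w) = ModPow.mk ℓ W n 0 := by rw [← h1, map_zero]; rfl
  rw [mk_eq_iff] at h2
  obtain ⟨v, hv⟩ := h2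
  rw [sub_zero] at hv
  obtain ⟨v', rfl⟩ := hsat n v ⟨w, hv.symm⟩
  rw [← map_nsmul] at hv
  rw [← hw, ← hi hv]
  change _ = (0 : ModPow ℓ W' n)
  rw [map_nsmul, ModPow.pow_nsmul_eq_zero]

/-- Saturation allows the corrections between successive levels to be taken in `W'`, so
representatives chosen level by level form a Cauchy sequence there. -/
theorem mem_range_hatMap_iff {x : Hat ℓ W} :
    x ∈ LinearMap.range (hatMap ℓ i) ↔ ∀ n, ∃ w, ModPow.mk ℓ W n (i w) = x.1 n := by
  constructor
  · rintro ⟨y, rfl⟩ n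
    obtain ⟨w, hw⟩ := exists_rep y n
    exact ⟨w, (hatMap_apply i y hw).symm⟩
  · intro h
    choose v hv using h
    refine ⟨ofSeq v fun n => ?_, ext' fun n => ?_⟩
    · have h1 := rep_of_le x n.le_succ (hv (n + 1))
      rw [← hv n, mk_eq_iff] at h1
      obtain ⟨d, hd⟩ := h1
      rw [← map_sub] at hd
      obtain ⟨d', rfl⟩ := hsat n d ⟨_, hd.symm⟩
      rw [← map_nsmul] at hd
      exact ⟨d', by rw [hi hd]; abel⟩
    · rw [hatMap_apply i _ (ofSeq_apply _ _ n).symm, hv]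

theorem isClosed_range_hatMap :
    IsClosed ((LinearMap.range (hatMap ℓ i) : Submodule ℤ_[ℓ] (Hat ℓ W)) : Set (Hat ℓ W)) := by
  have : ((LinearMap.range (hatMap ℓ i) : Submodule ℤ_[ℓ] (Hat ℓ W)) : Set (Hat ℓ W)) =
      ⋂ n, (fun x : Hat ℓ W => x.1 n) ⁻¹' {y | ∃ w, ModPow.mk ℓ W n (i w) = y} := by
    ext x
    rw [SetLike.mem_coe, mem_range_hatMap_iff hi hsat, Set.mem_iInter]
    rfl
  rw [this]
  exact isClosed_iInter fun n => (isClosed_discrete _).preimage (continuous_apply n)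

theorem mem_range_hatMap_of_smul {r : ℤ_[ℓ]} (hr : r ≠ 0) {x : Hat ℓ W}
    (hx : r • x ∈ LinearMap.range (hatMap ℓ i)) : x ∈ LinearMap.range (hatMap ℓ i) := by
  refine smul_mem_of_pow (fun k x hx => ?_) hr hx
  rw [mem_range_hatMap_iff hi hsat] at hx ⊢
  intro n
  obtain ⟨w, hw⟩ := exists_rep x (n + k)
  obtain ⟨u, hu⟩ := hx (n + k)
  have h1 : ModPow.mk ℓ W (n + k) (ℓ ^ k • w) = (ℓ ^ k • x).1 (n + k) := by
    rw [map_nsmul, hw]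
    rfl
  rw [← hu, mk_eq_iff] at h1
  obtain ⟨v, hv⟩ := h1
  obtain ⟨u', hu'⟩ := hsat k (w - ℓ ^ n • v) ⟨u, by
    rw [smul_sub, smul_smul, ← pow_add, add_comm k n, hv]
    abel⟩
  refine ⟨u', ?_⟩
  rw [← rep_of_le x (Nat.le_add_right n k) hw, hu', map_sub, map_nsmul, ModPow.pow_nsmul_eq_zero,
    sub_zero]

theorem mem_range_hatMap_of_extend {x : Hat ℓ W}
    (h : ∀ f : W →+ ℤ_[ℓ], (∀ w, f (i w) = 0) → extend f x = 0) :
    x ∈ LinearMap.range (hatMap ℓ i) := by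
  by_contra hx
  obtain ⟨f, hf, hfx⟩ := exists_extend_ne_zero (isClosed_range_hatMap hi hsat)
    (fun r hr x hx => mem_range_hatMap_of_smul hi hsat hr hx) hx
  refine hfx (h f fun w => ?_)
  have := hf _ ⟨toHat ℓ W' w, rfl⟩
  rwa [hatMap_toHat, extend_toHat] at this

end Saturated

end Hat

end HatBasics

/-! ### The pro-`ℓ` case -/

/-! ### Divisibility of roots of unity. -/

section RootsOfUnity

universe u

variable {k : Type u} [Field k] {ℓ : ℕ} [hp : Fact ℓ.Prime]

omit hp in
theorem exists_pow_eq_of_coprime {b : ℕ} (hb : b.Coprime ℓ) (n : ℕ) {η : kˣ} (h : η ^ b = 1) :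
    ∃ y : kˣ, y ^ ℓ ^ n = η := by
  obtain ⟨u, v, huv⟩ := Nat.isCoprime_iff_coprime.mpr (hb.pow_right n)
  refine ⟨η ^ v, ?_⟩
  have h1 : η ^ (u * (b : ℤ) + v * ((ℓ ^ n : ℕ) : ℤ)) = η := by rw [huv, zpow_one]
  rw [zpow_add, mul_comm u, zpow_mul, zpow_natCast, h, one_zpow, one_mul, zpow_mul,
    zpow_natCast] at h1
  exact h1

theorem exists_coprime_factor {ζ : kˣ} (h : IsOfFinOrder ζ) :
    ∃ a b : ℕ, b.Coprime ℓ ∧ ζ ^ (ℓ ^ a * b) = 1 := by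
  obtain ⟨a, b, hb, hab⟩ := Nat.exists_eq_pow_mul_and_not_dvd h.orderOf_pos.ne' ℓ hp.out.ne_one
  exact ⟨a, b, ((Nat.Prime.coprime_iff_not_dvd hp.out).mpr hb).symm, by
    rw [← hab, pow_orderOf_eq_one]⟩

/-- Up to a fixed power of `ℓ`, roots of unity are infinitely `ℓ`-divisible. -/
theorem exists_rootsOfUnity_divisible : ∃ m : ℕ, ∀ (n : ℕ) (ζ : kˣ), IsOfFinOrder ζ →
    ∃ y : kˣ, y ^ ℓ ^ n = ζ ^ ℓ ^ m := by
  -- Either the ℓ-power roots of unity are all killed by one `ℓ ^ m`, or there are elements of every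
  -- order `ℓ ^ n`.
  by_cases hA : ∃ m : ℕ, ∀ ζ : kˣ, ζ ^ ℓ ^ (m + 1) = 1 → ζ ^ ℓ ^ m = 1
  · obtain ⟨m, hm⟩ := hA
    refine ⟨m, fun n ζ hζ => ?_⟩
    obtain ⟨a, b, hb, hab⟩ := exists_coprime_factor (ℓ := ℓ) hζ
    have key : ∀ (a : ℕ) (ζ : kˣ), ζ ^ ℓ ^ (m + a) = 1 → ζ ^ ℓ ^ m = 1 := by
      intro a
      induction a with
      | zero => intro ζ h; exact h
      | succ a ih =>
        intro ζ h
        apply ih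
        have h2 := hm (ζ ^ ℓ ^ a) (by
          rw [← pow_mul, ← pow_add, ← h]
          congr 2
          omega)
        rw [← pow_mul, ← pow_add] at h2
        rw [add_comm m a]
        exact h2
    refine exists_pow_eq_of_coprime hb n ?_
    rw [← pow_mul, mul_comm, pow_mul]
    apply key a
    rw [← pow_mul, show b * ℓ ^ (m + a) = (ℓ ^ a * b) * ℓ ^ m by ring, pow_mul, hab, one_pow]
  · push Not at hA
    refine ⟨0, fun n ζ hζ => ?_⟩
    rw [pow_zero, pow_one]
    obtain ⟨a, b, hb, hab⟩ := exists_coprime_factor (ℓ := ℓ) hζ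
    obtain ⟨u, v, huv⟩ := Nat.isCoprime_iff_coprime.mpr (hb.pow_right a)
    obtain ⟨y₁, hy₁⟩ := exists_pow_eq_of_coprime hb n (η := (ζ ^ ℓ ^ a) ^ v) (by
      rw [← zpow_natCast, ← zpow_mul, mul_comm, zpow_mul, zpow_natCast, ← pow_mul, hab, one_zpow])
    -- `η` has order `ℓ ^ (a + n + 1)`. The ℓ-part of `ζ` is killed by `ℓ ^ a`, so it is a power of
    -- `η` with exponent divisible by `ℓ ^ n`.
    obtain ⟨η, hη1, hη2⟩ := hA (a + n)
    have hord := orderOf_eq_prime_pow hη2 hη1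
    have hprim : IsPrimitiveRoot (η : k) (ℓ ^ (a + n + 1)) := by
      rw [IsPrimitiveRoot.coe_units_iff, ← hord]
      exact IsPrimitiveRoot.orderOf η
    have hθ : ((ζ ^ b) ^ u) ^ ℓ ^ a = 1 := by
      rw [← zpow_natCast, ← zpow_mul, mul_comm, zpow_mul, zpow_natCast, ← pow_mul, mul_comm, hab,
        one_zpow]
    have : NeZero (ℓ ^ (a + n + 1)) := ⟨pow_ne_zero _ hp.out.ne_zero⟩
    obtain ⟨i, -, hi⟩ := hprim.eq_pow_of_pow_eq_one (ξ := (((ζ ^ b) ^ u : kˣ) : k)) (by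
      rw [← Units.val_pow_eq_pow_val, add_assoc, pow_add, pow_mul, hθ, one_pow, Units.val_one])
    have hi' : η ^ i = (ζ ^ b) ^ u := Units.ext (by rw [Units.val_pow_eq_pow_val, hi])
    have hdvd : ℓ ^ (a + n + 1) ∣ i * ℓ ^ a := by
      rw [← hord, orderOf_dvd_iff_pow_eq_one, pow_mul, hi', hθ]
    have hdvd' : ℓ ^ n ∣ i := by
      have h1 : ℓ ^ n * ℓ ^ a ∣ i * ℓ ^ a :=
        (Dvd.intro ℓ (by rw [pow_succ, pow_add]; ring)).trans hdvd
      exact Nat.dvd_of_mul_dvd_mul_right (pow_pos hp.out.pos a) h1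
    obtain ⟨j, rfl⟩ := hdvd'
    refine ⟨η ^ j * y₁, ?_⟩
    rw [mul_pow, hy₁, ← pow_mul, mul_comm j, hi']
    have h1 : ζ ^ (u * (b : ℤ) + v * ((ℓ ^ a : ℕ) : ℤ)) = ζ := by rw [huv, zpow_one]
    rw [zpow_add, mul_comm u, zpow_mul, zpow_natCast, mul_comm v, zpow_mul, zpow_natCast] at h1
    exact h1

end RootsOfUnity

/-! ### Duality between closed submodules and characters. -/

section ProEllDuality

universe u

open Hat

variable {ℓ : ℕ} [hp : Fact ℓ.Prime] {K : Type u} [Field K]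

@[simp] theorem extend_unitsToHat (f : Ch ℤ_[ℓ] K) (x : Kˣ) :
    extend f (unitsToHat ℓ x) = ev f x := extend_toHat f _

/-- An element killed by all functionals lies in the image of the completion of the roots of unity,
and a fixed power of `ℓ` annihilates that image. Here the field matters: for a general abelian
group, unbounded ℓ-torsion may complete to non-torsion elements. -/
theorem mem_tor_iff {z : FieldHat ℓ K} :
    z ∈ tor ℓ (FieldHat ℓ K) ↔ ∀ h : Ch ℤ_[ℓ] K, extend h z = 0 := by
  rw [tor, Submodule.mem_torsion_iff]
  constructor
  · rintro ⟨⟨a, ha⟩, hz⟩ h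
    have h1 : a * extend h z = 0 := by
      rw [← smul_eq_mul, ← map_smul]
      exact (congrArg (extend h) hz).trans (map_zero _)
    exact (mul_eq_zero.mp h1).resolve_left (nonZeroDivisors.ne_zero ha)
  · intro hz
    let i := (AddCommGroup.torsion (Additive Kˣ)).subtype
    have hi : Function.Injective i := Subtype.val_injective
    have hmem : ∀ w, w ∈ i.range ↔ IsOfFinAddOrder w := fun w => by
      rw [AddSubgroup.range_subtype]
      rfl
    have hsat : ∀ (n : ℕ) (w : Additive Kˣ), ℓ ^ n • w ∈ i.range → w ∈ i.range := by
      intro n w hw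
      rw [hmem] at hw ⊢
      exact (isOfFinAddOrder_nsmul.mp hw).resolve_right (pow_ne_zero n hp.out.ne_zero)
    obtain ⟨y, rfl⟩ := mem_range_hatMap_of_extend hi hsat fun f _ => hz f
    obtain ⟨m, hm⟩ := exists_rootsOfUnity_divisible (k := K) (ℓ := ℓ)
    refine ⟨⟨(ℓ : ℤ_[ℓ]) ^ m, mem_nonZeroDivisors_of_ne_zero
      (pow_ne_zero m (Nat.cast_ne_zero.mpr hp.out.ne_zero))⟩, ?_⟩
    change ((ℓ : ℤ_[ℓ]) ^ m) • hatMap ℓ i y = 0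
    refine (pow_smul_eq (ℓ := ℓ) m (hatMap ℓ i y)).trans ?_
    refine ext' fun n => ?_
    obtain ⟨t, ht⟩ := exists_rep y n
    change ℓ ^ m • (hatMap ℓ i y).1 n = 0
    rw [hatMap_apply i y ht, ← map_nsmul]
    have hfin : IsOfFinOrder (i t).toMul := isOfFinAddOrder_ofMul_iff.mp t.2
    obtain ⟨w, hw⟩ := hm n _ hfin
    have : ℓ ^ m • i t = ℓ ^ n • Additive.ofMul w := hw.symm
    rw [this, map_nsmul, ModPow.pow_nsmul_eq_zero]

theorem torsionFreeQuot_iff {S : Submodule ℤ_[ℓ] (FieldHat ℓ K)} :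
    TorsionFreeQuot ℓ S ↔ IsClosed (S : Set (FieldHat ℓ K)) ∧
      ∀ r : ℤ_[ℓ], r ≠ 0 → ∀ x : FieldHat ℓ K, r • x ∈ S → x ∈ S := by
  refine and_congr_right fun _ => ?_
  rw [Module.isTorsionFree_iff_smul_eq_zero]
  constructor
  · intro h r hr x hx
    have := h r (S.mkQ x) (by
      rw [← map_smul]
      exact (Submodule.Quotient.mk_eq_zero S).mpr hx)
    exact (Submodule.Quotient.mk_eq_zero S).mp (this.resolve_left hr)
  · intro h r x
    obtain ⟨x, rfl⟩ := S.mkQ_surjective x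
    intro hx
    by_cases hr : r = 0
    · exact Or.inl hr
    · rw [← map_smul] at hx
      exact Or.inr ((Submodule.Quotient.mk_eq_zero S).mpr
        (h r hr x ((Submodule.Quotient.mk_eq_zero S).mp hx)))

/-- The characters whose extension to the completion vanishes on `S`. -/
def perpHat (S : Submodule ℤ_[ℓ] (FieldHat ℓ K)) : Set (Ch ℤ_[ℓ] K) :=
  {f | ∀ x ∈ S, extend f x = 0}

theorem torsionFreeQuot_of_mem_iff {S : Submodule ℤ_[ℓ] (FieldHat ℓ K)} {D : Set (Ch ℤ_[ℓ] K)}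
    (h : ∀ x, x ∈ S ↔ ∀ f ∈ D, extend f x = 0) : TorsionFreeQuot ℓ S := by
  rw [torsionFreeQuot_iff]
  constructor
  · have : (S : Set (FieldHat ℓ K)) = ⋂ f ∈ D, {x | extend f x = 0} := by
      ext x
      rw [SetLike.mem_coe, h, Set.mem_iInter₂]
      rfl
    rw [this]
    exact isClosed_biInter fun f _ => isClosed_ker_extend f
  · intro r hr x hx
    rw [h] at hx ⊢
    intro f hf
    have := hx f hf
    rw [map_smul, smul_eq_mul] at this
    exact (mul_eq_zero.mp this).resolve_left hr

theorem perpHat_subset_iff {S S' : Submodule ℤ_[ℓ] (FieldHat ℓ K)} (hS' : TorsionFreeQuot ℓ S') :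
    S ≤ S' ↔ perpHat S' ⊆ perpHat S := by
  refine ⟨fun h f hf x hx => hf x (h hx), fun h x hx => ?_⟩
  by_contra hn
  rw [torsionFreeQuot_iff] at hS'
  obtain ⟨f, hf, hfx⟩ := exists_extend_ne_zero hS'.1 hS'.2 hn
  exact hfx (h hf x hx)

/-- The quotient is isomorphic to the image of the functional, an ideal of `ℤ_ℓ`, hence principal.
-/
theorem torsionFreeCyclicQuot_ker (f : Ch ℤ_[ℓ] K) :
    TorsionFreeCyclicQuot ℓ (LinearMap.ker (extend f) : Submodule ℤ_[ℓ] (FieldHat ℓ K)) := by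
  refine ⟨torsionFreeQuot_of_mem_iff (D := {f}) fun x => by simp, ?_⟩
  obtain ⟨⟨a, ha⟩⟩ := IsPrincipalIdealRing.principal (LinearMap.range (extend f) : Ideal ℤ_[ℓ])
  have ha' : a ∈ LinearMap.range (extend f) := by
    rw [ha]
    exact Submodule.mem_span_singleton_self a
  obtain ⟨e, rfl⟩ := ha'
  refine ⟨⟨(LinearMap.ker (extend f)).mkQ e, ?_⟩⟩
  symm
  rw [Submodule.eq_top_iff']
  intro x
  obtain ⟨x, rfl⟩ := Submodule.mkQ_surjective _ x
  have hx : extend f x ∈ LinearMap.range (extend f) := ⟨x, rfl⟩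
  rw [ha] at hx
  obtain ⟨c, hc⟩ := Submodule.mem_span_singleton.mp hx
  refine Submodule.mem_span_singleton.mpr ⟨c, ?_⟩
  rw [← map_smul, Submodule.mkQ_apply, Submodule.mkQ_apply, Submodule.Quotient.eq,
    LinearMap.mem_ker, map_sub, map_smul, hc, sub_self]

theorem exists_ker_eq {H : Submodule ℤ_[ℓ] (FieldHat ℓ K)} (hH : TorsionFreeCyclicQuot ℓ H) :
    ∃ f : Ch ℤ_[ℓ] K, H = LinearMap.ker (extend f) := by
  obtain ⟨htf, ⟨⟨g, hg⟩⟩⟩ := hH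
  obtain ⟨e, rfl⟩ := H.mkQ_surjective g
  have hrep : ∀ x, ∃ c : ℤ_[ℓ], x - c • e ∈ H := by
    intro x
    have hx : H.mkQ x ∈ (⊤ : Submodule ℤ_[ℓ] (FieldHat ℓ K ⧸ H)) := trivial
    rw [hg] at hx
    obtain ⟨c, hc⟩ := Submodule.mem_span_singleton.mp hx
    refine ⟨c, ?_⟩
    rw [← map_smul, Submodule.mkQ_apply, Submodule.mkQ_apply] at hc
    exact (Submodule.Quotient.eq H).mp hc.symm
  rw [torsionFreeQuot_iff] at htf
  by_cases he : e ∈ H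
  · refine ⟨0, le_antisymm (fun x _ => ?_) fun x _ => ?_⟩
    · have : extend (0 : Ch ℤ_[ℓ] K) = 0 := extend_eq fun w => rfl
      rw [LinearMap.mem_ker, this, LinearMap.zero_apply]
    · obtain ⟨c, hc⟩ := hrep x
      rw [← sub_add_cancel x (c • e)]
      exact H.add_mem hc (H.smul_mem c he)
  · obtain ⟨f, hf, hfe⟩ := exists_extend_ne_zero htf.1 htf.2 he
    refine ⟨f, le_antisymm hf fun x hx => ?_⟩
    obtain ⟨c, hc⟩ := hrep x
    have h1 := hf _ hc
    rw [map_sub, LinearMap.mem_ker.mp hx, zero_sub, neg_eq_zero, map_smul, smul_eq_mul] at h1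
    rw [(mul_eq_zero.mp h1).resolve_right hfe, zero_smul, sub_zero] at hc
    exact hc

/-- As for `rigid_chKer_iff`, except that over `ℤ_ℓ` a vanishing determinant makes one of the two
vectors a multiple of the other, and divisibility decides which of `x`, `y` generates. -/
theorem rigidHat_ker_iff {f g : Ch ℤ_[ℓ] K} :
    RigidHat ℓ (LinearMap.ker (extend f) ⊓ LinearMap.ker (extend g) :
      Submodule ℤ_[ℓ] (FieldHat ℓ K)) ↔ Comm f g := by
  set S : Submodule ℤ_[ℓ] (FieldHat ℓ K) :=
    LinearMap.ker (extend f) ⊓ LinearMap.ker (extend g) with hS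
  have hmem : ∀ x, x ∈ S ↔ extend f x = 0 ∧ extend g x = 0 := fun x => Iff.rfl
  constructor
  · intro h x y hxy
    by_cases hx : unitsToHat ℓ x ∈ S
    · have := (hmem _).mp hx
      rw [extend_unitsToHat, extend_unitsToHat] at this
      rw [this.1, this.2]
      ring
    · obtain ⟨⟨w, hw⟩⟩ := h x y hxy hx
      obtain ⟨w, rfl⟩ := S.mkQ_surjective w
      have hrep : ∀ z ∈ Submodule.span ℤ_[ℓ] {unitsToHat ℓ x, unitsToHat ℓ y}, ∃ c : ℤ_[ℓ],
          extend f z = c * extend f w ∧ extend g z = c * extend g w := by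
        intro z hz
        have hz' := Submodule.mem_map_of_mem (f := S.mkQ) hz
        rw [hw] at hz'
        obtain ⟨c, hc⟩ := Submodule.mem_span_singleton.mp hz'
        rw [← map_smul, Submodule.mkQ_apply, Submodule.mkQ_apply] at hc
        obtain ⟨h1, h2⟩ := (hmem _).mp ((Submodule.Quotient.eq S).mp hc.symm)
        rw [map_sub, map_smul, smul_eq_mul, sub_eq_zero] at h1 h2
        exact ⟨c, h1, h2⟩
      obtain ⟨n, h1, h2⟩ := hrep (unitsToHat ℓ x) (Submodule.subset_span (by simp))
      obtain ⟨m, h3, h4⟩ := hrep (unitsToHat ℓ y) (Submodule.subset_span (by simp))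
      rw [extend_unitsToHat] at h1 h2 h3 h4
      rw [h1, h2, h3, h4]
      ring
  · intro h x y hxy hx
    have aux : ∀ f g : Ch ℤ_[ℓ] K, Comm f g → ev f x ≠ 0 → ∃ c : ℤ_[ℓ],
        (ev f y = c * ev f x ∧ ev g y = c * ev g x) ∨
        (ev f x = c * ev f y ∧ ev g x = c * ev g y) := by
      intro f g h hfx
      rcases ValuationRing.dvd_total (ev f x) (ev f y) with ⟨c, hc⟩ | ⟨c, hc⟩
      · refine ⟨c, Or.inl ⟨by rw [hc]; ring, ?_⟩⟩
        apply mul_left_cancel₀ hfx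
        rw [h x y hxy, hc]
        ring
      · have hfy : ev f y ≠ 0 := by
          intro h0
          rw [h0, zero_mul] at hc
          exact hfx hc
        refine ⟨c, Or.inr ⟨by rw [hc]; ring, ?_⟩⟩
        apply mul_left_cancel₀ hfy
        rw [← h x y hxy, hc]
        ring
    have key : ∃ c : ℤ_[ℓ], unitsToHat ℓ y - c • unitsToHat ℓ x ∈ S ∨
        unitsToHat ℓ x - c • unitsToHat ℓ y ∈ S := by
      simp only [hmem, map_sub, map_smul, smul_eq_mul, extend_unitsToHat, sub_eq_zero]
      by_cases hf : ev f x = 0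
      · have hg : ev g x ≠ 0 := fun hg => hx ((hmem _).mpr ⟨by simpa using hf, by simpa using hg⟩)
        obtain ⟨c, hc⟩ := aux g f h.symm hg
        exact ⟨c, hc.imp And.symm And.symm⟩
      · exact aux f g h hf
    have prin : ∀ (p q : FieldHat ℓ K) (c : ℤ_[ℓ]), q - c • p ∈ S →
        ((Submodule.span ℤ_[ℓ] {p, q}).map S.mkQ).IsPrincipal := by
      intro p q c hc
      refine ⟨⟨S.mkQ p, ?_⟩⟩
      have hq : S.mkQ q = c • S.mkQ p := by
        rw [← map_smul, Submodule.mkQ_apply, Submodule.mkQ_apply]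
        exact (Submodule.Quotient.eq S).mpr hc
      rw [Submodule.map_span, Set.image_pair, hq]
      refine le_antisymm (Submodule.span_le.mpr ?_) (Submodule.span_mono (by simp))
      rintro z (rfl | rfl)
      · exact Submodule.mem_span_singleton_self _
      · exact Submodule.smul_mem _ c (Submodule.mem_span_singleton_self _)
    obtain ⟨c, hc | hc⟩ := key
    · exact prin _ _ c hc
    · rw [Set.pair_comm]
      exact prin _ _ c hc

theorem mem_bigHHat_iff {S : Submodule ℤ_[ℓ] (FieldHat ℓ K)} {x : FieldHat ℓ K} :
    x ∈ bigHHat ℓ S ↔ ∀ f ∈ ctr (perpHat S), extend f x = 0 := by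
  unfold bigHHat
  rw [Submodule.mem_sInf]
  constructor
  · rintro h f ⟨hf, hc⟩
    refine h (LinearMap.ker (extend f)) ⟨hf, torsionFreeCyclicQuot_ker f, fun H' hH' hcyc => ?_⟩
    obtain ⟨g, rfl⟩ := exists_ker_eq hcyc
    exact rigidHat_ker_iff.mpr (hc g hH')
  · rintro h H ⟨hSH, hcyc, hr⟩
    obtain ⟨f, rfl⟩ := exists_ker_eq hcyc
    refine h f ⟨hSH, fun g hg => ?_⟩
    exact rigidHat_ker_iff.mp (hr (LinearMap.ker (extend g)) hg (torsionFreeCyclicQuot_ker g))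

theorem le_bigHHat {S : Submodule ℤ_[ℓ] (FieldHat ℓ K)} : S ≤ bigHHat ℓ S := le_sInf fun _ h => h.1

/-- The argument of `perp_bigH` in additive form, with `ℤ_ℓ`-coefficients. -/
theorem perpHat_bigHHat {S : Submodule ℤ_[ℓ] (FieldHat ℓ K)} :
    perpHat (bigHHat ℓ S) = ctr (perpHat S) := by
  refine Set.Subset.antisymm (fun f hf => ?_) fun f hf x hx => mem_bigHHat_iff.mp hx f hf
  refine ⟨fun x hx => hf x (le_bigHHat hx), fun g hg x y hxy => ?_⟩
  have h1 : ev g y • unitsToHat ℓ x - ev g x • unitsToHat ℓ y ∈ bigHHat ℓ S := by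
    rw [mem_bigHHat_iff]
    intro h hh
    rw [map_sub, map_smul, map_smul, extend_unitsToHat, extend_unitsToHat, smul_eq_mul,
      smul_eq_mul]
    linear_combination hh.2 g hg x y hxy
  have h2 := hf _ h1
  rw [map_sub, map_smul, map_smul, extend_unitsToHat, extend_unitsToHat, smul_eq_mul,
    smul_eq_mul] at h2
  linear_combination h2

/-- `ℤ_ℓ` has no 2-torsion; this is why `-1` does not appear in the pro-ℓ definitions. -/
theorem mem_full_padic (f : Ch ℤ_[ℓ] K) : f ∈ full K ℤ_[ℓ] := by
  have h1 : (2 : ℤ_[ℓ]) * ev f (-1) = 0 := by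
    rw [two_mul, ← ev_mul, neg_one_mul, neg_neg, ev_one]
  exact (mul_eq_zero.mp h1).resolve_left two_ne_zero

theorem full_padic : full K ℤ_[ℓ] = Set.univ := Set.eq_univ_of_forall mem_full_padic

/-! ### The duals of `UHat` and `U1Hat`, and lifting from the residue field. -/

variable {A : ValuationSubring K}

theorem mem_UHat_iff {x : FieldHat ℓ K} :
    x ∈ UHat ℓ A ↔ ∀ f ∈ inr ℤ_[ℓ] A, extend f x = 0 := by
  constructor
  · rintro ⟨y, rfl⟩ f hf
    rw [unitsHatIncl, extend_hatMap]
    have : extend (f.comp (MonoidHom.toAdditive A.unitGroup.subtype)) = 0 :=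
      extend_eq fun u => (hf _ u.toMul.2).symm
    rw [this, LinearMap.zero_apply]
  · intro h
    refine mem_range_hatMap_of_extend Subtype.val_injective ?_ fun f hf =>
      h f fun u hu => hf (Additive.ofMul ⟨u, hu⟩)
    rintro n w ⟨u, hu⟩
    have h1 : w.toMul ^ ℓ ^ n ∈ A.unitGroup := by
      have : w.toMul ^ ℓ ^ n = A.unitGroup.subtype u.toMul := hu.symm
      rw [this]
      exact u.toMul.2
    exact ⟨Additive.ofMul ⟨w.toMul, unitGroup_root (pow_ne_zero n hp.out.ne_zero) h1⟩, rfl⟩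

theorem unitsHatIncl_injective : Function.Injective (unitsHatIncl ℓ A) := by
  refine hatMap_injective Subtype.val_injective ?_
  rintro n w ⟨u, hu⟩
  have h1 : w.toMul ^ ℓ ^ n ∈ A.unitGroup := by
    have : w.toMul ^ ℓ ^ n = A.unitGroup.subtype u.toMul := hu.symm
    rw [this]
    exact u.toMul.2
  exact ⟨Additive.ofMul ⟨w.toMul, unitGroup_root (pow_ne_zero n hp.out.ne_zero) h1⟩, rfl⟩

theorem unitsHatRes_surjective : Function.Surjective (unitsHatRes ℓ A) :=
  hatMap_surjective (rs_surjective A)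

theorem Lifts.extend_eq {f : Ch ℤ_[ℓ] K} {h : Ch ℤ_[ℓ] (IsLocalRing.ResidueField A)}
    (hl : Lifts A f h) (y : Hat ℓ (Additive A.unitGroup)) :
    extend f (unitsHatIncl ℓ A y) = extend h (unitsHatRes ℓ A y) := by
  rw [unitsHatIncl, unitsHatRes, extend_hatMap, extend_hatMap]
  congr 2
  exact AddMonoidHom.ext fun u => hl u.toMul

theorem mem_U1Hat_iff' {x : FieldHat ℓ K} :
    x ∈ U1Hat ℓ A ↔ ∃ y, unitsHatRes ℓ A y ∈ tor ℓ (FieldHat ℓ (IsLocalRing.ResidueField A)) ∧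
      unitsHatIncl ℓ A y = x := by
  rw [U1Hat, Submodule.mem_map]
  refine exists_congr fun y => and_congr_left fun _ => ?_
  rw [LinearMap.mem_ker, LinearMap.comp_apply, Submodule.mkQ_apply, Submodule.Quotient.mk_eq_zero]

/-- By `mem_tor_iff` the torsion of the residue completion is the common kernel of its functionals,
and their characters are exactly those induced by `dec`. -/
theorem mem_U1Hat_iff {x : FieldHat ℓ K} :
    x ∈ U1Hat ℓ A ↔ ∀ f ∈ dec ℤ_[ℓ] A, extend f x = 0 := by
  rw [mem_U1Hat_iff']
  constructor
  · rintro ⟨y, hy, rfl⟩ f hf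
    obtain ⟨h, -, hl⟩ := exists_residue_ch hf
    rw [hl.extend_eq]
    exact mem_tor_iff.mp hy h
  · intro hx
    obtain ⟨y, rfl⟩ : x ∈ UHat ℓ A := mem_UHat_iff.mpr fun f hf => hx f (inr_subset_dec A hf)
    refine ⟨y, mem_tor_iff.mpr fun h => ?_, rfl⟩
    obtain ⟨f, hf, hl⟩ := exists_lift_ch (A := A) (mem_full_padic h)
    rw [← hl.extend_eq]
    exact hx f hf

theorem perpHat_UHat : perpHat (UHat ℓ A) = inr ℤ_[ℓ] A := by
  refine Set.Subset.antisymm (fun f hf u hu => ?_) fun f hf x hx => mem_UHat_iff.mp hx f hf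
  rw [← extend_unitsToHat]
  exact hf _ ⟨toHat ℓ _ (Additive.ofMul ⟨u, hu⟩), rfl⟩

theorem perpHat_U1Hat : perpHat (U1Hat ℓ A) = dec ℤ_[ℓ] A := by
  refine Set.Subset.antisymm (fun f hf => ⟨mem_full_padic f, fun u hu => ?_⟩)
    fun f hf x hx => mem_U1Hat_iff.mp hx f hf
  rw [← extend_unitsToHat]
  refine hf _ (mem_U1Hat_iff.mpr fun g hg => ?_)
  rw [extend_unitsToHat]
  exact hg.2 u hu

theorem bigHHat_tor_eq_top_iff :
    bigHHat ℓ (tor ℓ (FieldHat ℓ K)) = ⊤ ↔ ctr (full K ℤ_[ℓ]) = {0} := by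
  have h1 : perpHat (tor ℓ (FieldHat ℓ K)) = full K ℤ_[ℓ] := by
    rw [full_padic]
    exact Set.eq_univ_of_forall fun f x hx => mem_tor_iff.mp hx f
  rw [← h1]
  constructor
  · intro h
    rw [← perpHat_bigHHat, h]
    refine Set.Subset.antisymm (fun f hf => ch_ext fun x => ?_) ?_
    · rw [← extend_unitsToHat, ev_zero]
      exact hf _ trivial
    · rintro _ rfl x -
      have : extend (0 : Ch ℤ_[ℓ] K) = 0 := extend_eq fun w => rfl
      rw [this, LinearMap.zero_apply]
  · intro h
    rw [Submodule.eq_top_iff']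
    intro x
    rw [mem_bigHHat_iff, h]
    rintro _ rfl
    have : extend (0 : Ch ℤ_[ℓ] K) = 0 := extend_eq fun w => rfl
    rw [this, LinearMap.zero_apply]

theorem isPrincipal_tor_iff (h : ctr (full K ℤ_[ℓ]) = {0}) :
    Module.IsPrincipal ℤ_[ℓ] (FieldHat ℓ K ⧸ tor ℓ (FieldHat ℓ K)) ↔ full K ℤ_[ℓ] = {0} := by
  constructor
  · rintro ⟨⟨e, he⟩⟩
    rw [← h]
    refine Set.Subset.antisymm (fun f hf => ⟨hf, fun g hg x y _ => ?_⟩) fun f hf => hf.1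
    obtain ⟨e, rfl⟩ := Submodule.mkQ_surjective _ e
    have hrep : ∀ z : Kˣ, ∃ c : ℤ_[ℓ], ∀ f : Ch ℤ_[ℓ] K, ev f z = c * extend f e := by
      intro z
      have hz : (tor ℓ (FieldHat ℓ K)).mkQ (unitsToHat ℓ z) ∈
          (⊤ : Submodule ℤ_[ℓ] (FieldHat ℓ K ⧸ tor ℓ (FieldHat ℓ K))) := trivial
      rw [he] at hz
      obtain ⟨c, hc⟩ := Submodule.mem_span_singleton.mp hz
      rw [← map_smul, Submodule.mkQ_apply, Submodule.mkQ_apply] at hc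
      have h1 := (Submodule.Quotient.eq _).mp hc.symm
      refine ⟨c, fun f => ?_⟩
      have := mem_tor_iff.mp h1 f
      rwa [map_sub, map_smul, extend_unitsToHat, smul_eq_mul, sub_eq_zero] at this
    obtain ⟨n, hn⟩ := hrep x
    obtain ⟨m, hm⟩ := hrep y
    rw [hn, hn, hm, hm]
    ring
  · intro hfull
    have htop : tor ℓ (FieldHat ℓ K) = ⊤ := by
      rw [Submodule.eq_top_iff']
      intro x
      rw [mem_tor_iff]
      intro f
      have hf := mem_full_padic f
      rw [hfull] at hf
      rw [show f = 0 from hf]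
      have : extend (0 : Ch ℤ_[ℓ] K) = 0 := Hat.extend_eq fun w => rfl
      rw [this, LinearMap.zero_apply]
    have hsub : Subsingleton (FieldHat ℓ K ⧸ tor ℓ (FieldHat ℓ K)) :=
      Submodule.Quotient.subsingleton_iff.mpr htop
    exact ⟨⟨0, Subsingleton.elim _ _⟩⟩

theorem VHat_eq : VHat ℓ K = VCh ℤ_[ℓ] ℓ K := by
  ext A
  refine and_congr_right fun _ => ?_
  rw [bigHHat_tor_eq_top_iff, ctr_dec_eq_iff, and_comm]
  refine and_congr_right fun h => ?_
  rw [isPrincipal_tor_iff h, Ne, dec_eq_inr_iff]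

theorem bijOn_U1Hat : Set.BijOn (U1Hat ℓ) (VHat ℓ K) (THat ℓ K) ∧
    ∀ A ∈ VHat ℓ K, Set.BijOn (U1Hat ℓ) (VHatRel ℓ A) (THatRel ℓ A) := by
  obtain ⟨h1, h2⟩ := bijOn_of_perp (ℓ := ℓ) (K := K) (R := ℤ_[ℓ])
    (ok := {S : Submodule ℤ_[ℓ] (FieldHat ℓ K) | TorsionFreeQuot ℓ S}) (perp := perpHat)
    (H := bigHHat ℓ) (u1 := U1Hat ℓ) (u := UHat ℓ)
    (fun S _ S' hS' => perpHat_subset_iff hS')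
    (fun S _ => ⟨torsionFreeQuot_of_mem_iff fun x => mem_bigHHat_iff, perpHat_bigHHat⟩)
    (fun S _ f _ => mem_full_padic f)
    (fun A => ⟨torsionFreeQuot_of_mem_iff fun x => mem_U1Hat_iff, perpHat_U1Hat⟩)
    (fun A => ⟨torsionFreeQuot_of_mem_iff fun x => mem_UHat_iff, perpHat_UHat⟩)
  rw [← VHat_eq] at h1
  have e : {S : Submodule ℤ_[ℓ] (FieldHat ℓ K) | S ∈ {S | TorsionFreeQuot ℓ S} ∧
      (∀ S' ∈ {S | TorsionFreeQuot ℓ S}, S' ≤ S → S' ≠ S → ¬ bigHHat ℓ S' ≤ bigHHat ℓ S) ∧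
      S ≠ bigHHat ℓ S} = THat ℓ K := by
    ext S
    refine and_congr_right fun _ => and_congr_left fun _ => ?_
    exact forall_congr' fun S' => ⟨fun h a b => h b a, fun h a b => h b a⟩
  rw [e] at h1
  refine ⟨h1, fun A hA => ?_⟩
  have := h2 A hA.1
  rw [← VHat_eq] at this
  have e' : THatRel ℓ A = {S : Submodule ℤ_[ℓ] (FieldHat ℓ K) | (S ∈ {S | TorsionFreeQuot ℓ S} ∧
      (∀ S' ∈ {S | TorsionFreeQuot ℓ S}, S' ≤ S → S' ≠ S → ¬ bigHHat ℓ S' ≤ bigHHat ℓ S) ∧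
      S ≠ bigHHat ℓ S) ∧ U1Hat ℓ A ≤ S ∧ S ≤ bigHHat ℓ S ∧ bigHHat ℓ S ≤ UHat ℓ A} := by
    ext S
    exact and_congr_left fun _ => by rw [← e]; rfl
  rw [e']
  exact this

theorem tor_le_of_torsionFreeQuot {S : Submodule ℤ_[ℓ] (FieldHat ℓ K)}
    (hS : TorsionFreeQuot ℓ S) : tor ℓ (FieldHat ℓ K) ≤ S := by
  intro x hx
  obtain ⟨⟨a, ha⟩, h⟩ := (Submodule.mem_torsion_iff x).mp hx
  refine (torsionFreeQuot_iff.mp hS).2 a (nonZeroDivisors.ne_zero ha) x ?_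
  have h' : a • x = 0 := h
  rw [h']
  exact S.zero_mem

theorem residueSubmodule_eq_iff {S' : Submodule ℤ_[ℓ] (FieldHat ℓ (IsLocalRing.ResidueField A))}
    (hS' : tor ℓ (FieldHat ℓ (IsLocalRing.ResidueField A)) ≤ S')
    (S : Submodule ℤ_[ℓ] (FieldHat ℓ K)) :
    (U1Hat ℓ A ≤ S ∧ S ≤ UHat ℓ A ∧ residueSubmodule ℓ A S = S') ↔ S = liftSubmodule ℓ A S' := by
  constructor
  · rintro ⟨h1, h2, rfl⟩
    ext x
    constructor
    · intro hx
      obtain ⟨y, rfl⟩ := h2 hx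
      exact ⟨y, ⟨y, hx, rfl⟩, rfl⟩
    · rintro ⟨y, ⟨z, hz, hzy⟩, rfl⟩
      have h3 : unitsHatIncl ℓ A (y - z) ∈ S := by
        refine h1 (mem_U1Hat_iff'.mpr ⟨_, ?_, rfl⟩)
        rw [map_sub, hzy, sub_self]
        exact Submodule.zero_mem _
      rw [← sub_add_cancel y z, map_add]
      exact S.add_mem h3 hz
  · rintro rfl
    refine ⟨fun x hx => ?_, ?_, ?_⟩
    · obtain ⟨y, hy, rfl⟩ := mem_U1Hat_iff'.mp hx
      exact ⟨y, hS' hy, rfl⟩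
    · rintro _ ⟨y, -, rfl⟩
      exact ⟨y, rfl⟩
    · rw [residueSubmodule, liftSubmodule,
        Submodule.comap_map_eq_of_injective unitsHatIncl_injective,
        Submodule.map_comap_eq_of_surjective unitsHatRes_surjective]

theorem liftSubmodule_U1Hat (B : ValuationSubring (IsLocalRing.ResidueField A)) :
    liftSubmodule ℓ A (U1Hat ℓ B) = U1Hat ℓ (compVal A B) := by
  ext x
  rw [mem_U1Hat_iff]
  constructor
  · rintro ⟨y, hy, rfl⟩ f hf
    obtain ⟨h, -, hl⟩ := exists_residue_ch (dec_mono (compVal_le B) hf)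
    rw [hl.extend_eq]
    exact mem_U1Hat_iff.mp hy h ((hl.mem_dec_compVal_iff hf.1).mp hf)
  · intro hx
    obtain ⟨y, rfl⟩ : x ∈ UHat ℓ A := mem_UHat_iff.mpr fun f hf =>
      hx f (inr_subset_dec _ (inr_anti (compVal_le B) hf))
    refine ⟨y, mem_U1Hat_iff.mpr fun h hh => ?_, rfl⟩
    obtain ⟨f, hf, hl⟩ := exists_lift_ch (A := A) hh.1
    rw [← hl.extend_eq]
    exact hx f ((hl.mem_dec_compVal_iff hf.1).mpr hh)

end ProEllDuality

/-- Supplies the bijection between the two classes of subgroups (or submodules) from the other three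
sides of the square. -/
theorem bijOn_of_square {α β γ δ : Type*} {X : Set α} {Y : Set β} {Z : Set γ} {W : Set δ}
    {f : α → β} {g : α → γ} {h : γ → δ} {l : β → δ} (hf : Set.BijOn f X Y) (hg : Set.BijOn g X Z)
    (hh : Set.BijOn h Z W) (hl : ∀ a ∈ X, l (f a) = h (g a)) : Set.BijOn l Y W := by
  rw [← hf.image_eq, ← Set.bijOn_comp_iff hf.injOn]
  exact (hh.comp hg).congr fun a ha => (hl a ha).symm

end RigidVal

/-! ### The theorem. -/

theorem mainTheorem11 (ℓ : ℕ) [Fact ℓ.Prime] (K : Type*) [Field K] :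
    -- the mod-ℓ case
    (Set.BijOn (RigidVal.U1 ℓ) (RigidVal.V ℓ K) (RigidVal.T ℓ K) ∧
      ∀ A ∈ RigidVal.V ℓ K,
        Set.BijOn (RigidVal.U1 ℓ) (RigidVal.Vrel ℓ A) (RigidVal.Trel ℓ A) ∧
        Set.BijOn (RigidVal.U1 ℓ) (RigidVal.V ℓ (IsLocalRing.ResidueField A))
          (RigidVal.T ℓ (IsLocalRing.ResidueField A)) ∧
        Set.BijOn (RigidVal.compVal A) (RigidVal.V ℓ (IsLocalRing.ResidueField A))
          (RigidVal.Vrel ℓ A) ∧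
        Set.BijOn (RigidVal.liftSubgroup ℓ A) (RigidVal.T ℓ (IsLocalRing.ResidueField A))
          (RigidVal.Trel ℓ A) ∧
        (∀ S' ∈ RigidVal.T ℓ (IsLocalRing.ResidueField A), ∀ S : Subgroup Kˣ,
          (RigidVal.U1 ℓ A ≤ S ∧ S ≤ RigidVal.U ℓ A ∧ RigidVal.residueSubgroup A S = S') ↔
            S = RigidVal.liftSubgroup ℓ A S') ∧
        ∀ B ∈ RigidVal.V ℓ (IsLocalRing.ResidueField A),
          RigidVal.liftSubgroup ℓ A (RigidVal.U1 ℓ B) =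
            RigidVal.U1 ℓ (RigidVal.compVal A B)) ∧
    -- the pro-ℓ case
    (Set.BijOn (RigidVal.U1Hat ℓ) (RigidVal.VHat ℓ K) (RigidVal.THat ℓ K) ∧
      ∀ A ∈ RigidVal.VHat ℓ K,
        Set.BijOn (RigidVal.U1Hat ℓ) (RigidVal.VHatRel ℓ A) (RigidVal.THatRel ℓ A) ∧
        Set.BijOn (RigidVal.U1Hat ℓ) (RigidVal.VHat ℓ (IsLocalRing.ResidueField A))
          (RigidVal.THat ℓ (IsLocalRing.ResidueField A)) ∧
        Set.BijOn (RigidVal.compVal A) (RigidVal.VHat ℓ (IsLocalRing.ResidueField A))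
          (RigidVal.VHatRel ℓ A) ∧
        Set.BijOn (RigidVal.liftSubmodule ℓ A) (RigidVal.THat ℓ (IsLocalRing.ResidueField A))
          (RigidVal.THatRel ℓ A) ∧
        (∀ S' ∈ RigidVal.THat ℓ (IsLocalRing.ResidueField A),
          ∀ S : Submodule ℤ_[ℓ] (RigidVal.FieldHat ℓ K),
          (RigidVal.U1Hat ℓ A ≤ S ∧ S ≤ RigidVal.UHat ℓ A ∧
            RigidVal.residueSubmodule ℓ A S = S') ↔ S = RigidVal.liftSubmodule ℓ A S') ∧
        ∀ B ∈ RigidVal.VHat ℓ (IsLocalRing.ResidueField A),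
          RigidVal.liftSubmodule ℓ A (RigidVal.U1Hat ℓ B) =
            RigidVal.U1Hat ℓ (RigidVal.compVal A B)) := by
  constructor
  · refine ⟨RigidVal.bijOn_U1.1, fun A hA => ?_⟩
    have hk := (RigidVal.bijOn_U1 (ℓ := ℓ) (K := IsLocalRing.ResidueField A)).1
    have hrel := RigidVal.bijOn_U1.2 A hA
    have hcomp : Set.BijOn (RigidVal.compVal A) (RigidVal.V ℓ (IsLocalRing.ResidueField A))
        (RigidVal.Vrel ℓ A) := by
      have := RigidVal.bijOn_compVal (R := ZMod ℓ) hA.1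
      rwa [← RigidVal.V_eq, ← RigidVal.V_eq] at this
    exact ⟨hrel, hk, hcomp,
      RigidVal.bijOn_of_square hk hcomp hrel fun B _ => RigidVal.liftSubgroup_U1 B,
      fun S' hS' S => RigidVal.residueSubgroup_eq_iff hS'.1 S,
      fun B _ => RigidVal.liftSubgroup_U1 B⟩
  · refine ⟨RigidVal.bijOn_U1Hat.1, fun A hA => ?_⟩
    have hk := (RigidVal.bijOn_U1Hat (ℓ := ℓ) (K := IsLocalRing.ResidueField A)).1
    have hrel := RigidVal.bijOn_U1Hat.2 A hA
    have hcomp : Set.BijOn (RigidVal.compVal A) (RigidVal.VHat ℓ (IsLocalRing.ResidueField A))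
        (RigidVal.VHatRel ℓ A) := by
      have := RigidVal.bijOn_compVal (R := ℤ_[ℓ]) hA.1
      rwa [← RigidVal.VHat_eq, ← RigidVal.VHat_eq] at this
    exact ⟨hrel, hk, hcomp,
      RigidVal.bijOn_of_square hk hcomp hrel fun B _ => RigidVal.liftSubmodule_U1Hat B,
      fun S' hS' S =>
        RigidVal.residueSubmodule_eq_iff (RigidVal.tor_le_of_torsionFreeQuot hS'.1) S,
      fun B _ => RigidVal.liftSubmodule_U1Hat B⟩
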